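/- Let $\mathbf{k}$ be a field of characteristic zero, $H$ a cocommutative Hopf algebra over $\mathbf{k}$, and $\mathfrak g,\mathfrak h$ left $H$-modules. For a left $H$-module $N$ let $H^{\otimes n}\otimes_H N$ be formed with $H$ acting on $H^{\otimes n}$ on the right through the iterated coproduct, and let $C^n(M,N)$ be the space of $H^{\otimes n}$-linear maps $f:M^{\otimes n}\to H^{\otimes n}\otimes_H N$ that are skew-symmetric, i.e. $f(x_1,\dots,x_n)=(-1)^\sigma(\sigma\otimes_H\mathrm{id})f(x_{\sigma(1)},\dots,x_{\sigma(n)})$ for $\sigma\in S_n$, where $\sigma\otimes_H\mathrm{id}$ moves the $i$-th tensor factor of $H^{\otimes n}$ to position $\sigma(i)$. Give $C^{n+1}(M,N)$ the degree $n$. On $\bigoplus_{n\ge 0}C^{n+1}(M,M)$ let $[\cdot,\cdot]_{NR}$ be the Nijenhuis–Richardson bracket $$[f,g]_{NR}=f\circledcirc g-(-1)^{(p-1)(q-1)}g\circledcirc f,$$ $$(f\circledcirc g)(x_1,\dots,x_{p+q-1})=\sum_{\sigma\in S_{q,p-1}}(-1)^\sigma(\sigma\otimes_H\mathrm{id})f\big(g(x_{\sigma(1)},\dots,x_{\sigma(q)}),x_{\sigma(q+1)},\dots,x_{\sigma(p+q-1)}\big)$$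 for $f\in C^p(M,M)$, $g\in C^q(M,M)$, where $S_{q,p-1}$ is the set of $(q,p-1)$-shuffles. Let $\Omega\in C^2(\mathfrak g\boxplus\mathfrak h,\mathfrak g\boxplus\mathfrak h)$ be a Lie pseudobracket (that is, it satisfies the Jacobi identity) on the direct sum $\mathfrak g\boxplus\mathfrak h$ of $H$-modules, such that $\mathfrak h$ is a Lie subpseudoalgebra; in other words, $(\mathfrak g\boxplus\mathfrak h,\mathfrak g,\mathfrak h)$ is a quasi-twilled Lie pseudoalgebra. Its pseudobracket has components $\pi:\mathfrak g\otimes\mathfrak g\to H^{\otimes2}\otimes_H\mathfrak g$, $\rho:\mathfrak g\otimes\mathfrak h\to H^{\otimes2}\otimes_H\mathfrak h$, $\mu:\mathfrak h\otimes\mathfrak h\to H^{\otimes2}\otimes_H\mathfrak h$, $\eta:\mathfrak g\otimes\mathfrak h\to H^{\otimes2}\otimes_H\mathfrak g$, $\theta:\mathfrak g\otimes\mathfrak g\to H^{\otimes2}\otimes_H\mathfrak h$, and the same letters denote their skew-symmetric extensions by zero to $C^2(\mathfrak g\boxplus\mathfrak h,\mathfrak g\boxplus\mathfrak h)$. Then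 $\Omega=\pi+\rho+\mu+\eta+\theta$, and the following hold. (1) Let $\mathfrak J=\bigoplus_{n\ge0}C^{n+1}(\mathfrak g\boxplus\mathfrak h,\mathfrak g\boxplus\mathfrak h)$ with $[\cdot,\cdot]_{NR}$; let $\mathfrak K=\bigoplus_{n\ge0}C^{n+1}(\mathfrak g,\mathfrak h)$, embedded (injectively) in $\mathfrak J$ by letting $f$ act on the $\mathfrak g$-components of its arguments and regarding its values as values in $\mathfrak g\boxplus\mathfrak h$; and let $P:\mathfrak J\to\mathfrak J$ be the projection onto $\mathfrak K$ that restricts a cochain to arguments in $\mathfrak g$ and takes the $\mathfrak h$-component of its values. Then $(\mathfrak J,\mathfrak K,P,\Omega)$ is a curved $V$-datum: $\mathfrak J$ is a $\mathbb Z$-graded Lie algebra, $\mathfrak K$ is an abelian graded Lie subalgebra, $P$ is $\mathbf k$-linear with $P\circ P=P$, image $\mathfrak K$ and kernel a graded Lie subalgebra, and $\Omega$ has degree $1$ and $[\Omega,\Omega]_{NR}=0$. (2) The derived brackets $l_n(f_1,\dots,f_n)=P[\cdots[[\Omega,f_1]_{NR},f_2]_{NR},\cdots,f_n]_{NR}$,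 $n\ge0$, make $\mathfrak K$ a curved $L_\infty$-algebra: the $l_n:\mathfrak K^{\otimes n}\to\mathfrak K$ are $\mathbf k$-multilinear, graded symmetric and of degree $1$, and for all $n\ge0$ and all homogeneous $x_1,\dots,x_n\in\mathfrak K$ $$\sum_{i=0}^n\sum_{\sigma\in\mathrm{Sh}(i,n-i)}\epsilon(\sigma)\,l_{n-i+1}\big(l_i(x_{\sigma(1)},\dots,x_{\sigma(i)}),x_{\sigma(i+1)},\dots,x_{\sigma(n)}\big)=0,$$ where $\epsilon(\sigma)$ is the Koszul sign. Explicitly, $$l_0=\theta,\qquad l_1(f)=[\pi+\rho,f]_{NR},\qquad l_2(f_1,f_2)=[[\mu+\eta,f_1]_{NR},f_2]_{NR},\qquad l_n=0\ \ (n\ge3).$$ (3) An $H$-module homomorphism $D:\mathfrak g\to\mathfrak h$ is a deformation map of type I, i.e. satisfies $$(\mathrm{id}\otimes_HD)\big(\pi(x,y)+\eta(x,D(y))-((12)\otimes_H\mathrm{id})\eta(y,D(x))\big)$$ $$=\mu(D(x),D(y))+\rho(x,D(y))-((12)\otimes_H\mathrm{id})\rho(y,D(x))+\theta(x,y)$$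 for all $x,y\in\mathfrak g$, if and only if $D$, regarded as the element $x\mapsto 1\otimes_HD(x)$ of $C^1(\mathfrak g,\mathfrak h)\subset\mathfrak K$, satisfies the Maurer–Cartan equation $$l_0+l_1(D)+\tfrac12\,l_2(D,D)=0.$$ -/

import Mathlib

open scoped TensorProduct
open Coalgebra WithConv

set_option linter.unusedSectionVars false

namespace LiePseudo

noncomputable section

/-! ### Tensor powers of `H` and iterated coproducts -/

section TensorPower

variable (k H : Type*) [Field k] [Ring H] [HopfAlgebra k H]

/-- The tensor power `H^{⊗ι}`, a `k`-algebra with componentwise product. -/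
abbrev TPow (ι : Type*) : Type _ := PiTensorProduct k (fun _ : ι => H)

variable {ι κ : Type*}

/-- The algebra map `H^{⊗ι} → H^{⊗κ}` along an injection `ψ : ι ↪ κ`: the `i`-th tensor factor
goes to position `ψ i`, all other positions are filled with `1`. -/
def place (ψ : ι ↪ κ) : TPow k H ι →ₐ[k] TPow k H κ :=
  PiTensorProduct.liftAlgHom
    { toFun := fun h => PiTensorProduct.tprod k (Function.extend ψ h (1 : κ → H))
      map_update_add' := by
        intro _ h i a b
        classical
        have key : ∀ c : H, Function.extend ψ (Function.update h i c) (1 : κ → H)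
            = Function.update (Function.extend ψ h 1) (ψ i) c := by
          intro c; funext j
          by_cases hj : ∃ l, ψ l = j
          · obtain ⟨l, rfl⟩ := hj
            simp [ψ.injective.extend_apply, Function.update_apply]
          · rw [Function.extend_apply' _ _ _ hj, Function.update_of_ne, Function.extend_apply' _ _ _ hj]
            rintro rfl; exact hj ⟨i, rfl⟩
        have e : ‹DecidableEq ι› = Classical.decEq ι := Subsingleton.elim _ _
        subst e
        simp only [key, MultilinearMap.map_update_add]
      map_update_smul' := by
        intro _ h i a b
        classical
        have key : ∀ c : H, Function.extend ψ (Function.update h i c) (1 : κ → H)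
            = Function.update (Function.extend ψ h 1) (ψ i) c := by
          intro c; funext j
          by_cases hj : ∃ l, ψ l = j
          · obtain ⟨l, rfl⟩ := hj
            simp [ψ.injective.extend_apply, Function.update_apply]
          · rw [Function.extend_apply' _ _ _ hj, Function.update_of_ne, Function.extend_apply' _ _ _ hj]
            rintro rfl; exact hj ⟨i, rfl⟩
        have e : ‹DecidableEq ι› = Classical.decEq ι := Subsingleton.elim _ _
        subst e
        simp only [key, MultilinearMap.map_update_smul] }
    (by
      have : Function.extend ψ (1 : ι → H) (1 : κ → H) = 1 := by
        funext j
        by_cases hj : ∃ l, ψ l = j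
        · obtain ⟨l, rfl⟩ := hj; simp [ψ.injective.extend_apply]
        · rw [Function.extend_apply' _ _ _ hj]
      simp only [MultilinearMap.coe_mk, this]
      rfl)
    (by
      intro x y
      have : Function.extend ψ (x * y) (1 : κ → H)
          = Function.extend ψ x 1 * Function.extend ψ y 1 := by
        funext j
        by_cases hj : ∃ l, ψ l = j
        · obtain ⟨l, rfl⟩ := hj; simp [ψ.injective.extend_apply]
        · simp [Function.extend_apply' _ _ _ hj]
      simp only [MultilinearMap.coe_mk, this, PiTensorProduct.tprod_mul_tprod])

@[simp] theorem place_tprod (ψ : ι ↪ κ) (h : ι → H) :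
    place k H ψ (PiTensorProduct.tprod k h)
      = PiTensorProduct.tprod k (Function.extend ψ h (1 : κ → H)) := by
  simp [place]

variable {k H}

theorem commute_of_tprod {A B : TPow k H ι}
    (P Q : Set (ι → H))
    (hA : A ∈ Submodule.span k (PiTensorProduct.tprod k '' P))
    (hB : B ∈ Submodule.span k (PiTensorProduct.tprod k '' Q))
    (hPQ : ∀ p ∈ P, ∀ q ∈ Q, Commute p q) : Commute A B := by
  induction hA using Submodule.span_induction with
  | mem x hx =>
    obtain ⟨p, hp, rfl⟩ := hx
    induction hB using Submodule.span_induction with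
    | mem y hy => obtain ⟨q, hq, rfl⟩ := hy; exact (hPQ p hp q hq).tprod
    | zero => exact Commute.zero_right _
    | add a b _ _ ha hb => exact ha.add_right hb
    | smul c a _ ha => exact ha.smul_right c
  | zero => exact Commute.zero_left _
  | add a b _ _ ha hb => exact ha.add_left hb
  | smul c a _ ha => exact ha.smul_left c

theorem place_mem_span (ψ : ι ↪ κ) (x : TPow k H ι) :
    place k H ψ x ∈ Submodule.span k (PiTensorProduct.tprod k ''
      {p : κ → H | ∀ j, j ∉ Set.range ψ → p j = 1}) := by
  induction x using PiTensorProduct.induction_on with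
  | smul_tprod r h =>
    rw [map_smul, place_tprod]
    refine Submodule.smul_mem _ _ (Submodule.subset_span ⟨_, ?_, rfl⟩)
    intro j hj
    rw [Function.extend_apply' _ _ _ (by simpa using hj)]; rfl
  | add a b ha hb => rw [map_add]; exact Submodule.add_mem _ ha hb

theorem commute_of_support {A B : TPow k H κ} (S S' : Set κ) (hd : Disjoint S S')
    (hA : A ∈ Submodule.span k (PiTensorProduct.tprod k '' {p : κ → H | ∀ j, j ∉ S → p j = 1}))
    (hB : B ∈ Submodule.span k (PiTensorProduct.tprod k '' {p : κ → H | ∀ j, j ∉ S' → p j = 1})) :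
    Commute A B := by
  refine commute_of_tprod _ _ hA hB ?_
  intro p hp q hq
  refine funext fun j => ?_
  by_cases h1 : j ∈ S
  · have h2 : j ∉ S' := fun h => Set.disjoint_left.1 hd h1 h
    simp [hq j h2]
  · simp [hp j h1]

theorem place_commute {ι' : Type*} (ψ : ι ↪ κ) (ψ' : ι' ↪ κ)
    (hd : ∀ i j, ψ i ≠ ψ' j) (x : TPow k H ι) (y : TPow k H ι') :
    Commute (place k H ψ x) (place k H ψ' y) :=
  commute_of_support (Set.range ψ) (Set.range ψ')
    (by rw [Set.disjoint_left]; rintro _ ⟨i, rfl⟩ ⟨j, hj⟩; exact hd i j hj.symm)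
    (place_mem_span ψ x) (place_mem_span ψ' y)

variable (k H)

/-- The algebra map `H → H^{⊗ι}` putting `h` at position `i` and `1` elsewhere. -/
def slot [DecidableEq ι] (i : ι) : H →ₐ[k] TPow k H ι :=
  PiTensorProduct.singleAlgHom (A := fun _ : ι => H) i

theorem slot_apply [DecidableEq ι] (i : ι) (h : H) :
    slot k H i h = PiTensorProduct.tprod k (Function.update (1 : ι → H) i h) := rfl

theorem place_slot [DecidableEq ι] [DecidableEq κ] (ψ : ι ↪ κ) (i : ι) (h : H) :
    place k H ψ (slot k H i h) = slot k H (ψ i) h := by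
  rw [slot_apply, slot_apply, place_tprod]
  congr 1
  funext j
  by_cases hj : ∃ l, ψ l = j
  · obtain ⟨l, rfl⟩ := hj
    simp [ψ.injective.extend_apply, Function.update_apply]
  · rw [Function.extend_apply' _ _ _ hj, Function.update_of_ne]
    rintro rfl; exact hj ⟨i, rfl⟩

theorem slot_mem_span [DecidableEq κ] (i : κ) (x : H) :
    slot k H i x ∈ Submodule.span k (PiTensorProduct.tprod k ''
      {p : κ → H | ∀ j, j ∉ ({i} : Set κ) → p j = 1}) :=
  Submodule.subset_span ⟨_, fun j hj => by
    change Function.update (1 : κ → H) i x j = 1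
    rw [Function.update_of_ne (by simpa using hj)]; rfl, rfl⟩

theorem slot_commute_place [DecidableEq κ] {ι' : Type*} (i : κ) (ψ : ι' ↪ κ) (hd : ∀ j, i ≠ ψ j)
    (x : H) (y : TPow k H ι') : Commute (slot k H i x) (place k H ψ y) :=
  commute_of_support {i} (Set.range ψ)
    (by rw [Set.disjoint_singleton_left]; rintro ⟨j, hj⟩; exact hd j hj.symm)
    (slot_mem_span k H i x) (place_mem_span ψ y)

theorem slot_commute [DecidableEq κ] {i j : κ} (hij : i ≠ j) (x y : H) :
    Commute (slot k H i x) (slot k H j y) :=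
  commute_of_support {i} {j} (by simpa using hij) (slot_mem_span k H i x) (slot_mem_span k H j y)

/-- The iterated coproduct `h ↦ h₍₁₎ ⊗ ⋯ ⊗ h₍ₙ₎`, an algebra map `H → H^{⊗n}`
(the counit for `n = 0`). -/
def iterComul : (n : ℕ) → H →ₐ[k] TPow k H (Fin n)
  | 0 => (Algebra.ofId k _).comp (Bialgebra.counitAlgHom k H)
  | n + 1 =>
    (Algebra.TensorProduct.lift (slot k H 0)
      ((place k H (Fin.succEmb n)).comp (iterComul n))
      (fun _ _ => slot_commute_place k H _ _ (fun j => (Fin.succ_ne_zero j).symm) _ _)).comp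
    (Bialgebra.comulAlgHom k H)

theorem iterComul_succ_apply (n : ℕ) (h : H) :
    iterComul k H (n + 1) h = LinearMap.mul' k _ (TensorProduct.map (slot k H 0).toLinearMap
      ((place k H (Fin.succEmb n)).comp (iterComul k H n)).toLinearMap (comul h)) := by
  simp only [iterComul, AlgHom.comp_apply, Bialgebra.comulAlgHom_apply]
  induction comul (R := k) h using TensorProduct.induction_on with
  | zero => simp
  | tmul x y => exact Algebra.TensorProduct.lift_tmul _ _ _ _ _
  | add a b ha hb => simp only [map_add, ha, hb]

variable {k H}

/-- In the convolution algebra, the iterated coproduct is the product of the slot maps. -/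
theorem comp_iterComul {B : Type*} [Ring B] [Algebra k B] (n : ℕ) (φ : TPow k H (Fin n) →ₐ[k] B) :
    toConv (φ.comp (iterComul k H n)).toLinearMap
      = (List.ofFn fun i => toConv (φ.comp (slot k H i)).toLinearMap).prod := by
  induction n with
  | zero =>
    ext h
    simp [iterComul, Algebra.ofId_apply]
  | succ n ih =>
    rw [List.ofFn_succ, List.prod_cons]
    have := ih (φ.comp (place k H (Fin.succEmb n)))
    simp only [AlgHom.comp_assoc] at this
    have e : ∀ i : Fin n, (place k H (Fin.succEmb n)).comp (slot k H i)
        = slot k H i.succ := by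
      intro i; ext h; exact place_slot k H _ i h
    simp only [e] at this
    rw [← this]
    ext h
    simp only [LinearMap.convMul_apply]
    change φ (iterComul k H (n + 1) h) = _
    rw [iterComul_succ_apply]
    induction comul (R := k) h using TensorProduct.induction_on with
    | zero => simp
    | tmul x y => simp
    | add a b ha hb => simp only [map_add, ha, hb]

theorem conv_commute [IsCocomm k H] {B : Type*} [Ring B] [Algebra k B] (f g : H →ₗ[k] B)
    (hc : ∀ x y, Commute (f x) (g y)) : Commute (toConv f) (toConv g) := by
  ext h
  simp only [LinearMap.convMul_apply]
  conv_lhs => rw [← comm_comul k h]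
  induction comul (R := k) h using TensorProduct.induction_on with
  | zero => simp
  | tmul x y => simpa using (hc y x).eq
  | add a b ha hb => simp only [map_add, ha, hb]

theorem iterComul_eq_of_perm [IsCocomm k H] {N : ℕ} (f : H →ₗ[k] TPow k H (Fin N))
    (l : List (Fin N)) (hl : l.Perm (List.finRange N))
    (hf : toConv f = (l.map fun i => toConv (slot k H i).toLinearMap).prod) (h : H) :
    f h = iterComul k H N h := by
  have h1 := comp_iterComul N (AlgHom.id k (TPow k H (Fin N)))
  simp only [AlgHom.id_comp, List.ofFn_eq_map] at h1
  have h2 : toConv f = toConv (iterComul k H N).toLinearMap := by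
    rw [hf, h1]
    refine (hl.map _).prod_eq' ?_
    rw [List.pairwise_map]
    refine ((hl.nodup_iff.2 (List.nodup_finRange N))).imp ?_
    intro a b hab
    exact conv_commute _ _ (fun x y => slot_commute k H hab x y)
  exact congrArg (fun u => u.ofConv h) h2

/-- The iterated coproduct of a cocommutative Hopf algebra is invariant under permutations. -/
theorem place_perm_iterComul [IsCocomm k H] {n : ℕ} (σ : Equiv.Perm (Fin n)) (h : H) :
    place k H σ.toEmbedding (iterComul k H n h) = iterComul k H n h := by
  refine iterComul_eq_of_perm ((place k H σ.toEmbedding).comp (iterComul k H n)).toLinearMap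
    ((List.finRange n).map σ) ?_ ?_ h
  · exact List.perm_of_nodup_nodup_toFinset_eq ((List.nodup_finRange n).map σ.injective)
      (List.nodup_finRange n) (by ext i; simpa using σ.surjective i)
  · rw [comp_iterComul, List.ofFn_eq_map, List.map_map]
    congr 2
    funext i
    congr 2
    ext h; exact place_slot k H _ i h

/-- The positions of the first block under `e : Fin q ⊕ Fin m ≃ Fin N`. -/
def blockL {q m N : ℕ} (e : Fin q ⊕ Fin m ≃ Fin N) : Fin q ↪ Fin N :=
  Function.Embedding.inl.trans e.toEmbedding

/-- The positions of the second block under `e : Fin q ⊕ Fin m ≃ Fin N`. -/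
def blockR {q m N : ℕ} (e : Fin q ⊕ Fin m ≃ Fin N) : Fin m ↪ Fin N :=
  Function.Embedding.inr.trans e.toEmbedding

theorem block_ne {q m N : ℕ} (e : Fin q ⊕ Fin m ≃ Fin N) (a : Fin q) (b : Fin m) :
    blockL e a ≠ blockR e b := fun h => by simpa using e.injective h

variable (k H)

/-- The algebra map `H^{⊗(m+1)} → H^{⊗N}` applying the `q`-fold iterated coproduct to the `i`-th
tensor factor and spreading the result over the first block of `e`, while the remaining tensor
factors are put, in their order, on the second block. -/
def spread {q m N : ℕ} (i : Fin (m + 1)) (e : Fin q ⊕ Fin m ≃ Fin N) :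
    TPow k H (Fin (m + 1)) →ₐ[k] TPow k H (Fin N) :=
  PiTensorProduct.liftAlgHom
    { toFun := fun h => place k H (blockL e) (iterComul k H q (h i)) *
        place k H (blockR e) (PiTensorProduct.tprod k (i.removeNth h))
      map_update_add' := by
        intro inst h j a b
        have e : inst = instDecidableEqFin _ := Subsingleton.elim _ _
        subst e
        rcases Fin.eq_self_or_eq_succAbove i j with rfl | ⟨j, rfl⟩
        · simp [add_mul]
        · simp [mul_add, Fin.ne_succAbove]
      map_update_smul' := by
        intro inst h j a b
        have e : inst = instDecidableEqFin _ := Subsingleton.elim _ _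
        subst e
        rcases Fin.eq_self_or_eq_succAbove i j with rfl | ⟨j, rfl⟩
        · simp
        · simp [Fin.ne_succAbove] }
    (by
      change place k H (blockL e) (iterComul k H q 1) *
        place k H (blockR e) (PiTensorProduct.tprod k 1) = 1
      rw [← PiTensorProduct.one_def]; simp)
    (by
      intro x y
      change place k H (blockL e) (iterComul k H q (x i * y i)) *
        place k H (blockR e) (PiTensorProduct.tprod k (i.removeNth x * i.removeNth y)) =
        (place k H (blockL e) (iterComul k H q (x i)) *
          place k H (blockR e) (PiTensorProduct.tprod k (i.removeNth x))) *
        (place k H (blockL e) (iterComul k H q (y i)) *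
          place k H (blockR e) (PiTensorProduct.tprod k (i.removeNth y)))
      rw [← PiTensorProduct.tprod_mul_tprod, map_mul, map_mul, map_mul]
      exact (place_commute (blockR e) (blockL e) (fun a b => (block_ne e b a).symm)
        _ _).symm.mul_mul_mul_comm _ _)

theorem spread_tprod {q m N : ℕ} (i : Fin (m + 1)) (e : Fin q ⊕ Fin m ≃ Fin N)
    (h : Fin (m + 1) → H) :
    spread k H i e (PiTensorProduct.tprod k h) = place k H (blockL e) (iterComul k H q (h i)) *
        place k H (blockR e) (PiTensorProduct.tprod k (i.removeNth h)) := by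
  simp [spread]

theorem spread_slot_self {q m N : ℕ} (i : Fin (m + 1)) (e : Fin q ⊕ Fin m ≃ Fin N) (h : H) :
    spread k H i e (slot k H i h) = place k H (blockL e) (iterComul k H q h) := by
  rw [slot_apply, spread_tprod, Fin.removeNth_update, Function.update_self]
  have : PiTensorProduct.tprod k (i.removeNth (1 : Fin (m + 1) → H)) = 1 := rfl
  rw [this, map_one, mul_one]

theorem spread_slot_succAbove {q m N : ℕ} (i : Fin (m + 1)) (e : Fin q ⊕ Fin m ≃ Fin N)
    (j : Fin m) (h : H) :
    spread k H i e (slot k H (i.succAbove j) h) = slot k H (blockR e j) h := by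
  rw [slot_apply, spread_tprod, Fin.removeNth_update_succAbove,
    Function.update_of_ne (Fin.ne_succAbove i j)]
  rw [← place_slot, slot_apply]
  simp only [Pi.one_apply, map_one, one_mul]
  rfl

variable {k H}

theorem spread_iterComul [IsCocomm k H] {q m N : ℕ} (i : Fin (m + 1)) (e : Fin q ⊕ Fin m ≃ Fin N)
    (h : H) : spread k H i e (iterComul k H (m + 1) h) = iterComul k H N h := by
  classical
  let blk : Fin (m + 1) → List (Fin N) := i.insertNth ((List.finRange q).map (blockL e))
    (fun j => [blockR e j])
  have hblk : ∀ j, toConv ((spread k H i e).comp (slot k H j)).toLinearMap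
      = ((blk j).map fun a => toConv (slot k H a).toLinearMap).prod := by
    intro j
    rcases Fin.eq_self_or_eq_succAbove i j with rfl | ⟨j, rfl⟩
    · have h1 : (spread k H j e).comp (slot k H j) = (place k H (blockL e)).comp (iterComul k H q) :=
        AlgHom.ext fun h => spread_slot_self k H j e h
      rw [h1, comp_iterComul]
      simp only [blk, Fin.insertNth_apply_same, List.map_map, List.ofFn_eq_map]
      congr 2
      funext a
      simp only [Function.comp]
      congr 2
      exact AlgHom.ext fun h => place_slot k H _ a h
    · have h1 : (spread k H i e).comp (slot k H (i.succAbove j)) = slot k H (blockR e j) :=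
        AlgHom.ext fun h => spread_slot_succAbove k H i e j h
      rw [h1]
      simp [blk]
  have hnd : ((List.finRange (m + 1)).flatMap blk).Nodup := by
    rw [List.nodup_flatMap]
    constructor
    · intro j _
      rcases Fin.eq_self_or_eq_succAbove i j with rfl | ⟨j, rfl⟩
      · simp only [blk, Fin.insertNth_apply_same]
        exact (List.nodup_finRange q).map (blockL e).injective
      · simp [blk]
    · refine (List.nodup_finRange (m + 1)).imp ?_
      intro a b hab
      simp only [Function.onFun, List.disjoint_left]
      rcases Fin.eq_self_or_eq_succAbove i a with ha | ⟨a, rfl⟩ <;>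
      rcases Fin.eq_self_or_eq_succAbove i b with hb | ⟨b, rfl⟩
      · exact absurd (ha.trans hb.symm) hab
      · subst ha
        simp only [blk, Fin.insertNth_apply_same, Fin.insertNth_apply_succAbove, List.mem_map,
          List.mem_singleton]
        rintro _ ⟨c, _, rfl⟩
        exact block_ne e _ _
      · subst hb
        simp only [blk, Fin.insertNth_apply_same, Fin.insertNth_apply_succAbove, List.mem_map,
          List.mem_singleton]
        rintro _ rfl ⟨c, _, hc⟩
        exact block_ne e _ _ hc
      · simp only [blk, Fin.insertNth_apply_succAbove, List.mem_singleton]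
        rintro _ rfl hc
        exact hab (by rw [(blockR e).injective hc])
  refine iterComul_eq_of_perm ((spread k H i e).comp (iterComul k H (m + 1))).toLinearMap
    ((List.finRange (m + 1)).flatMap blk) ?_ ?_ h
  · refine List.perm_of_nodup_nodup_toFinset_eq hnd (List.nodup_finRange N) ?_
    ext a
    simp only [List.mem_toFinset, List.mem_flatMap, List.mem_finRange, true_and, iff_true]
    obtain ⟨c, rfl⟩ := e.surjective a
    rcases c with c | c
    · exact ⟨i, by simp [blk, blockL]⟩
    · exact ⟨i.succAbove c, by simp [blk, blockR]⟩
  · rw [comp_iterComul, List.ofFn_eq_map]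
    simp only [hblk]
    rw [List.map_flatMap, List.flatMap_def, List.prod_flatten, List.map_map]
    rfl

end TensorPower

/-! ### The modules `H^{⊗n} ⊗_H N` -/

section PseudoTensor

variable (k H : Type*) [Field k] [Ring H] [HopfAlgebra k H]
variable (n : ℕ) (N : Type*) [AddCommGroup N] [Module k N] [Module H N] [IsScalarTower k H N]

/-- The relations `a Δ(h) ⊗ x = a ⊗ h x` defining `H^{⊗n} ⊗_H N` as a quotient of
`H^{⊗n} ⊗_k N`, where `Δ` is the iterated coproduct. -/
def pseudoRel : Submodule (TPow k H (Fin n)) (TPow k H (Fin n) ⊗[k] N) :=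
  Submodule.span _ {z | ∃ (a : TPow k H (Fin n)) (h : H) (x : N),
    z = (a * iterComul k H n h) ⊗ₜ[k] x - a ⊗ₜ[k] (h • x)}

/-- `H^{⊗n} ⊗_H N`, where `H^{⊗n}` is a right `H`-module through the iterated coproduct. -/
def PTensor : Type _ := (TPow k H (Fin n) ⊗[k] N) ⧸ pseudoRel k H n N

instance : AddCommGroup (PTensor k H n N) :=
  inferInstanceAs (AddCommGroup ((TPow k H (Fin n) ⊗[k] N) ⧸ pseudoRel k H n N))

instance : Module (TPow k H (Fin n)) (PTensor k H n N) :=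
  inferInstanceAs (Module (TPow k H (Fin n)) ((TPow k H (Fin n) ⊗[k] N) ⧸ pseudoRel k H n N))

instance : Module k (PTensor k H n N) :=
  inferInstanceAs (Module k ((TPow k H (Fin n) ⊗[k] N) ⧸ pseudoRel k H n N))

instance : IsScalarTower k (TPow k H (Fin n)) (PTensor k H n N) :=
  inferInstanceAs (IsScalarTower k (TPow k H (Fin n))
    ((TPow k H (Fin n) ⊗[k] N) ⧸ pseudoRel k H n N))

namespace PTensor

variable {n N}

variable (n N) in
/-- The quotient map `H^{⊗n} ⊗_k N → H^{⊗n} ⊗_H N`. -/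
def proj : TPow k H (Fin n) ⊗[k] N →ₗ[TPow k H (Fin n)] PTensor k H n N :=
  (pseudoRel k H n N).mkQ

/-- The class `a ⊗_H x`. -/
def mk (a : TPow k H (Fin n)) (x : N) : PTensor k H n N := proj k H n N (a ⊗ₜ[k] x)

variable {k H}

theorem mk_mul_iterComul (a : TPow k H (Fin n)) (h : H) (x : N) :
    mk k H (a * iterComul k H n h) x = mk k H a (h • x) := by
  have h1 := (Submodule.Quotient.mk_eq_zero (pseudoRel k H n N)).2
    (Submodule.subset_span ⟨a, h, x, rfl⟩)
  rw [mk, mk, ← sub_eq_zero, ← map_sub]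
  exact h1

theorem smul_mk (b a : TPow k H (Fin n)) (x : N) : b • mk k H a x = mk k H (b * a) x := by
  rw [mk, ← map_smul]; rfl

theorem mk_add_left (a b : TPow k H (Fin n)) (x : N) :
    mk k H (a + b) x = mk k H a x + mk k H b x := by
  simp only [mk, TensorProduct.add_tmul, map_add]

theorem mk_add_right (a : TPow k H (Fin n)) (x y : N) :
    mk k H a (x + y) = mk k H a x + mk k H a y := by
  simp only [mk, TensorProduct.tmul_add, map_add]

theorem mk_smul_left (c : k) (a : TPow k H (Fin n)) (x : N) :
    mk k H (c • a) x = c • mk k H a x := by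
  rw [mk, ← TensorProduct.smul_tmul']; exact ((proj k H n N).restrictScalars k).map_smul c _

theorem mk_smul_right (c : k) (a : TPow k H (Fin n)) (x : N) :
    mk k H a (c • x) = c • mk k H a x := by
  rw [mk, TensorProduct.tmul_smul]; exact ((proj k H n N).restrictScalars k).map_smul c _

@[elab_as_elim]
theorem induction {p : PTensor k H n N → Prop} (z : PTensor k H n N) (h0 : p 0)
    (hmk : ∀ a x, p (mk k H a x)) (hadd : ∀ y z, p y → p z → p (y + z)) : p z := by
  obtain ⟨t, rfl⟩ : ∃ t, proj k H n N t = z := (pseudoRel k H n N).mkQ_surjective z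
  induction t using TensorProduct.induction_on with
  | zero => rw [map_zero]; exact h0
  | tmul a x => exact hmk a x
  | add a b ha hb => rw [map_add]; exact hadd _ _ ha hb

variable {W : Type*} [AddCommGroup W] [Module k W]

/-- A `k`-bilinear map on `H^{⊗n} × N` balanced over `H` induces a linear map on
`H^{⊗n} ⊗_H N`. -/
def lift (B : TPow k H (Fin n) →ₗ[k] N →ₗ[k] W)
    (hB : ∀ a h x, B (a * iterComul k H n h) x = B a (h • x)) : PTensor k H n N →ₗ[k] W :=
  (((pseudoRel k H n N).restrictScalars k).liftQ (TensorProduct.lift B) (by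
    intro z hz
    have : ∀ b : TPow k H (Fin n), TensorProduct.lift B (b • z) = 0 := by
      refine Submodule.span_induction (p := fun z _ => ∀ b : TPow k H (Fin n),
        TensorProduct.lift B (b • z) = 0) ?_ ?_ ?_ ?_ (hz : z ∈ pseudoRel k H n N)
      · rintro _ ⟨a, h, x, rfl⟩ b
        rw [smul_sub, map_sub, TensorProduct.smul_tmul', TensorProduct.smul_tmul',
          TensorProduct.lift.tmul, TensorProduct.lift.tmul, smul_eq_mul, smul_eq_mul,
          ← mul_assoc, hB, sub_self]
      · simp
      · intro x y _ _ hx hy b; rw [smul_add, map_add, hx, hy, add_zero]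
      · intro c x _ hx b; rw [smul_smul]; exact hx _
    have h1 := this 1
    rw [one_smul] at h1
    exact h1)).comp
  (Submodule.Quotient.restrictScalarsEquiv k (pseudoRel k H n N)).symm.toLinearMap

@[simp] theorem lift_mk (B : TPow k H (Fin n) →ₗ[k] N →ₗ[k] W) (hB) (a : TPow k H (Fin n)) (x : N) :
    lift B hB (mk k H a x) = B a x := rfl

theorem hom_ext {f g : PTensor k H n N →ₗ[k] W} (h : ∀ a x, f (mk k H a x) = g (mk k H a x)) :
    f = g := by
  ext z
  induction z using induction with
  | h0 => simp
  | hmk a x => exact h a x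
  | hadd y z hy hz => rw [map_add, map_add, hy, hz]

variable (k H N) in
/-- `a ⊗_H x` as a bilinear expression. -/
def mkBilin : TPow k H (Fin n) →ₗ[k] N →ₗ[k] PTensor k H n N :=
  LinearMap.mk₂ k (mk k H) mk_add_left mk_smul_left mk_add_right mk_smul_right

@[simp] theorem mkBilin_apply (a : TPow k H (Fin n)) (x : N) : mkBilin k H N a x = mk k H a x := rfl

variable {n' : ℕ} {N' : Type*} [AddCommGroup N'] [Module k N'] [Module H N'] [IsScalarTower k H N']

/-- `φ ⊗_H id` for an algebra map `φ : H^{⊗n} → H^{⊗n'}` compatible with iterated coproducts. -/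
def mapAlg (φ : TPow k H (Fin n) →ₐ[k] TPow k H (Fin n'))
    (hφ : ∀ h, φ (iterComul k H n h) = iterComul k H n' h) :
    PTensor k H n N →ₗ[k] PTensor k H n' N :=
  lift ((mkBilin k H N).comp φ.toLinearMap) (by
    intro a h x
    change mk k H (φ (a * _)) x = mk k H (φ a) (h • x)
    rw [map_mul, hφ, mk_mul_iterComul])

@[simp] theorem mapAlg_mk (φ : TPow k H (Fin n) →ₐ[k] TPow k H (Fin n')) (hφ)
    (a : TPow k H (Fin n)) (x : N) : mapAlg φ hφ (mk k H a x) = mk k H (φ a) x := rfl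

theorem mapAlg_smul (φ : TPow k H (Fin n) →ₐ[k] TPow k H (Fin n')) (hφ)
    (a : TPow k H (Fin n)) (z : PTensor k H n N) :
    mapAlg φ hφ (a • z) = φ a • mapAlg φ hφ z := by
  induction z using induction with
  | h0 => simp
  | hmk b x => simp [smul_mk]
  | hadd y z hy hz => rw [smul_add, map_add, map_add, hy, hz, smul_add]

/-- `σ ⊗_H id`: it moves the `i`-th tensor factor of `H^{⊗n}` to position `σ i`. -/
def perm [IsCocomm k H] (σ : Equiv.Perm (Fin n)) : PTensor k H n N →ₗ[k] PTensor k H n N :=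
  mapAlg (place k H σ.toEmbedding) (place_perm_iterComul σ)

/-- `id ⊗_H ν` for an `H`-linear map `ν`. -/
def map (ν : N →ₗ[H] N') : PTensor k H n N →ₗ[k] PTensor k H n N' :=
  lift ((mkBilin k H N').compl₂ (ν.restrictScalars k)) (by
    intro a h x
    change mk k H (a * _) (ν x) = mk k H a (ν (h • x))
    rw [map_smul, mk_mul_iterComul])

@[simp] theorem map_mk (ν : N →ₗ[H] N') (a : TPow k H (Fin n)) (x : N) :
    map ν (mk k H a x) = mk k H a (ν x) := rfl

theorem map_smul' (ν : N →ₗ[H] N') (a : TPow k H (Fin n)) (z : PTensor k H n N) :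
    map ν (a • z) = a • map ν z := by
  induction z using induction with
  | h0 => simp
  | hmk b x => simp [smul_mk]
  | hadd y z hy hz => rw [smul_add, map_add, map_add, hy, hz, smul_add]

theorem map_mapAlg (ν : N →ₗ[H] N') (φ : TPow k H (Fin n) →ₐ[k] TPow k H (Fin n')) (hφ)
    (z : PTensor k H n N) : map ν (mapAlg φ hφ z) = mapAlg φ hφ (map ν z) := by
  induction z using induction with
  | h0 => simp
  | hmk b x => simp
  | hadd y z hy hz => simp only [map_add, hy, hz]

end PTensor

end PseudoTensor

/-! ### Cochains -/

section Cochain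

variable (k H : Type*) [Field k] [Ring H] [HopfAlgebra k H] [IsCocomm k H]

/-- `C^n(M, N)`: the skew-symmetric `H^{⊗n}`-linear maps `M^{⊗n} → H^{⊗n} ⊗_H N`. -/
def Cochain (n : ℕ) (M N : Type*) [AddCommGroup M] [Module k M] [Module H M] [IsScalarTower k H M]
    [AddCommGroup N] [Module k N] [Module H N] [IsScalarTower k H N] :
    Submodule k (MultilinearMap k (fun _ : Fin n => M) (PTensor k H n N)) where
  carrier := {f |
    (∀ (h : Fin n → H) (x : Fin n → M),
      f (fun i => h i • x i) = PiTensorProduct.tprod k h • f x) ∧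
    (∀ (σ : Equiv.Perm (Fin n)) (x : Fin n → M),
      f x = (Equiv.Perm.sign σ : ℤ) • PTensor.perm σ (f fun i => x (σ i)))}
  add_mem' := by
    rintro f g ⟨hf1, hf2⟩ ⟨hg1, hg2⟩
    refine ⟨fun h x => ?_, fun σ x => ?_⟩
    · simp only [add_apply, hf1, hg1, smul_add]
    · simp only [add_apply, map_add, smul_add, ← hf2, ← hg2]
  zero_mem' := ⟨fun h x => by simp, fun σ x => by simp⟩
  smul_mem' := by
    rintro c f ⟨hf1, hf2⟩
    refine ⟨fun h x => ?_, fun σ x => ?_⟩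
    · simp only [smul_apply, hf1]
      rw [← algebraMap_smul (TPow k H (Fin n)) c, ← algebraMap_smul (TPow k H (Fin n)) c, smul_smul,
        smul_smul, Algebra.commutes]
    · simp only [smul_apply, map_smul]
      rw [smul_comm, ← hf2]

variable {k H}

variable {M N M' N' : Type*}
  [AddCommGroup M] [Module k M] [Module H M] [IsScalarTower k H M]
  [AddCommGroup N] [Module k N] [Module H N] [IsScalarTower k H N]
  [AddCommGroup M'] [Module k M'] [Module H M'] [IsScalarTower k H M']
  [AddCommGroup N'] [Module k N'] [Module H N'] [IsScalarTower k H N']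

namespace Cochain

/-- `f ↦ (id ⊗_H ν) ∘ f ∘ α^{⊗n}` for `H`-linear maps `α : M' → M` and `ν : N → N'`. -/
def map (n : ℕ) (α : M' →ₗ[H] M) (ν : N →ₗ[H] N') :
    Cochain k H n M N →ₗ[k] Cochain k H n M' N' where
  toFun f := ⟨((PTensor.map ν).compMultilinearMap f.1).compLinearMap
      (fun _ => α.restrictScalars k), by
    refine ⟨fun h x => ?_, fun σ x => ?_⟩
    · simp only [MultilinearMap.compLinearMap_apply, LinearMap.compMultilinearMap_apply,
        LinearMap.coe_restrictScalars, map_smul]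
      rw [f.2.1, PTensor.map_smul']
    · simp only [MultilinearMap.compLinearMap_apply, LinearMap.compMultilinearMap_apply,
        LinearMap.coe_restrictScalars]
      rw [f.2.2 σ, map_zsmul, PTensor.perm, PTensor.map_mapAlg]
      rfl⟩
  map_add' f g := by ext; simp
  map_smul' c f := by ext; simp

theorem map_apply (n : ℕ) (α : M' →ₗ[H] M) (ν : N →ₗ[H] N') (f : Cochain k H n M N)
    (x : Fin n → M') : (map n α ν f).1 x = PTensor.map ν (f.1 fun i => α (x i)) := rfl

/-- Insertion of pseudotensors: for `y = Σ G ⊗_H a` and arguments `z`, this is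
`f(z₀, …, y, …, z_{m-1})` with `y` inserted as the `i`-th argument, that is
`Σ (G ⊗ 1) · (Δ^{(q)}_i ⊗_H id) f(z₀, …, a, …, z_{m-1})`. The tensor factors of `H^{⊗N}` belonging
to `y` are those in the first block of `e`, the ones belonging to `z` are those in the second. -/
def insertion {q m n : ℕ} (f : Cochain k H (m + 1) M N) (i : Fin (m + 1))
    (e : Fin q ⊕ Fin m ≃ Fin n) :
    PTensor k H q M →ₗ[k] MultilinearMap k (fun _ : Fin m => M) (PTensor k H n N) :=
  PTensor.lift
    (LinearMap.mk₂ k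
      (fun (G : TPow k H (Fin q)) (a : M) =>
        (Algebra.lsmul k k (PTensor k H n N) (place k H (blockL e) G) ∘ₗ
          PTensor.mapAlg (spread k H i e) (spread_iterComul i e)).compMultilinearMap
        (f.1.curryMid i a))
      (by intro G G' a; ext z; simp)
      (by intro c G a; ext z; simp)
      (by intro G a b; ext z; simp)
      (by intro c G a; ext z; simp))
    (by
      intro G h a
      ext z
      simp only [LinearMap.mk₂_apply, LinearMap.compMultilinearMap_apply, LinearMap.comp_apply,
        MultilinearMap.curryMid_apply_apply, Algebra.lsmul_coe]
      have h1 : f.1 (i.insertNth (h • a) z) = slot k H i h • f.1 (i.insertNth a z) := by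
        rw [slot_apply, ← f.2.1]
        congr 1
        funext j
        rcases Fin.eq_self_or_eq_succAbove i j with rfl | ⟨j, rfl⟩ <;> simp [Fin.succAbove_ne]
      rw [h1, PTensor.mapAlg_smul, spread_slot_self, map_mul, mul_smul])

theorem insertion_mk {q m n : ℕ} (f : Cochain k H (m + 1) M N) (i : Fin (m + 1))
    (e : Fin q ⊕ Fin m ≃ Fin n) (G : TPow k H (Fin q)) (a : M) (z : Fin m → M) :
    insertion f i e (PTensor.mk k H G a) z = place k H (blockL e) G •
      PTensor.mapAlg (spread k H i e) (spread_iterComul i e) (f.1 (i.insertNth a z)) := rfl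

theorem insertion_add {q m n : ℕ} (f g : Cochain k H (m + 1) M N) (i : Fin (m + 1))
    (e : Fin q ⊕ Fin m ≃ Fin n) : insertion (f + g) i e = insertion f i e + insertion g i e := by
  refine PTensor.hom_ext fun a x => ?_
  ext z
  simp [insertion_mk]

theorem insertion_smul {q m n : ℕ} (c : k) (f : Cochain k H (m + 1) M N) (i : Fin (m + 1))
    (e : Fin q ⊕ Fin m ≃ Fin n) : insertion (c • f) i e = c • insertion f i e := by
  refine PTensor.hom_ext fun a x => ?_
  ext z
  simp only [insertion_mk, LinearMap.smul_apply, smul_apply, SetLike.val_smul,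
    map_smul]
  rw [smul_comm]

theorem insertion_equivariant {q m n : ℕ} (f : Cochain k H (m + 1) M N) (i : Fin (m + 1))
    (e : Fin q ⊕ Fin m ≃ Fin n) (b : TPow k H (Fin q)) (h : Fin m → H) (y : PTensor k H q M)
    (z : Fin m → M) :
    insertion f i e (b • y) (fun j => h j • z j) =
      (place k H (blockL e) b * place k H (blockR e) (PiTensorProduct.tprod k h)) •
        insertion f i e y z := by
  induction y using PTensor.induction with
  | h0 => simp
  | hmk G a =>
    rw [PTensor.smul_mk, insertion_mk, insertion_mk]
    have h1 : f.1 (i.insertNth a fun j => h j • z j) =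
        PiTensorProduct.tprod k (i.insertNth (α := fun _ => H) (1 : H) h) • f.1 (i.insertNth a z) := by
      rw [← f.2.1]
      congr 1
      funext j
      rcases Fin.eq_self_or_eq_succAbove i j with rfl | ⟨j, rfl⟩ <;> simp
    rw [h1, PTensor.mapAlg_smul, spread_tprod]
    simp only [Fin.insertNth_apply_same, map_one, one_mul, Fin.removeNth_insertNth, map_mul,
      smul_smul]
    congr 1
    rw [mul_assoc, mul_assoc, (place_commute (blockL e) (blockR e) (block_ne e) _ _).eq]
  | hadd y z hy hz => simp only [smul_add, map_add, add_apply, hy, hz]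

end Cochain

end Cochain

/-! ### Shuffles -/

section Shuffle

/-- The decomposition of `{1, …, N}` into the first `q` and the last `m` elements, `q + m = N`. -/
def blocks {q m N : ℕ} (h : q + m = N) : Fin q ⊕ Fin m ≃ Fin N :=
  finSumFinEquiv.trans (finCongr h)

open Classical in
/-- The `(q, m)`-shuffles: permutations `σ` of `{1, …, q + m}` with `σ(1) < ⋯ < σ(q)` and
`σ(q+1) < ⋯ < σ(q+m)`. -/
def shuffles {q m N : ℕ} (h : q + m = N) : Finset (Equiv.Perm (Fin N)) :=
  Finset.univ.filter fun σ =>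
    StrictMono (fun i : Fin q => σ (blocks h (Sum.inl i))) ∧
    StrictMono (fun j : Fin m => σ (blocks h (Sum.inr j)))

variable {q m N : ℕ} (h : q + m = N)

theorem mem_shuffles {σ : Equiv.Perm (Fin N)} : σ ∈ shuffles h ↔
    StrictMono (fun i : Fin q => σ (blocks h (Sum.inl i))) ∧
    StrictMono (fun j : Fin m => σ (blocks h (Sum.inr j))) := by
  simp [shuffles]

/-- The permutation of `{1, …, q + m}` which permutes the two blocks separately. -/
def blockPerm (κ₁ : Equiv.Perm (Fin q)) (κ₂ : Equiv.Perm (Fin m)) : Equiv.Perm (Fin N) :=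
  (blocks h).permCongr (Equiv.sumCongr κ₁ κ₂)

theorem blockPerm_inl (κ₁ : Equiv.Perm (Fin q)) (κ₂ : Equiv.Perm (Fin m)) (i : Fin q) :
    blockPerm h κ₁ κ₂ (blocks h (Sum.inl i)) = blocks h (Sum.inl (κ₁ i)) := by
  simp [blockPerm, Equiv.permCongr_apply]

theorem blockPerm_inr (κ₁ : Equiv.Perm (Fin q)) (κ₂ : Equiv.Perm (Fin m)) (i : Fin m) :
    blockPerm h κ₁ κ₂ (blocks h (Sum.inr i)) = blocks h (Sum.inr (κ₂ i)) := by
  simp [blockPerm, Equiv.permCongr_apply]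

theorem sign_blockPerm (κ₁ : Equiv.Perm (Fin q)) (κ₂ : Equiv.Perm (Fin m)) :
    Equiv.Perm.sign (blockPerm h κ₁ κ₂) = Equiv.Perm.sign κ₁ * Equiv.Perm.sign κ₂ := by
  rw [blockPerm, Equiv.Perm.sign_permCongr]
  exact Equiv.Perm.sign_sumCongr κ₁ κ₂

/-- The shuffle in the coset of `σ` modulo permutations of the two blocks. -/
def sortPerm (σ : Equiv.Perm (Fin N)) : Equiv.Perm (Fin N) :=
  σ * blockPerm h (Tuple.sort fun i => σ (blocks h (Sum.inl i)))
    (Tuple.sort fun i => σ (blocks h (Sum.inr i)))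

theorem sortPerm_mem (σ : Equiv.Perm (Fin N)) : sortPerm h σ ∈ shuffles h := by
  rw [mem_shuffles]
  constructor
  · refine Monotone.strictMono_of_injective ?_ ?_
    · have := Tuple.monotone_sort fun i => σ (blocks h (Sum.inl i))
      intro a b hab
      simpa [sortPerm, blockPerm_inl] using this hab
    · intro a b hab; simpa using hab
  · refine Monotone.strictMono_of_injective ?_ ?_
    · have := Tuple.monotone_sort fun i => σ (blocks h (Sum.inr i))
      intro a b hab
      simpa [sortPerm, blockPerm_inr] using this hab
    · intro a b hab; simpa using hab

theorem shuffle_unique {σ : Equiv.Perm (Fin N)} (κ₁ : Equiv.Perm (Fin q))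
    (κ₂ : Equiv.Perm (Fin m)) (hσ : σ ∈ shuffles h) (hσ' : σ * blockPerm h κ₁ κ₂ ∈ shuffles h) :
    σ * blockPerm h κ₁ κ₂ = σ := by
  rw [mem_shuffles] at hσ hσ'
  have h1 := (hσ'.1.range_inj hσ.1).1 (by
    have : (fun i : Fin q => (σ * blockPerm h κ₁ κ₂) (blocks h (Sum.inl i)))
        = (fun i : Fin q => σ (blocks h (Sum.inl i))) ∘ κ₁ := by
      funext i; simp [blockPerm_inl]
    rw [this, κ₁.surjective.range_comp])
  have h2 := (hσ'.2.range_inj hσ.2).1 (by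
    have : (fun i : Fin m => (σ * blockPerm h κ₁ κ₂) (blocks h (Sum.inr i)))
        = (fun i : Fin m => σ (blocks h (Sum.inr i))) ∘ κ₂ := by
      funext i; simp [blockPerm_inr]
    rw [this, κ₂.surjective.range_comp])
  ext a
  obtain ⟨c, rfl⟩ := (blocks h).surjective a
  rcases c with c | c
  · exact congrArg Fin.val (congrFun h1 c)
  · exact congrArg Fin.val (congrFun h2 c)

theorem sortPerm_coset {σ τ : Equiv.Perm (Fin N)} (hσ : σ ∈ shuffles h) :
    sortPerm h (τ⁻¹ * sortPerm h (τ * σ)) = σ := by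
  have hmul : ∀ a b a' b', blockPerm h a b * blockPerm h a' b' = blockPerm h (a * a') (b * b') := by
    intro a b a' b'
    refine Equiv.ext fun x => ?_
    obtain ⟨c, rfl⟩ := (blocks h).surjective x
    rcases c with c | c <;> simp [blockPerm_inl, blockPerm_inr]
  have hm := sortPerm_mem h (τ⁻¹ * sortPerm h (τ * σ))
  generalize hs : sortPerm h (τ * σ) = s at hm ⊢
  rw [sortPerm] at hs
  rw [sortPerm] at hm ⊢
  subst hs
  simp only [← mul_assoc, inv_mul_cancel, one_mul] at hm ⊢
  simp only [mul_assoc σ, hmul] at hm ⊢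
  exact shuffle_unique h _ _ hσ hm

theorem sum_shuffles_mul {W : Type*} [AddCommMonoid W] (A : Equiv.Perm (Fin N) → W)
    (hA : ∀ σ κ₁ κ₂, A (σ * blockPerm h κ₁ κ₂) = A σ) (τ : Equiv.Perm (Fin N)) :
    ∑ σ ∈ shuffles h, A (τ * σ) = ∑ σ ∈ shuffles h, A σ := by
  refine Finset.sum_bij' (fun σ _ => sortPerm h (τ * σ)) (fun σ _ => sortPerm h (τ⁻¹ * σ))
    (fun σ _ => sortPerm_mem h _) (fun σ _ => sortPerm_mem h _)
    (fun σ hσ => sortPerm_coset h hσ) (fun σ hσ => ?_) (fun σ _ => (hA _ _ _).symm)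
  have := sortPerm_coset (τ := τ⁻¹) h hσ
  rwa [inv_inv] at this

end Shuffle

/-! ### The circle product and the Nijenhuis–Richardson bracket -/

section Circle

variable {k H : Type*} [Field k] [Ring H] [HopfAlgebra k H] [IsCocomm k H]
variable {M N : Type*}
  [AddCommGroup M] [Module k M] [Module H M] [IsScalarTower k H M]
  [AddCommGroup N] [Module k N] [Module H N] [IsScalarTower k H N]

theorem place_place {a b c : ℕ} (ψ : Fin a ↪ Fin b) (ψ' : Fin b ↪ Fin c) (x : TPow k H (Fin a)) :
    place k H ψ' (place k H ψ x) = place k H (ψ.trans ψ') x := by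
  have : (place k H ψ').comp (place k H ψ) = place k H (ψ.trans ψ') := by
    refine PiTensorProduct.algHom_ext fun i => AlgHom.ext fun h => ?_
    change place k H ψ' (place k H ψ (slot k H i h)) = place k H (ψ.trans ψ') (slot k H i h)
    rw [place_slot, place_slot, place_slot]; rfl
  exact DFunLike.congr_fun this x

theorem place_tprod_perm {n : ℕ} (σ : Equiv.Perm (Fin n)) (h : Fin n → H) :
    place k H σ.toEmbedding (PiTensorProduct.tprod k fun i => h (σ i))
      = PiTensorProduct.tprod k h := by
  rw [place_tprod]
  congr 1
  funext j
  have h1 := σ.injective.extend_apply (fun i => h (σ i)) (1 : Fin n → H) (σ.symm j)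
  rw [Equiv.apply_symm_apply] at h1
  exact h1

theorem place_blocks_tprod {q m n : ℕ} (e : Fin q ⊕ Fin m ≃ Fin n) (h : Fin n → H) :
    place k H (blockL e) (PiTensorProduct.tprod k fun i => h (e (Sum.inl i))) *
      place k H (blockR e) (PiTensorProduct.tprod k fun i => h (e (Sum.inr i)))
      = PiTensorProduct.tprod k h := by
  rw [place_tprod, place_tprod, PiTensorProduct.tprod_mul_tprod]
  congr 1
  funext j
  obtain ⟨c, rfl⟩ := e.surjective j
  rw [Pi.mul_apply]
  rcases c with c | c
  · have h1 := (blockL e).injective.extend_apply (fun i => h (e (Sum.inl i))) (1 : Fin n → H) c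
    have h2 := Function.extend_apply' (f := blockR e) (fun i => h (e (Sum.inr i)))
      (1 : Fin n → H) (blockL e c) (fun ⟨d, hd⟩ => block_ne e c d hd.symm)
    exact (congrArg₂ (· * ·) h1 h2).trans (mul_one _)
  · have h1 := (blockR e).injective.extend_apply (fun i => h (e (Sum.inr i))) (1 : Fin n → H) c
    have h2 := Function.extend_apply' (f := blockL e) (fun i => h (e (Sum.inl i)))
      (1 : Fin n → H) (blockR e c) (fun ⟨d, hd⟩ => block_ne e d c hd)
    exact (congrArg₂ (· * ·) h2 h1).trans (one_mul _)

theorem PTensor.perm_smul {n : ℕ} (σ : Equiv.Perm (Fin n)) (a : TPow k H (Fin n))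
    (z : PTensor k H n N) :
    PTensor.perm σ (a • z) = place k H σ.toEmbedding a • PTensor.perm σ z :=
  PTensor.mapAlg_smul _ _ _ _

theorem PTensor.perm_mul {n : ℕ} (σ τ : Equiv.Perm (Fin n)) (z : PTensor k H n N) :
    PTensor.perm (σ * τ) z = PTensor.perm σ (PTensor.perm τ z) := by
  induction z using PTensor.induction with
  | h0 => simp
  | hmk G a =>
    change PTensor.mk k H (place k H (σ * τ).toEmbedding G) a =
      PTensor.mk k H (place k H σ.toEmbedding (place k H τ.toEmbedding G)) a
    rw [place_place]; rfl
  | hadd y z hy hz => simp only [map_add, hy, hz]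

theorem Cochain.insertion_perm {q m n : ℕ} (h : q + m = n) (f : Cochain k H (m + 1) M N)
    (κ₁ : Equiv.Perm (Fin q)) (κ₂ : Equiv.Perm (Fin m)) (y : PTensor k H q M) (z : Fin m → M) :
    PTensor.perm (blockPerm h κ₁ κ₂) (Cochain.insertion f 0 (blocks h) y fun j => z (κ₂ j)) =
      (Equiv.Perm.sign κ₂ : ℤ) • Cochain.insertion f 0 (blocks h) (PTensor.perm κ₁ y) z := by
  induction y using PTensor.induction with
  | h0 => simp
  | hmk G a =>
    have h1 : PTensor.perm κ₁ (PTensor.mk k H G a) =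
      PTensor.mk k H (place k H κ₁.toEmbedding G) a := rfl
    rw [h1, insertion_mk, insertion_mk, PTensor.perm_smul, place_place, place_place]
    have h2 : (blockL (blocks h)).trans (blockPerm h κ₁ κ₂).toEmbedding
        = κ₁.toEmbedding.trans (blockL (blocks h)) := by
      ext i; exact congrArg Fin.val (blockPerm_inl h κ₁ κ₂ i)
    rw [h2, smul_comm]
    congr 1
    set κ := Equiv.Perm.decomposeFin.symm (0, κ₂) with hκ
    have hκ0 : κ 0 = 0 := by simp [hκ]
    have hκs : ∀ j : Fin m, κ j.succ = (κ₂ j).succ := by intro j; simp [hκ]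
    have hsg : Equiv.Perm.sign κ = Equiv.Perm.sign κ₂ := by simp [hκ]
    have h3 : (fun i => (Fin.insertNth (α := fun _ => M) 0 a z) (κ i))
        = Fin.insertNth (α := fun _ => M) 0 a (fun j => z (κ₂ j)) := by
      funext i
      refine Fin.cases ?_ (fun j => ?_) i
      · simp [hκ0]
      · simp [hκs]
    rw [f.2.2 κ (Fin.insertNth 0 a z), h3, hsg, map_zsmul, smul_smul]
    have : ((Equiv.Perm.sign κ₂ : ℤ) * (Equiv.Perm.sign κ₂ : ℤ)) = 1 := by
      rw [← Units.val_mul, Int.units_mul_self]; rfl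
    rw [this, one_smul]
    have h4 : ∀ x : TPow k H (Fin (m + 1)),
        place k H (blockPerm h κ₁ κ₂).toEmbedding (spread k H 0 (blocks h) x) =
          spread k H 0 (blocks h) (place k H κ.toEmbedding x) := by
      intro x
      have : (place k H (blockPerm h κ₁ κ₂).toEmbedding).comp (spread k H 0 (blocks h)) =
          (spread k H 0 (blocks h)).comp (place k H κ.toEmbedding) := by
        refine PiTensorProduct.algHom_ext fun i => AlgHom.ext fun g => ?_
        change place k H (blockPerm h κ₁ κ₂).toEmbedding (spread k H 0 (blocks h) (slot k H i g)) =
          spread k H 0 (blocks h) (place k H κ.toEmbedding (slot k H i g))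
        rw [place_slot]
        refine Fin.cases ?_ (fun j => ?_) i
        · change _ = spread k H 0 (blocks h) (slot k H (κ 0) g)
          rw [hκ0, spread_slot_self, place_place, h2, ← place_place, place_perm_iterComul]
        · change _ = spread k H 0 (blocks h) (slot k H (κ j.succ) g)
          have hj := spread_slot_succAbove k H 0 (blocks h) j g
          have hj' := spread_slot_succAbove k H 0 (blocks h) (κ₂ j) g
          rw [Fin.zero_succAbove] at hj hj'
          rw [hκs, hj, hj', place_slot]
          exact congrArg (fun a => slot k H a g) (blockPerm_inr h κ₁ κ₂ j)
      exact DFunLike.congr_fun this x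
    generalize f.1 (Fin.insertNth 0 a fun j => z (κ₂ j)) = w
    induction w using PTensor.induction with
    | h0 => simp
    | hmk F b =>
      change PTensor.mk k H (place k H (blockPerm h κ₁ κ₂).toEmbedding
        (spread k H 0 (blocks h) F)) b =
        PTensor.mk k H (spread k H 0 (blocks h) (place k H κ.toEmbedding F)) b
      rw [h4]
    | hadd y z hy hz => simp only [map_add, hy, hz]
  | hadd y z hy hz => simp only [map_add, add_apply, smul_add, hy, hz]

namespace Cochain

/-- `(x₁, …, x_{q+m}) ↦ f(g(x₁, …, x_q), x_{q+1}, …, x_{q+m})`. -/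
def comp₁ {q m n : ℕ} (h : q + m = n) (f : Cochain k H (m + 1) M N) (g : Cochain k H q M M) :
    MultilinearMap k (fun _ : Fin n => M) (PTensor k H n N) :=
  (((Cochain.insertion f 0 (blocks h)).compMultilinearMap g.1).uncurrySum).domDomCongr (blocks h)

theorem comp₁_apply {q m n : ℕ} (h : q + m = n) (f : Cochain k H (m + 1) M N)
    (g : Cochain k H q M M) (x : Fin n → M) :
    comp₁ h f g x = Cochain.insertion f 0 (blocks h) (g.1 fun i => x (blocks h (Sum.inl i)))
      (fun j => x (blocks h (Sum.inr j))) := rfl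

/-- The circle product `f ⊚ g` of `f ∈ C^{m+1}(M, N)` and `g ∈ C^q(M, M)` in `C^{q+m}(M, N)`,
`(f ⊚ g)(x₁, …, x_{q+m}) = ∑_σ (-1)^σ (σ ⊗_H id)
  f(g(x_{σ(1)}, …, x_{σ(q)}), x_{σ(q+1)}, …, x_{σ(q+m)})`, the sum being over `(q, m)`-shuffles. -/
def circ {q m n : ℕ} (h : q + m = n) (f : Cochain k H (m + 1) M N) (g : Cochain k H q M M) :
    Cochain k H n M N :=
  ⟨∑ σ ∈ shuffles h, (Equiv.Perm.sign σ : ℤ) •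
    (PTensor.perm σ).compMultilinearMap ((comp₁ h f g).domDomCongr σ), by
    have hap : ∀ x : Fin n → M, (∑ σ ∈ shuffles h, (Equiv.Perm.sign σ : ℤ) •
        (PTensor.perm σ).compMultilinearMap ((comp₁ h f g).domDomCongr σ)) x =
        ∑ σ ∈ shuffles h, (Equiv.Perm.sign σ : ℤ) •
          PTensor.perm σ (comp₁ h f g fun i => x (σ i)) := by
      intro x; rw [sum_apply]; rfl
    refine ⟨fun a x => ?_, fun τ x => ?_⟩
    · rw [hap, hap, Finset.smul_sum]
      refine Finset.sum_congr rfl fun σ _ => ?_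
      rw [smul_comm, comp₁_apply, comp₁_apply, g.2.1, insertion_equivariant,
        place_blocks_tprod (blocks h) (fun i => a (σ i)), PTensor.perm_smul, place_tprod_perm]
    · rw [hap, hap, map_sum, Finset.smul_sum]
      rw [← sum_shuffles_mul h (fun σ => (Equiv.Perm.sign σ : ℤ) •
          PTensor.perm σ (comp₁ h f g fun i => x (σ i))) ?_ τ]
      · refine Finset.sum_congr rfl fun σ _ => ?_
        rw [map_zsmul, smul_smul, PTensor.perm_mul, Equiv.Perm.sign_mul, Units.val_mul]
        rfl
      · intro σ κ₁ κ₂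
        rw [PTensor.perm_mul, Equiv.Perm.sign_mul, sign_blockPerm, comp₁_apply, comp₁_apply]
        simp only [Equiv.Perm.mul_apply, blockPerm_inl, blockPerm_inr]
        rw [insertion_perm h f κ₁ κ₂ _ (fun j => x (σ (blocks h (Sum.inr j)))),
          g.2.2 κ₁ (fun i => x (σ (blocks h (Sum.inl i))))]
        simp only [map_zsmul, Units.val_mul]
        have : ∀ W : MultilinearMap k (fun _ : Fin m => M) (PTensor k H n N),
          ∀ c : ℤ, ∀ z, (c • W) z = c • W z := fun _ _ _ => rfl
        rw [this, map_zsmul, smul_smul, smul_smul]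
        congr 1
        have : ((Equiv.Perm.sign κ₂ : ℤ) * (Equiv.Perm.sign κ₂ : ℤ)) = 1 := by
          rw [← Units.val_mul, Int.units_mul_self]; rfl
        linear_combination (Equiv.Perm.sign σ : ℤ) * (Equiv.Perm.sign κ₁ : ℤ) * this⟩

theorem circ_apply {q m n : ℕ} (h : q + m = n) (f : Cochain k H (m + 1) M N)
    (g : Cochain k H q M M) (x : Fin n → M) :
    (circ h f g).1 x = ∑ σ ∈ shuffles h, (Equiv.Perm.sign σ : ℤ) • PTensor.perm σ
      (Cochain.insertion f 0 (blocks h) (g.1 fun i => x (σ (blocks h (Sum.inl i))))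
        (fun j => x (σ (blocks h (Sum.inr j))))) := by
  change (∑ σ ∈ shuffles h, _ : MultilinearMap k _ _) x = _
  rw [sum_apply]; rfl

/-- The circle product as a bilinear map. -/
def circBilin {q m n : ℕ} (h : q + m = n) :
    Cochain k H (m + 1) M N →ₗ[k] Cochain k H q M M →ₗ[k] Cochain k H n M N :=
  LinearMap.mk₂ k (circ h)
    (by
      intro f f' g; ext x
      simp only [Submodule.coe_add, add_apply, circ_apply, insertion_add, LinearMap.add_apply,
        map_add, smul_add, Finset.sum_add_distrib])
    (by
      intro c f g; ext x
      simp only [SetLike.val_smul, smul_apply, circ_apply, insertion_smul, LinearMap.smul_apply,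
        map_smul, Finset.smul_sum, smul_comm c])
    (by
      intro f g g'; ext x
      simp only [Submodule.coe_add, add_apply, circ_apply, map_add, smul_add,
        Finset.sum_add_distrib])
    (by
      intro c f g; ext x
      simp only [SetLike.val_smul, smul_apply, circ_apply, map_smul, Finset.smul_sum, smul_comm c])

end Cochain

end Circle

section Bracket

variable (k H : Type*) [Field k] [Ring H] [HopfAlgebra k H] [IsCocomm k H]
variable (M N : Type*)
  [AddCommGroup M] [Module k M] [Module H M] [IsScalarTower k H M]
  [AddCommGroup N] [Module k N] [Module H N] [IsScalarTower k H N]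

/-- The graded space `⨁_{n ≥ 0} C^{n+1}(M, N)`; the summand `C^{n+1}(M, N)` has degree `n`. -/
abbrev CochainSpace : Type _ := DirectSum ℕ fun n => Cochain k H (n + 1) M N

/-- A cochain in `C^{n+1}(M, N)` as an element of the graded space. -/
abbrev ofDegree (n : ℕ) : Cochain k H (n + 1) M N →ₗ[k] CochainSpace k H M N :=
  DirectSum.lof k ℕ (fun n => Cochain k H (n + 1) M N) n

/-- The homogeneous component of degree `d : ℤ` (zero for negative `d`). -/
def degreePart (d : ℤ) : Submodule k (CochainSpace k H M N) where
  carrier := {f | ∀ n : ℕ, (n : ℤ) ≠ d → f n = 0}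
  add_mem' := by
    intro f g hf hg n hn
    rw [DirectSum.add_apply, hf n hn, hg n hn, add_zero]
  zero_mem' := fun n _ => rfl
  smul_mem' := by
    intro c f hf n hn
    rw [DirectSum.smul_apply, hf n hn, smul_zero]

/-- The Nijenhuis–Richardson bracket on homogeneous cochains,
`[f, g] = f ⊚ g - (-1)^{mn} g ⊚ f` for `f ∈ C^{m+1}(M, M)` and `g ∈ C^{n+1}(M, M)`. -/
def nrHom (m n : ℕ) : Cochain k H (m + 1) M M →ₗ[k] Cochain k H (n + 1) M M →ₗ[k]
    Cochain k H (m + n + 1) M M :=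
  LinearMap.mk₂ k
    (fun f g => Cochain.circ (by omega) f g - (-1 : k) ^ (m * n) • Cochain.circ (by omega) g f)
    (by
      intro f f' g
      have h1 :=
        (Cochain.circBilin (k := k) (H := H) (M := M) (N := M) (by omega : n + 1 + m = m + n + 1)).map_add₂ f f' g
      have h2 :=
        ((Cochain.circBilin (k := k) (H := H) (M := M) (N := M) (by omega : m + 1 + n = m + n + 1)) g).map_add f f'
      simp only [Cochain.circBilin, LinearMap.mk₂_apply] at h1 h2
      rw [h1, h2, smul_add]; abel)
    (by
      intro c f g
      have h1 :=
        (Cochain.circBilin (k := k) (H := H) (M := M) (N := M) (by omega : n + 1 + m = m + n + 1)).map_smul₂ c f g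
      have h2 :=
        ((Cochain.circBilin (k := k) (H := H) (M := M) (N := M) (by omega : m + 1 + n = m + n + 1)) g).map_smul c f
      simp only [Cochain.circBilin, LinearMap.mk₂_apply] at h1 h2
      rw [h1, h2, smul_sub, smul_comm c])
    (by
      intro f g g'
      have h1 :=
        (Cochain.circBilin (k := k) (H := H) (M := M) (N := M) (by omega : m + 1 + n = m + n + 1)).map_add₂ g g' f
      have h2 :=
        ((Cochain.circBilin (k := k) (H := H) (M := M) (N := M) (by omega : n + 1 + m = m + n + 1)) f).map_add g g'
      simp only [Cochain.circBilin, LinearMap.mk₂_apply] at h1 h2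
      rw [h1, h2, smul_add]; abel)
    (by
      intro c f g
      have h1 :=
        (Cochain.circBilin (k := k) (H := H) (M := M) (N := M) (by omega : m + 1 + n = m + n + 1)).map_smul₂ c g f
      have h2 :=
        ((Cochain.circBilin (k := k) (H := H) (M := M) (N := M) (by omega : n + 1 + m = m + n + 1)) f).map_smul c g
      simp only [Cochain.circBilin, LinearMap.mk₂_apply] at h1 h2
      rw [h1, h2, smul_sub, smul_comm c])

/-- The Nijenhuis–Richardson bracket on `⨁_{n ≥ 0} C^{n+1}(M, M)`. -/
def nrBracket : CochainSpace k H M M →ₗ[k] CochainSpace k H M M →ₗ[k] CochainSpace k H M M :=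
  DirectSum.toModule k ℕ _ fun m => LinearMap.flip <|
    DirectSum.toModule k ℕ _ fun n => LinearMap.flip <|
      (nrHom k H M m n).compr₂ (ofDegree k H M M (m + n))

variable {k H M}

theorem nrBracket_of (m n : ℕ) (f : Cochain k H (m + 1) M M) (g : Cochain k H (n + 1) M M) :
    nrBracket k H M (ofDegree k H M M m f) (ofDegree k H M M n g) =
      ofDegree k H M M (m + n)
        (Cochain.circ (by omega) f g - (-1 : k) ^ (m * n) • Cochain.circ (by omega) g f) := by
  simp only [nrBracket, DirectSum.toModule_lof, LinearMap.flip_apply]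
  rfl

end Bracket

/-! ### Graded Lie algebras, curved `V`-data and curved `L∞`-algebras -/

section Abstract

variable {k : Type*} [Field k]

/-- `(L, br)` is a `ℤ`-graded Lie algebra over `k` (of characteristic zero) with homogeneous
components `𝒜 i`. -/
structure IsGradedLieAlgebra {L : Type*} [AddCommGroup L] [Module k L] (𝒜 : ℤ → Submodule k L)
    (br : L →ₗ[k] L →ₗ[k] L) : Prop where
  internal : DirectSum.IsInternal 𝒜
  bracket_mem : ∀ i j, ∀ x ∈ 𝒜 i, ∀ y ∈ 𝒜 j, br x y ∈ 𝒜 (i + j)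
  antisymm : ∀ i j, ∀ x ∈ 𝒜 i, ∀ y ∈ 𝒜 j, br x y = -(((i * j).negOnePow : ℤ) • br y x)
  jacobi : ∀ i j l, ∀ x ∈ 𝒜 i, ∀ y ∈ 𝒜 j, ∀ z ∈ 𝒜 l,
    br x (br y z) = br (br x y) z + ((i * j).negOnePow : ℤ) • br y (br x z)

/-- A graded subspace: it is the sum of its intersections with the homogeneous components. -/
def IsGradedSubspace {L : Type*} [AddCommGroup L] [Module k L] (𝒜 : ℤ → Submodule k L)
    (K : Submodule k L) : Prop :=
  K = ⨆ i, K ⊓ 𝒜 i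

/-- A curved `V`-datum `(L, K, P, Δ)`: a graded Lie algebra `L`, an abelian graded Lie subalgebra
`K`, a projection `P` with image `K` whose kernel is a graded Lie subalgebra, and `Δ` of degree `1`
with `[Δ, Δ] = 0`. -/
structure IsCurvedVDatum {L : Type*} [AddCommGroup L] [Module k L] (𝒜 : ℤ → Submodule k L)
    (br : L →ₗ[k] L →ₗ[k] L) (K : Submodule k L) (P : L →ₗ[k] L) (Δ : L) : Prop where
  gradedLie : IsGradedLieAlgebra 𝒜 br
  graded : IsGradedSubspace 𝒜 K
  abelian : ∀ x ∈ K, ∀ y ∈ K, br x y = 0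
  proj_proj : P ∘ₗ P = P
  range_proj : LinearMap.range P = K
  ker_graded : IsGradedSubspace 𝒜 (LinearMap.ker P)
  ker_bracket : ∀ x ∈ LinearMap.ker P, ∀ y ∈ LinearMap.ker P, br x y ∈ LinearMap.ker P
  degree_one : Δ ∈ 𝒜 1
  square_zero : br Δ Δ = 0

/-- `(x₁, …, xₙ) ↦ [⋯[[Δ, x₁], x₂], ⋯, xₙ]`. -/
def iterBracket {L : Type*} [AddCommGroup L] [Module k L] (br : L →ₗ[k] L →ₗ[k] L) (Δ : L) :
    (n : ℕ) → MultilinearMap k (fun _ : Fin n => L) L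
  | 0 => MultilinearMap.constOfIsEmpty k _ Δ
  | n + 1 => MultilinearMap.uncurryRight (M := fun _ => L)
      (br.compMultilinearMap (iterBracket br Δ n))

/-- The Koszul sign `ε(σ)`, given by `x₁ ⋯ xₙ = ε(σ) x_{σ(1)} ⋯ x_{σ(n)}` in the free graded
commutative algebra on elements `xᵢ` of degree `d i`. -/
def koszulSign {n : ℕ} (d : Fin n → ℤ) (σ : Equiv.Perm (Fin n)) : ℤˣ :=
  ∏ p : Fin n × Fin n,
    if p.1 < p.2 ∧ σ p.2 < σ p.1 then (d (σ p.1) * d (σ p.2)).negOnePow else 1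

/-- `(V, (l n)_{n ≥ 0})` is a curved `L∞`-algebra over `k` with homogeneous components `𝒱 i`:
the `l n` are graded symmetric of degree `1` and satisfy the higher Jacobi identities
`∑_{i=0}^{n} ∑_{σ ∈ Sh(i, n-i)} ε(σ) l_{n-i+1}(l_i(x_{σ(1)}, …, x_{σ(i)}), x_{σ(i+1)}, …) = 0`
for all `n ≥ 0`. -/
structure IsCurvedLInfinityAlgebra {V : Type*} [AddCommGroup V] [Module k V]
    (𝒱 : ℤ → Submodule k V) (l : (n : ℕ) → MultilinearMap k (fun _ : Fin n => V) V) : Prop where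
  internal : DirectSum.IsInternal 𝒱
  degree : ∀ (n : ℕ) (d : Fin n → ℤ) (x : Fin n → V), (∀ i, x i ∈ 𝒱 (d i)) →
    l n x ∈ 𝒱 ((∑ i, d i) + 1)
  symm : ∀ (n : ℕ) (d : Fin n → ℤ) (x : Fin n → V), (∀ i, x i ∈ 𝒱 (d i)) →
    ∀ σ : Equiv.Perm (Fin n), l n x = (koszulSign d σ : ℤ) • l n (fun i => x (σ i))
  jacobi : ∀ (n : ℕ) (d : Fin n → ℤ) (x : Fin n → V), (∀ i, x i ∈ 𝒱 (d i)) →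
    ∑ i : Fin (n + 1), ∑ σ ∈ shuffles (by omega : (i : ℕ) + (n - i) = n),
      (koszulSign d σ : ℤ) • l (n - i + 1) (Fin.cons
        (l i fun a => x (σ (blocks (by omega : (i : ℕ) + (n - i) = n) (Sum.inl a))))
        (fun b => x (σ (blocks (by omega : (i : ℕ) + (n - i) = n) (Sum.inr b))))) = 0

end Abstract

/-! ### Quasi-twilled Lie pseudoalgebras and deformation maps of type I -/

section QuasiTwilled

variable {k H : Type*} [Field k] [Ring H] [HopfAlgebra k H] [IsCocomm k H]

/-- A skew-symmetric `H^{⊗2}`-linear map `Ω : L ⊗ L → H^{⊗2} ⊗_H L` is a Lie pseudobracket if it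
satisfies the Jacobi identity `Ω(x, Ω(y, z)) = Ω(Ω(x, y), z) + ((12) ⊗_H id) Ω(y, Ω(x, z))`
in `H^{⊗3} ⊗_H L`. -/
def IsLiePseudobracket {L : Type*} [AddCommGroup L] [Module k L] [Module H L] [IsScalarTower k H L]
    (Ω : Cochain k H 2 L L) : Prop :=
  let left (y : PTensor k H 2 L) (z : L) : PTensor k H 3 L :=
    Cochain.insertion Ω 0 (blocks (rfl : 2 + 1 = 3)) y ![z]
  let right (x : L) (y : PTensor k H 2 L) : PTensor k H 3 L :=
    Cochain.insertion Ω 1 ((Equiv.sumComm (Fin 2) (Fin 1)).trans (blocks (rfl : 1 + 2 = 3))) y ![x]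
  ∀ x y z : L, right x (Ω.1 ![y, z]) =
    left (Ω.1 ![x, y]) z + PTensor.perm (Equiv.swap 0 1) (right y (Ω.1 ![x, z]))

variable {g h : Type*}
  [AddCommGroup g] [Module k g] [Module H g] [IsScalarTower k H g]
  [AddCommGroup h] [Module k h] [Module H h] [IsScalarTower k H h]

/-- `(g ⊞ h, g, h)` with pseudobracket `Ω` is a quasi-twilled Lie pseudoalgebra: `Ω` is a Lie
pseudobracket and `h` is a Lie subpseudoalgebra. -/
def IsQuasiTwilled (Ω : Cochain k H 2 (g × h) (g × h)) : Prop :=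
  IsLiePseudobracket Ω ∧
    ∀ u v : h, ∃ w : PTensor k H 2 h, Ω.1 ![(0, u), (0, v)] = PTensor.map (LinearMap.inr H g h) w

/-- The component `π : g ⊗ g → H^{⊗2} ⊗_H g` of `Ω`. -/
def piPart (Ω : Cochain k H 2 (g × h) (g × h)) (x y : g) : PTensor k H 2 g :=
  PTensor.map (LinearMap.fst H g h) (Ω.1 ![(x, 0), (y, 0)])

/-- The component `ρ : g ⊗ h → H^{⊗2} ⊗_H h` of `Ω`. -/
def rhoPart (Ω : Cochain k H 2 (g × h) (g × h)) (x : g) (v : h) : PTensor k H 2 h :=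
  PTensor.map (LinearMap.snd H g h) (Ω.1 ![(x, 0), (0, v)])

/-- The component `μ : h ⊗ h → H^{⊗2} ⊗_H h` of `Ω`. -/
def muPart (Ω : Cochain k H 2 (g × h) (g × h)) (u v : h) : PTensor k H 2 h :=
  PTensor.map (LinearMap.snd H g h) (Ω.1 ![(0, u), (0, v)])

/-- The component `η : g ⊗ h → H^{⊗2} ⊗_H g` of `Ω`. -/
def etaPart (Ω : Cochain k H 2 (g × h) (g × h)) (x : g) (v : h) : PTensor k H 2 g :=
  PTensor.map (LinearMap.fst H g h) (Ω.1 ![(x, 0), (0, v)])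

/-- The component `θ : g ⊗ g → H^{⊗2} ⊗_H h` of `Ω`. -/
def thetaPart (Ω : Cochain k H 2 (g × h) (g × h)) (x y : g) : PTensor k H 2 h :=
  PTensor.map (LinearMap.snd H g h) (Ω.1 ![(x, 0), (y, 0)])

/-- Deformation maps of type I of `(g ⊞ h, g, h)`. -/
def IsDeformationMapI (Ω : Cochain k H 2 (g × h) (g × h)) (D : g →ₗ[H] h) : Prop :=
  ∀ x y : g,
    PTensor.map D (piPart Ω x y + etaPart Ω x (D y)
        - PTensor.perm (Equiv.swap 0 1) (etaPart Ω y (D x))) =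
      muPart Ω (D x) (D y) + rhoPart Ω x (D y)
        - PTensor.perm (Equiv.swap 0 1) (rhoPart Ω y (D x)) + thetaPart Ω x y

/-- The `H`-linear endomorphism `(x, u) ↦ (x, 0)` of `g ⊞ h`. -/
def toG (H g h : Type*) [Ring H] [AddCommGroup g] [Module H g] [AddCommGroup h] [Module H h] :
    (g × h) →ₗ[H] (g × h) := LinearMap.inl H g h ∘ₗ LinearMap.fst H g h

/-- The `H`-linear endomorphism `(x, u) ↦ (0, u)` of `g ⊞ h`. -/
def toH (H g h : Type*) [Ring H] [AddCommGroup g] [Module H g] [AddCommGroup h] [Module H h] :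
    (g × h) →ₗ[H] (g × h) := LinearMap.inr H g h ∘ₗ LinearMap.snd H g h

/-- The cochain `π̂((x, u), (y, v)) = (π(x, y), 0)`. -/
def piLift (Ω : Cochain k H 2 (g × h) (g × h)) : Cochain k H 2 (g × h) (g × h) :=
  Cochain.map 2 (toG H g h) (toG H g h) Ω

/-- The cochain `μ̂((x, u), (y, v)) = (0, μ(u, v))`. -/
def muLift (Ω : Cochain k H 2 (g × h) (g × h)) : Cochain k H 2 (g × h) (g × h) :=
  Cochain.map 2 (toH H g h) (toH H g h) Ω

/-- The cochain `θ̂((x, u), (y, v)) = (0, θ(x, y))`. -/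
def thetaLift (Ω : Cochain k H 2 (g × h) (g × h)) : Cochain k H 2 (g × h) (g × h) :=
  Cochain.map 2 (toG H g h) (toH H g h) Ω

/-- The part of `Ω` with one argument in `g` and one argument in `h`,
`((x, u), (y, v)) ↦ Ω((x, 0), (0, v)) + Ω((0, u), (y, 0))`. -/
def mixedPart (Ω : Cochain k H 2 (g × h) (g × h)) : Cochain k H 2 (g × h) (g × h) :=
  Ω - Cochain.map 2 (toG H g h) LinearMap.id Ω - Cochain.map 2 (toH H g h) LinearMap.id Ω

/-- The cochain `η̂((x, u), (y, v)) = (η(x, v) - ((12) ⊗_H id) η(y, u), 0)`,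
see `etaLift_apply`. -/
def etaLift (Ω : Cochain k H 2 (g × h) (g × h)) : Cochain k H 2 (g × h) (g × h) :=
  Cochain.map 2 LinearMap.id (toG H g h) (mixedPart Ω)

/-- The cochain `ρ̂((x, u), (y, v)) = (0, ρ(x, v) - ((12) ⊗_H id) ρ(y, u))`,
see `rhoLift_apply`. -/
def rhoLift (Ω : Cochain k H 2 (g × h) (g × h)) : Cochain k H 2 (g × h) (g × h) :=
  Cochain.map 2 LinearMap.id (toH H g h) (mixedPart Ω)

theorem PTensor.map_id {n : ℕ} (z : PTensor k H n g) : PTensor.map LinearMap.id z = z := by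
  induction z using PTensor.induction with
  | h0 => simp
  | hmk G a => rfl
  | hadd y z hy hz => rw [map_add, hy, hz]

theorem PTensor.map_comp {g' : Type*} [AddCommGroup g'] [Module k g'] [Module H g']
    [IsScalarTower k H g'] {n : ℕ} (α : g →ₗ[H] h) (β : h →ₗ[H] g') (z : PTensor k H n g) :
    PTensor.map (β ∘ₗ α) z = PTensor.map β (PTensor.map α z) := by
  induction z using PTensor.induction with
  | h0 => simp
  | hmk G a => rfl
  | hadd y z hy hz => simp only [map_add, hy, hz]

theorem mixedPart_apply (Ω : Cochain k H 2 (g × h) (g × h)) (x y : g) (u v : h) :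
    (mixedPart Ω).1 ![(x, u), (y, v)] = Ω.1 ![(x, 0), (0, v)]
      - PTensor.perm (Equiv.swap 0 1) (Ω.1 ![(y, 0), (0, u)]) := by
  have e : ∀ (a b c : g × h), Ω.1 ![a + b, c] = Ω.1 ![a, c] + Ω.1 ![b, c] := by
    intro a b c
    have := Ω.1.map_update_add ![0, c] 0 a b
    have e : ∀ z : g × h, Function.update ![0, c] 0 z = ![z, c] := by
      intro z; ext i <;> fin_cases i <;> rfl
    simpa only [e] using this
  have e' : ∀ (a b c : g × h), Ω.1 ![c, a + b] = Ω.1 ![c, a] + Ω.1 ![c, b] := by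
    intro a b c
    have := Ω.1.map_update_add ![c, 0] 1 a b
    have e : ∀ z : g × h, Function.update ![c, 0] 1 z = ![c, z] := by
      intro z; ext i <;> fin_cases i <;> rfl
    simpa only [e] using this
  have sk : Ω.1 ![(0, u), (y, 0)]
      = -PTensor.perm (Equiv.swap 0 1) (Ω.1 ![(y, 0), (0, u)]) := by
    rw [Ω.2.2 (Equiv.swap 0 1)]
    have : (fun i => (![(0, u), (y, 0)] : Fin 2 → g × h) (Equiv.swap 0 1 i))
        = ![(y, 0), (0, u)] := by
      ext i <;> fin_cases i <;> rfl
    rw [this]; simp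
  have hG : (fun i => toG H g h ((![(x, u), (y, v)] : Fin 2 → g × h) i)) = ![(x, 0), (y, 0)] := by
    ext i <;> fin_cases i <;> rfl
  have hH : (fun i => toH H g h ((![(x, u), (y, v)] : Fin 2 → g × h) i)) = ![(0, u), (0, v)] := by
    ext i <;> fin_cases i <;> rfl
  have hx : (x, u) = (x, 0) + ((0, u) : g × h) := by simp
  have hy : (y, v) = (y, 0) + ((0, v) : g × h) := by simp
  have h1 : (mixedPart Ω).1 ![(x, u), (y, v)] = Ω.1 ![(x, u), (y, v)]
      - Ω.1 ![(x, 0), (y, 0)] - Ω.1 ![(0, u), (0, v)] := by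
    change Ω.1 ![(x, u), (y, v)] - (Cochain.map 2 (toG H g h) LinearMap.id Ω).1 ![(x, u), (y, v)]
      - (Cochain.map 2 (toH H g h) LinearMap.id Ω).1 ![(x, u), (y, v)] = _
    rw [Cochain.map_apply, Cochain.map_apply, hG, hH, PTensor.map_id, PTensor.map_id]
  rw [h1, hx, hy, e, e', e', sk]
  abel

theorem etaLift_apply (Ω : Cochain k H 2 (g × h) (g × h)) (x y : g) (u v : h) :
    (etaLift Ω).1 ![(x, u), (y, v)] = PTensor.map (LinearMap.inl H g h)
      (etaPart Ω x v - PTensor.perm (Equiv.swap 0 1) (etaPart Ω y u)) := by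
  rw [etaLift, Cochain.map_apply]
  simp only [LinearMap.id_apply]
  rw [mixedPart_apply, toG, PTensor.map_comp, map_sub]
  simp only [PTensor.perm, PTensor.map_mapAlg, etaPart]

theorem rhoLift_apply (Ω : Cochain k H 2 (g × h) (g × h)) (x y : g) (u v : h) :
    (rhoLift Ω).1 ![(x, u), (y, v)] = PTensor.map (LinearMap.inr H g h)
      (rhoPart Ω x v - PTensor.perm (Equiv.swap 0 1) (rhoPart Ω y u)) := by
  rw [rhoLift, Cochain.map_apply]
  simp only [LinearMap.id_apply]
  rw [mixedPart_apply, toH, PTensor.map_comp, map_sub]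
  simp only [PTensor.perm, PTensor.map_mapAlg, rhoPart]

theorem iterComul_one (a : H) :
    iterComul k H 1 a = PiTensorProduct.tprod k (fun _ : Fin 1 => a) := by
  have h1 := comp_iterComul 1 (AlgHom.id k (TPow k H (Fin 1)))
  simp only [AlgHom.id_comp, List.ofFn_succ, List.ofFn_zero, List.prod_cons, List.prod_nil,
    mul_one] at h1
  have h2 : iterComul k H 1 a = slot k H 0 a := congrArg (fun u => u.ofConv a) h1
  rw [h2, slot_apply]
  congr 1
  funext i
  fin_cases i; simp

/-- An `H`-linear map `D : g → h` as the cochain `x ↦ 1 ⊗_H D(x)` in `C^1(g, h)`. -/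
def Cochain.ofHom (D : g →ₗ[H] h) : Cochain k H 1 g h :=
  ⟨MultilinearMap.ofSubsingleton k g (PTensor k H 1 h) 0
    ((PTensor.mkBilin k H h 1).comp (D.restrictScalars k)), by
    refine ⟨fun a x => ?_, fun σ x => ?_⟩
    · change PTensor.mk k H 1 (D (a 0 • x 0)) = _ • PTensor.mk k H 1 (D (x 0))
      rw [map_smul, ← PTensor.mk_mul_iterComul, PTensor.smul_mk, one_mul, mul_one, iterComul_one]
      congr 2
      funext i; fin_cases i; rfl
    · have : σ = 1 := Subsingleton.elim _ _
      subst this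
      change PTensor.mk k H 1 (D (x 0)) = _
      simp only [Equiv.Perm.sign_one, Units.val_one, one_smul]
      change _ = PTensor.mk k H (place k H (Equiv.toEmbedding 1) 1) (D (x 0))
      rw [map_one]⟩

theorem Cochain.ofHom_apply (D : g →ₗ[H] h) (x : Fin 1 → g) :
    (Cochain.ofHom (k := k) D).1 x = PTensor.mk k H 1 (D (x 0)) := rfl

variable (k H g h) in
/-- The embedding of `⨁ C^{n+1}(g, h)` into `⨁ C^{n+1}(g ⊞ h, g ⊞ h)`, sending `f` to
`((x₁, u₁), …) ↦ (0, f(x₁, …))`. -/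
def embed : CochainSpace k H g h →ₗ[k] CochainSpace k H (g × h) (g × h) :=
  DirectSum.lmap fun n => Cochain.map (n + 1) (LinearMap.fst H g h) (LinearMap.inr H g h)

variable (k H g h) in
/-- The map `⨁ C^{n+1}(g ⊞ h, g ⊞ h) → ⨁ C^{n+1}(g, h)` restricting a cochain to arguments in `g`
and taking the component in `h` of its values. -/
def restrict : CochainSpace k H (g × h) (g × h) →ₗ[k] CochainSpace k H g h :=
  DirectSum.lmap fun n => Cochain.map (n + 1) (LinearMap.inl H g h) (LinearMap.snd H g h)

variable (k H g h) in
/-- The projection `P` of `⨁ C^{n+1}(g ⊞ h, g ⊞ h)` onto `⨁ C^{n+1}(g, h)`. -/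
def projK : CochainSpace k H (g × h) (g × h) →ₗ[k] CochainSpace k H (g × h) (g × h) :=
  embed k H g h ∘ₗ restrict k H g h

/-- The derived brackets `l_n(f₁, …, fₙ) = P [⋯[[Ω, f₁], f₂], ⋯, fₙ]` on `⨁ C^{n+1}(g, h)`. -/
def derivedBracket (Ω : Cochain k H 2 (g × h) (g × h)) (n : ℕ) :
    MultilinearMap k (fun _ : Fin n => CochainSpace k H g h) (CochainSpace k H g h) :=
  ((restrict k H g h).compMultilinearMap
    (iterBracket (nrBracket k H (g × h)) (ofDegree k H (g × h) (g × h) 1 Ω) n)).compLinearMap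
      fun _ => embed k H g h

end QuasiTwilled

end
end LiePseudo

open LiePseudo

/-! Two facts carry the theorem: the Nijenhuis–Richardson bracket is a graded Lie bracket, and
bracketing with the projection onto `h` grades the cochains by a weight that governs `K`, `P` and
the components of `Ω`.

Graded Lie structure. The circle product is graded right pre-Lie: the associator `(f ⊚ g) ⊚ u - f ⊚
(g ⊚ u)` is graded symmetric in `g` and `u` (`Cochain.associator_comm`). Multiplying by factorials,
which can be cancelled in characteristic zero, replaces sums over shuffles by sums over all
permutations, where reindexing is free. In `(f ⊚ g) ⊚ u` the cochain `u` enters either an argument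
of `g` or another argument of `f`. The nested terms make up `f ⊚ (g ⊚ u)`; the parallel ones are
symmetric up to sign because `f` is skew-symmetric. The bookkeeping inside `H^{⊗n}` becomes
combinatorics through `IsFib.ext`: by cocommutativity, a composite of placements and iterated
coproducts is determined by which input factor feeds each output position.

Weight. Let `E` be the projection onto `h`, an element of degree `0` (`euler`). On the component of
a cochain with `s` arguments in `h`, the map `[·, E]` is multiplication by `s` if the value is taken
in `g` and by `s - 1` if it is taken in `h`. It is a derivation, so weights add. No weight is below
`-1`, and `K` is exactly the part of weight `-1`; hence `[K, K]`, of weight `-2`, vanishes, and `P`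
is the projection onto this part. The kernel of `P` is closed under the bracket because it consists
of the cochains sending arguments in `g` to values in `g`.

The cochains `θ`, `π + ρ`, `μ + η` have weights `-1`, `0`, `1`; the component `h ⊗ h → g`, of weight
`2`, is absent because `h` is a subalgebra. Counting weights gives all derived brackets. The Jacobi
identity says `[Ω, Ω] = 0`, and separating weights splits this into four equations
(`IsDerivedTriple.of_eigen`) which, with the graded Jacobi identity, are the higher Jacobi
identities in arities `0` to `3`.

Finally, the Maurer–Cartan expression of `D` is the restriction to `g` of `Ω + [Ω, D] + ½[[Ω, D],
D]`, and its value at `(x, y)` is the difference of the two sides of the deformation equation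
(`maurerCartan_apply`). -/

namespace LiePseudo

noncomputable section

/-! ### Algebra maps between tensor powers, described by their fibres -/

section Fibers

variable {k H : Type*} [Field k] [Ring H] [HopfAlgebra k H]

/-- The algebra map `F : H^{⊗a} → H^{⊗b}` applies to the `i`-th tensor factor the iterated
coproduct with values in the positions `j` with `φ j = some i`. -/
def IsFib {a b : ℕ} (F : TPow k H (Fin a) →ₐ[k] TPow k H (Fin b)) (φ : Fin b → Option (Fin a)) :
    Prop :=
  ∀ i, ∃ l : List (Fin b), l.Nodup ∧ (∀ j, j ∈ l ↔ φ j = some i) ∧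
    toConv (F.comp (slot k H i)).toLinearMap =
      (l.map fun j => toConv (slot k H j).toLinearMap).prod

/-- Composition with an algebra map on the left is multiplicative for convolution. -/
theorem toConv_comp_list_prod {ι A B : Type*} [Ring A] [Algebra k A] [Ring B] [Algebra k B]
    (G : A →ₐ[k] B) (u : ι → H →ₗ[k] A) (l : List ι) :
    toConv (G.toLinearMap ∘ₗ ((l.map fun j => toConv (u j)).prod).ofConv) =
      (l.map fun j => toConv (G.toLinearMap ∘ₗ u j)).prod := by
  induction l with
  | nil =>
    ext x
    simp [LinearMap.convOne_def]
  | cons i l ih =>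
    rw [List.map_cons, List.prod_cons, List.map_cons, List.prod_cons, ← ih]
    exact congrArg toConv (LinearMap.algHom_comp_convMul_distrib G (toConv (u i)) _)

/-- Slots at distinct positions have commuting values, and cocommutativity turns this into
commutation for convolution. So only the set of positions matters, not their order. -/
theorem prod_slot_eq [IsCocomm k H] {b : ℕ} {l l' : List (Fin b)} (hl : l.Nodup) (hp : l.Perm l') :
    (l.map fun j => toConv (slot k H j).toLinearMap).prod =
      (l'.map fun j => toConv (slot k H j).toLinearMap).prod := by
  refine (hp.map _).prod_eq' ?_
  rw [List.pairwise_map]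
  refine hl.imp ?_
  intro i j hij
  exact conv_commute _ _ fun x y => slot_commute k H hij x y

/-- An algebra map on `H^{⊗a}` is determined by its restrictions to the tensor factors, and each
restriction depends only on the set of positions it is spread over. All later identities between
composites of `place` and `spread` are proved by comparing fibre functions. -/
theorem IsFib.ext [IsCocomm k H] {a b : ℕ} {F G : TPow k H (Fin a) →ₐ[k] TPow k H (Fin b)}
    {φ ψ : Fin b → Option (Fin a)} (hF : IsFib F φ) (hG : IsFib G ψ) (h : ∀ j, φ j = ψ j) :
    F = G := by
  refine PiTensorProduct.algHom_ext fun i => ?_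
  obtain ⟨l, hl, hm, e⟩ := hF i
  obtain ⟨l', hl', hm', e'⟩ := hG i
  have : toConv (F.comp (slot k H i)).toLinearMap = toConv (G.comp (slot k H i)).toLinearMap := by
    rw [e, e']
    exact prod_slot_eq hl ((List.perm_ext_iff_of_nodup hl hl').2 fun j => by rw [hm, hm', h])
  exact AlgHom.ext fun x => congrArg (fun u => u.ofConv x) this

/-- Fibre functions point from outputs to inputs, so they compose in the opposite order: an output
position is traced back through `ψ`, then through `φ`. -/
theorem IsFib.comp {a b c : ℕ} {F : TPow k H (Fin a) →ₐ[k] TPow k H (Fin b)}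
    {G : TPow k H (Fin b) →ₐ[k] TPow k H (Fin c)}
    {φ : Fin b → Option (Fin a)} {ψ : Fin c → Option (Fin b)} (hG : IsFib G ψ) (hF : IsFib F φ) :
    IsFib (G.comp F) fun j => (ψ j).bind φ := by
  intro i
  obtain ⟨l, hl, hm, e⟩ := hF i
  choose L hL hLm eL using hG
  refine ⟨l.flatMap L, ?_, ?_, ?_⟩
  · rw [List.nodup_flatMap]
    refine ⟨fun j _ => hL j, hl.imp fun {x y} hxy => ?_⟩
    simp only [Function.onFun, List.disjoint_left]
    intro j hj hj'
    rw [hLm] at hj hj'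
    exact hxy (Option.some.inj (hj.symm.trans hj'))
  · intro j
    simp only [List.mem_flatMap, hm, hLm, Option.bind_eq_some_iff]
    exact ⟨fun ⟨x, h1, h2⟩ => ⟨x, h2, h1⟩, fun ⟨x, h1, h2⟩ => ⟨x, h2, h1⟩⟩
  · have h1 : toConv ((G.comp F).comp (slot k H i)).toLinearMap =
        toConv (G.toLinearMap ∘ₗ (toConv (F.comp (slot k H i)).toLinearMap).ofConv) := rfl
    rw [h1, e, toConv_comp_list_prod]
    have h2 : ∀ j, toConv (G.toLinearMap ∘ₗ (slot k H j).toLinearMap) =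
        ((L j).map fun j => toConv (slot k H j).toLinearMap).prod := fun j => eL j
    simp only [h2]
    rw [List.map_flatMap, List.flatMap_def, List.prod_flatten, List.map_map]
    rfl

theorem isFib_place {a b : ℕ} (ψ : Fin a ↪ Fin b) {φ : Fin b → Option (Fin a)}
    (h1 : ∀ j i, φ j = some i ↔ ψ i = j) : IsFib (place k H ψ) φ := by
  intro i
  refine ⟨[ψ i], by simp, fun j => ?_, ?_⟩
  · rw [h1, List.mem_singleton, eq_comm]
  · simp only [List.map_cons, List.map_nil, List.prod_cons, List.prod_nil, mul_one]
    congr 2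
    exact AlgHom.ext fun x => place_slot k H ψ i x

theorem isFib_spread {q m N : ℕ} (i : Fin (m + 1)) (e : Fin q ⊕ Fin m ≃ Fin N)  :
    IsFib (spread k H i e)
      fun j => some (Sum.elim (fun _ => i) (fun b => i.succAbove b) (e.symm j)) := by
  intro j
  rcases Fin.eq_self_or_eq_succAbove i j with rfl | ⟨j, rfl⟩
  · refine ⟨(List.finRange q).map (blockL e), (List.nodup_finRange q).map (blockL e).injective,
      fun b => ?_, ?_⟩
    · obtain ⟨c, rfl⟩ := e.surjective b
      rcases c with c | c <;> simp [blockL, Fin.succAbove_ne]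
    · have h1 : (spread k H j e).comp (slot k H j) = (place k H (blockL e)).comp (iterComul k H q) :=
        AlgHom.ext fun h => spread_slot_self k H j e h
      rw [h1, comp_iterComul, List.ofFn_eq_map, List.map_map]
      congr 2
      funext a
      exact congrArg (fun u : H →ₐ[k] _ => toConv u.toLinearMap)
        (AlgHom.ext fun h => place_slot k H _ a h)
  · refine ⟨[blockR e j], by simp, fun b => ?_, ?_⟩
    · obtain ⟨c, rfl⟩ := e.surjective b
      rcases c with c | c
      · simp only [List.mem_singleton, Equiv.symm_apply_apply, Sum.elim_inl, Option.some.injEq]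
        exact ⟨fun h => absurd h (block_ne e c j), fun h => absurd h (Fin.ne_succAbove i j)⟩
      · simp [blockR]
    · simp only [List.map_cons, List.map_nil, List.prod_cons, List.prod_nil, mul_one]
      congr 2
      exact AlgHom.ext fun x => spread_slot_succAbove k H i e j x

/-- The partial inverse of `blockL e`. -/
theorem isFib_blockL {q m N : ℕ} (e : Fin q ⊕ Fin m ≃ Fin N) :
    IsFib (place k H (blockL e)) fun j => Sum.elim some (fun _ => none) (e.symm j) := by
  refine isFib_place _ fun j i => ?_
  obtain ⟨c, rfl⟩ := e.surjective j
  rcases c with c | c <;> simp [blockL, eq_comm]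

theorem isFib_perm {N : ℕ} (σ : Equiv.Perm (Fin N)) :
    IsFib (place k H σ.toEmbedding) fun j => some (σ.symm j) := by
  refine isFib_place _ fun j i => ?_
  rw [Option.some.injEq, Equiv.symm_apply_eq, eq_comm]
  rfl

end Fibers

/-! ### Insertion, block decompositions, and circle products as sums over all permutations -/

section Insertion

variable {k H : Type*} [Field k] [Ring H] [HopfAlgebra k H]
variable {M N : Type*}
  [AddCommGroup M] [Module k M] [Module H M] [IsScalarTower k H M]
  [AddCommGroup N] [Module k N] [Module H N] [IsScalarTower k H N]

theorem PTensor.mapAlg_mapAlg {a b c : ℕ} (φ : TPow k H (Fin a) →ₐ[k] TPow k H (Fin b)) (hφ)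
    (ψ : TPow k H (Fin b) →ₐ[k] TPow k H (Fin c)) (hψ)
    (χ : TPow k H (Fin a) →ₐ[k] TPow k H (Fin c)) (hχ) (h : ψ.comp φ = χ) (z : PTensor k H a N) :
    PTensor.mapAlg ψ hψ (PTensor.mapAlg φ hφ z) = PTensor.mapAlg χ hχ z := by
  subst h
  induction z using PTensor.induction with
  | h0 => simp
  | hmk G a => rfl
  | hadd y z hy hz => simp only [map_add, hy, hz]

variable [IsCocomm k H]

theorem place_comp_spread {q m n : ℕ} (i : Fin (m + 1)) (e : Fin q ⊕ Fin m ≃ Fin n)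
    (σ : Equiv.Perm (Fin n)) :
    (place k H σ.toEmbedding).comp (spread k H i e) = spread k H i (e.trans σ) :=
  ((isFib_perm σ).comp (isFib_spread i e)).ext (isFib_spread i (e.trans σ)) fun j => by simp

/-- Insertion of pseudotensors into the first argument of a `k`-linear map
`u : M → H^{⊗(m+1)} ⊗_H N` which is `H`-linear for the first tensor factor of `H^{⊗(m+1)}`. -/
def insLin {q m n : ℕ} (u : M →ₗ[k] PTensor k H (m + 1) N)
    (hu : ∀ (h : H) (a : M), u (h • a) = slot k H (0 : Fin (m + 1)) h • u a) (e : Fin q ⊕ Fin m ≃ Fin n) :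
    PTensor k H q M →ₗ[k] PTensor k H n N :=
  PTensor.lift
    (LinearMap.mk₂ k
      (fun (G : TPow k H (Fin q)) (a : M) => place k H (blockL e) G •
        PTensor.mapAlg (spread k H 0 e) (spread_iterComul 0 e) (u a))
      (by intro G G' a; rw [map_add, add_smul])
      (by intro c G a; rw [map_smul, smul_assoc])
      (by intro G a b; rw [map_add, map_add, smul_add])
      (by intro c G a; rw [map_smul, map_smul, smul_comm]))
    (by
      intro G h a
      simp only [LinearMap.mk₂_apply]
      rw [hu, PTensor.mapAlg_smul, spread_slot_self, map_mul, mul_smul])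

theorem insLin_mk {q m n : ℕ} (u : M →ₗ[k] PTensor k H (m + 1) N) (hu)
    (e : Fin q ⊕ Fin m ≃ Fin n) (G : TPow k H (Fin q)) (a : M) :
    insLin u hu e (PTensor.mk k H G a) = place k H (blockL e) G •
        PTensor.mapAlg (spread k H 0 e) (spread_iterComul 0 e) (u a) := rfl

theorem PTensor.perm_mapAlg_spread {q m n : ℕ} (i : Fin (m + 1)) (e : Fin q ⊕ Fin m ≃ Fin n)
    (σ : Equiv.Perm (Fin n)) (w : PTensor k H (m + 1) N) :
    PTensor.perm σ (PTensor.mapAlg (spread k H i e) (spread_iterComul i e) w) =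
      PTensor.mapAlg (spread k H i (e.trans σ)) (spread_iterComul i (e.trans σ)) w :=
  PTensor.mapAlg_mapAlg _ _ _ _ _ _ (place_comp_spread i e σ) w

namespace Cochain

/-- Permuting the output only relabels the positions of the two blocks. Thus the permutation in each
term of a circle product can be absorbed into the decomposition `e`. -/
theorem perm_insertion {q m n : ℕ} (f : Cochain k H (m + 1) M N) (i : Fin (m + 1))
    (e : Fin q ⊕ Fin m ≃ Fin n) (σ : Equiv.Perm (Fin n)) (y : PTensor k H q M) (z : Fin m → M) :
    PTensor.perm σ (insertion f i e y z) = insertion f i (e.trans σ) y z := by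
  induction y using PTensor.induction with
  | h0 => simp
  | hmk G a =>
    rw [insertion_mk, insertion_mk, PTensor.perm_smul, PTensor.perm_mapAlg_spread, place_place]
    rfl
  | hadd y y' hy hy' => simp only [map_add, add_apply, hy, hy']

theorem exists_trans_blocks {q m n : ℕ} (e : Fin q ⊕ Fin m ≃ Fin n) :
    ∃ (h : q + m = n) (σ : Equiv.Perm (Fin n)), e = (blocks h).trans σ := by
  have h : q + m = n := by simpa using Fintype.card_congr e
  exact ⟨h, (blocks h).symm.trans e, by ext x; simp⟩

theorem insertion_sumCongr {q m n : ℕ} (f : Cochain k H (m + 1) M N)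
    (e : Fin q ⊕ Fin m ≃ Fin n) (κ₁ : Equiv.Perm (Fin q)) (κ₂ : Equiv.Perm (Fin m))
    (y : PTensor k H q M) (z : Fin m → M) :
    insertion f 0 ((Equiv.sumCongr κ₁ κ₂).trans e) y (fun j => z (κ₂ j)) =
      (Equiv.Perm.sign κ₂ : ℤ) • insertion f 0 e (PTensor.perm κ₁ y) z := by
  obtain ⟨h, σ, rfl⟩ := exists_trans_blocks e
  have h1 := congrArg (PTensor.perm σ) (insertion_perm h f κ₁ κ₂ y z)
  rw [map_zsmul, perm_insertion, perm_insertion, perm_insertion] at h1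
  rw [← h1]
  have he : (Equiv.sumCongr κ₁ κ₂).trans ((blocks h).trans σ) =
      ((blocks h).trans (blockPerm h κ₁ κ₂)).trans σ := by
    ext x
    rcases x with x | x <;> simp [blockPerm_inl, blockPerm_inr]
  rw [he]

/-- `f(g(x), x')` where `x` are the arguments in the first block of `e` and `x'` the ones in the
second block. -/
def kernel {q m n : ℕ} (e : Fin q ⊕ Fin m ≃ Fin n) (f : Cochain k H (m + 1) M N)
    (g : Cochain k H q M M) : MultilinearMap k (fun _ : Fin n => M) (PTensor k H n N) :=
  (((insertion f 0 e).compMultilinearMap g.1).uncurrySum).domDomCongr e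

theorem kernel_apply {q m n : ℕ} (e : Fin q ⊕ Fin m ≃ Fin n) (f : Cochain k H (m + 1) M N)
    (g : Cochain k H q M M) (x : Fin n → M) :
    kernel e f g x = insertion f 0 e (g.1 fun i => x (e (Sum.inl i)))
      (fun j => x (e (Sum.inr j))) := rfl

/-- Skew-symmetry of `g` yields the sign of `κ₁`, that of `f` in its remaining arguments the sign of
`κ₂`. -/
theorem kernel_sumCongr {q m n : ℕ} (e : Fin q ⊕ Fin m ≃ Fin n) (f : Cochain k H (m + 1) M N)
    (g : Cochain k H q M M) (κ₁ : Equiv.Perm (Fin q)) (κ₂ : Equiv.Perm (Fin m)) (x : Fin n → M) :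
    kernel ((Equiv.sumCongr κ₁ κ₂).trans e) f g x =
      (Equiv.Perm.sign κ₁ * Equiv.Perm.sign κ₂ : ℤ) • kernel e f g x := by
  rw [kernel_apply, kernel_apply]
  simp only [Equiv.trans_apply, Equiv.sumCongr_apply, Sum.map_inl, Sum.map_inr]
  rw [insertion_sumCongr f e κ₁ κ₂ _ fun j => x (e (Sum.inr j)),
    g.2.2 κ₁ (fun i => x (e (Sum.inl i)))]
  simp only [map_zsmul]
  have : ∀ W : MultilinearMap k (fun _ : Fin m => M) (PTensor k H n N),
    ∀ c : ℤ, ∀ z, (c • W) z = c • W z := fun _ _ _ => rfl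
  rw [this, smul_smul]
  have : ((Equiv.Perm.sign κ₁ : ℤ) * (Equiv.Perm.sign κ₁ : ℤ)) = 1 := by
    rw [← Units.val_mul, Int.units_mul_self]; rfl
  congr 1
  linear_combination -(Equiv.Perm.sign κ₂ : ℤ) * this

theorem kernel_equivariant {q m n : ℕ} (e : Fin q ⊕ Fin m ≃ Fin n) (f : Cochain k H (m + 1) M N)
    (g : Cochain k H q M M) (a : Fin n → H) (x : Fin n → M) :
    kernel e f g (fun i => a i • x i) = PiTensorProduct.tprod k a • kernel e f g x := by
  rw [kernel_apply, kernel_apply, g.2.1, insertion_equivariant, place_blocks_tprod e a]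

end Cochain

theorem blockPerm_mul {q m N : ℕ} (h : q + m = N) (a a' : Equiv.Perm (Fin q))
    (b b' : Equiv.Perm (Fin m)) :
    blockPerm h a b * blockPerm h a' b' = blockPerm h (a * a') (b * b') := by
  refine Equiv.ext fun x => ?_
  obtain ⟨c, rfl⟩ := (blocks h).surjective x
  rcases c with c | c <;> simp [blockPerm_inl, blockPerm_inr]

theorem blockPerm_one {q m N : ℕ} (h : q + m = N) : blockPerm h 1 1 = 1 := by
  refine Equiv.ext fun x => ?_
  obtain ⟨c, rfl⟩ := (blocks h).surjective x
  rcases c with c | c <;> simp [blockPerm_inl, blockPerm_inr]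

theorem blockPerm_injective {q m N : ℕ} (h : q + m = N) {a a' : Equiv.Perm (Fin q)}
    {b b' : Equiv.Perm (Fin m)} (hab : blockPerm h a b = blockPerm h a' b') : a = a' ∧ b = b' := by
  constructor
  · ext i
    have := congrArg (fun s : Equiv.Perm (Fin N) => s (blocks h (Sum.inl i))) hab
    simp only [blockPerm_inl, EmbeddingLike.apply_eq_iff_eq, Sum.inl.injEq] at this
    rw [this]
  · ext i
    have := congrArg (fun s : Equiv.Perm (Fin N) => s (blocks h (Sum.inr i))) hab
    simp only [blockPerm_inr, EmbeddingLike.apply_eq_iff_eq, Sum.inr.injEq] at this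
    rw [this]

/-- The sum over all permutations of a function which is invariant under permutations of the two
blocks is a multiple of its sum over shuffles. -/
theorem sum_perm_eq_sum_shuffles {q m n : ℕ} (h : q + m = n) {W : Type*} [AddCommMonoid W]
    (A : Equiv.Perm (Fin n) → W) (hA : ∀ σ κ₁ κ₂, A (σ * blockPerm h κ₁ κ₂) = A σ) :
    ∑ σ, A σ = (q.factorial * m.factorial) • ∑ σ ∈ shuffles h, A σ := by
  have h1 : ∑ σ, A σ = ∑ p ∈ shuffles h ×ˢ
      (Finset.univ : Finset (Equiv.Perm (Fin q) × Equiv.Perm (Fin m))), A p.1 := by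
    symm
    refine Finset.sum_bij (fun p _ => p.1 * blockPerm h p.2.1 p.2.2) (fun _ _ => Finset.mem_univ _)
      ?_ ?_ (fun p _ => (hA _ _ _).symm)
    · rintro ⟨s, a, b⟩ hp ⟨s', a', b'⟩ hp' he
      simp only [Finset.mem_product, Finset.mem_univ, and_true] at hp hp' he
      have h2 : s = s' * blockPerm h (a' * a⁻¹) (b' * b⁻¹) := by
        rw [← blockPerm_mul, ← mul_assoc, ← he, mul_assoc, blockPerm_mul]
        simp [blockPerm_one]
      -- The two shuffles lie in the same coset of the block permutations, and each coset contains
      -- only one.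
      have h3 : s = s' := by
        rw [h2]; exact shuffle_unique h _ _ hp' (h2 ▸ hp)
      subst h3
      obtain ⟨rfl, rfl⟩ := blockPerm_injective h (mul_left_cancel he)
      rfl
    · intro σ _
      -- Sorting the values of `σ` on each block gives the shuffle in its coset; the inverse sorting
      -- permutations recover `σ`.
      refine ⟨(sortPerm h σ, (Tuple.sort fun i => σ (blocks h (Sum.inl i)))⁻¹,
        (Tuple.sort fun i => σ (blocks h (Sum.inr i)))⁻¹), ?_, ?_⟩
      · simpa using sortPerm_mem h σ
      · simp only [sortPerm, mul_assoc, blockPerm_mul]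
        simp [blockPerm_one]
  rw [h1, Finset.sum_product]
  simp only [Finset.sum_const, Finset.card_univ, Fintype.card_prod, Fintype.card_perm,
    Fintype.card_fin]
  rw [Finset.smul_sum]

namespace Cochain

theorem circ_apply_kernel {q m n : ℕ} (h : q + m = n) (f : Cochain k H (m + 1) M N)
    (g : Cochain k H q M M) (x : Fin n → M) :
    (circ h f g).1 x = ∑ σ ∈ shuffles h, (Equiv.Perm.sign σ : ℤ) •
      kernel ((blocks h).trans σ) f g x := by
  rw [circ_apply]
  refine Finset.sum_congr rfl fun σ _ => ?_
  rw [perm_insertion]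
  rfl

/-- Each shuffle represents `q! m!` permutations with equal signed terms. The full sum is preferred
because it can be reindexed by any permutation. -/
theorem smul_circ_apply {q m n : ℕ} (h : q + m = n) (f : Cochain k H (m + 1) M N)
    (g : Cochain k H q M M) (x : Fin n → M) :
    (q.factorial * m.factorial) • (circ h f g).1 x = ∑ σ, (Equiv.Perm.sign σ : ℤ) •
      kernel ((blocks h).trans σ) f g x := by
  rw [circ_apply_kernel, sum_perm_eq_sum_shuffles h]
  intro σ κ₁ κ₂
  have h1 : (blocks h).trans (σ * blockPerm h κ₁ κ₂) =
      (Equiv.sumCongr κ₁ κ₂).trans ((blocks h).trans σ) := by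
    ext x
    rcases x with x | x <;> simp [blockPerm_inl, blockPerm_inr]
  rw [h1, kernel_sumCongr, smul_smul, Equiv.Perm.sign_mul, sign_blockPerm]
  congr 1
  push_cast
  have a1 : ((Equiv.Perm.sign κ₁ : ℤ) * (Equiv.Perm.sign κ₁ : ℤ)) = 1 := by
    rw [← Units.val_mul, Int.units_mul_self]; rfl
  have a2 : ((Equiv.Perm.sign κ₂ : ℤ) * (Equiv.Perm.sign κ₂ : ℤ)) = 1 := by
    rw [← Units.val_mul, Int.units_mul_self]; rfl
  linear_combination (Equiv.Perm.sign σ : ℤ) * (Equiv.Perm.sign κ₂ : ℤ) ^ 2 * a1 +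
    (Equiv.Perm.sign σ : ℤ) * a2

end Cochain

end Insertion

/-! ### Decompositions with a new first position -/

section Extensions

/-- The extension of `e : Fin n ⊕ Fin m ≃ Fin s` by a new first element in the first block. -/
def extL {n m s : ℕ} (e : Fin n ⊕ Fin m ≃ Fin s) : Fin (n + 1) ⊕ Fin m ≃ Fin (s + 1) where
  toFun := Sum.elim (Fin.cons 0 fun i => (e (Sum.inl i)).succ) fun j => (e (Sum.inr j)).succ
  invFun := Fin.cons (Sum.inl 0) fun i => Sum.map Fin.succ id (e.symm i)
  left_inv := by
    rintro (i | j)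
    · refine Fin.cases ?_ (fun i => ?_) i <;> simp
    · simp
  right_inv := by
    intro i
    refine Fin.cases ?_ (fun i => ?_) i
    · simp
    · obtain ⟨c, rfl⟩ := e.surjective i
      rcases c with c | c <;> simp

/-- The extension of `e : Fin n ⊕ Fin m ≃ Fin s` by a new first element in the second block. -/
def extR {n m s : ℕ} (e : Fin n ⊕ Fin m ≃ Fin s) : Fin n ⊕ Fin (m + 1) ≃ Fin (s + 1) where
  toFun := Sum.elim (fun i => (e (Sum.inl i)).succ) (Fin.cons 0 fun j => (e (Sum.inr j)).succ)
  invFun := Fin.cons (Sum.inr 0) fun i => Sum.map id Fin.succ (e.symm i)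
  left_inv := by
    rintro (i | j)
    · simp
    · refine Fin.cases ?_ (fun i => ?_) j <;> simp
  right_inv := by
    intro i
    refine Fin.cases ?_ (fun i => ?_) i
    · simp
    · obtain ⟨c, rfl⟩ := e.surjective i
      rcases c with c | c <;> simp

variable {n m s : ℕ} (e : Fin n ⊕ Fin m ≃ Fin s)

@[simp] theorem extL_inl_zero : extL e (Sum.inl 0) = 0 := rfl
@[simp] theorem extL_inl_succ (i : Fin n) : extL e (Sum.inl i.succ) = (e (Sum.inl i)).succ := rfl
@[simp] theorem extL_inr (j : Fin m) : extL e (Sum.inr j) = (e (Sum.inr j)).succ := rfl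
@[simp] theorem extL_symm_zero : (extL e).symm 0 = Sum.inl 0 := rfl
@[simp] theorem extL_symm_succ (i : Fin s) :
    (extL e).symm i.succ = Sum.map Fin.succ id (e.symm i) := rfl
@[simp] theorem extR_inl (i : Fin n) : extR e (Sum.inl i) = (e (Sum.inl i)).succ := rfl
@[simp] theorem extR_inr_zero : extR e (Sum.inr 0) = 0 := rfl
@[simp] theorem extR_inr_succ (j : Fin m) : extR e (Sum.inr j.succ) = (e (Sum.inr j)).succ := rfl
@[simp] theorem extR_symm_zero : (extR e).symm 0 = Sum.inr 0 := rfl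
@[simp] theorem extR_symm_succ (i : Fin s) :
    (extR e).symm i.succ = Sum.map id Fin.succ (e.symm i) := rfl

theorem val_blocks_inl {q m N : ℕ} (h : q + m = N) (i : Fin q) :
    (blocks h (Sum.inl i) : ℕ) = i := by simp [blocks]

theorem val_blocks_inr {q m N : ℕ} (h : q + m = N) (j : Fin m) :
    (blocks h (Sum.inr j) : ℕ) = q + j := by simp [blocks]

theorem swap_zero_one_succ_succ {m : ℕ} (i : Fin m) :
    Equiv.swap (0 : Fin (m + 2)) 1 i.succ.succ = i.succ.succ :=
  Equiv.swap_apply_of_ne_of_ne (Fin.succ_ne_zero _) (by simp [Fin.ext_iff])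

theorem exists_of_apply_zero {s : ℕ} (ρ : Equiv.Perm (Fin (s + 1))) (h : ρ 0 = 0) :
    ∃ ρ' : Equiv.Perm (Fin s), Equiv.Perm.sign ρ = Equiv.Perm.sign ρ' ∧
      ∀ i, ρ i.succ = (ρ' i).succ := by
  obtain ⟨⟨p, ρ'⟩, rfl⟩ := Equiv.Perm.decomposeFin.symm.surjective ρ
  rw [Equiv.Perm.decomposeFin_symm_apply_zero] at h
  subst h
  exact ⟨ρ', by simp, fun i => by simp⟩

/-- The first position of the first block is `0`, so `ρ` fixes `0` and the sign does not change. -/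
theorem exists_extL {n m s : ℕ} (h : n + 1 + m = s + 1) (h' : n + m = s)
    (ρ : Equiv.Perm (Fin (s + 1))) (h0 : ρ (blocks h (Sum.inl 0)) = 0) :
    ∃ ρ' : Equiv.Perm (Fin s), Equiv.Perm.sign ρ = Equiv.Perm.sign ρ' ∧
      (blocks h).trans ρ = extL ((blocks h').trans ρ') := by
  have hb : blocks h (Sum.inl 0) = 0 := Fin.ext (by simp [val_blocks_inl])
  obtain ⟨ρ', hs, hρ⟩ := exists_of_apply_zero ρ (by rwa [hb] at h0)
  refine ⟨ρ', hs, Equiv.ext ?_⟩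
  rintro (i | j)
  · refine Fin.cases ?_ (fun i => ?_) i
    · simpa using h0
    · have : blocks h (Sum.inl i.succ) = (blocks h' (Sum.inl i)).succ :=
        Fin.ext (by simp [val_blocks_inl])
      simp [this, hρ]
  · have : blocks h (Sum.inr j) = (blocks h' (Sum.inr j)).succ :=
        Fin.ext (by simp [val_blocks_inr]; omega)
    simp [this, hρ]

/-- The sign `(-1)^n` is the cost of moving the first element of the second block past the `n`
elements of the first. -/
theorem exists_extR {n m s : ℕ} (h : n + (m + 1) = s + 1) (h' : n + m = s)
    (ρ : Equiv.Perm (Fin (s + 1))) (h0 : ρ (blocks h (Sum.inr 0)) = 0) :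
    ∃ ρ' : Equiv.Perm (Fin s), (Equiv.Perm.sign ρ) = (-1) ^ n * Equiv.Perm.sign ρ' ∧
      (blocks h).trans ρ = extR ((blocks h').trans ρ') := by
  set p : Fin (s + 1) := blocks h (Sum.inr 0) with hp
  have hpn : (p : ℕ) = n := by simp [hp, val_blocks_inr]
  -- The inverse cycle sends `0` to `p`, so the composite fixes `0`; the cycle on `0, …, p` has sign
  -- `(-1)^p` with `p = n`.
  obtain ⟨ρ', hs, hρ⟩ := exists_of_apply_zero (ρ * (Fin.cycleRange p)⁻¹) (by
    rw [Equiv.Perm.mul_apply, Equiv.Perm.inv_def, Fin.cycleRange_symm_zero, h0])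
  have hc : ∀ i, ρ i = (ρ * (Fin.cycleRange p)⁻¹) (Fin.cycleRange p i) := by
    intro i; simp
  refine ⟨ρ', ?_, Equiv.ext ?_⟩
  · rw [← hs, Equiv.Perm.sign_mul, Equiv.Perm.sign_inv, Fin.sign_cycleRange, hpn, mul_comm,
      mul_assoc, ← mul_pow]
    simp
  · rintro (i | j)
    · have : Fin.cycleRange p (blocks h (Sum.inl i)) = (blocks h' (Sum.inl i)).succ := by
        have hlt : blocks h (Sum.inl i) < p := by
          rw [Fin.lt_def, hpn, val_blocks_inl]; exact i.2
        refine Fin.ext ?_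
        rw [Fin.coe_cycleRange_of_lt hlt]
        simp [val_blocks_inl]
      rw [Equiv.trans_apply, hc, this, hρ]
      rfl
    · refine Fin.cases ?_ (fun j => ?_) j
      · simpa using h0
      · have : Fin.cycleRange p (blocks h (Sum.inr j.succ)) = (blocks h' (Sum.inr j)).succ := by
          have hlt : p < blocks h (Sum.inr j.succ) := by
            rw [Fin.lt_def, hpn, val_blocks_inr]; simp
          rw [Fin.cycleRange_of_gt hlt]
          refine Fin.ext ?_
          simp [val_blocks_inr]; omega
        rw [Equiv.trans_apply, hc, this, hρ]
        rfl

end Extensions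

/-! ### Nested and parallel double insertions -/

section Assoc

variable {k H : Type*} [Field k] [Ring H] [HopfAlgebra k H] [IsCocomm k H]
variable {M N : Type*}
  [AddCommGroup M] [Module k M] [Module H M] [IsScalarTower k H M]
  [AddCommGroup N] [Module k N] [Module H N] [IsScalarTower k H N]

/-- The decomposition into three blocks given by two decompositions into two blocks. -/
def tripleEquiv {q n m s t : ℕ} (e' : Fin n ⊕ Fin m ≃ Fin s) (e : Fin q ⊕ Fin s ≃ Fin t) :
    (Fin q ⊕ Fin n) ⊕ Fin m ≃ Fin t :=
  (Equiv.sumAssoc _ _ _).trans ((Equiv.sumCongr (Equiv.refl _) e').trans e)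

@[simp] theorem tripleEquiv_inl_inl {q n m s t : ℕ} (e' : Fin n ⊕ Fin m ≃ Fin s)
    (e : Fin q ⊕ Fin s ≃ Fin t) (i : Fin q) :
    tripleEquiv e' e (Sum.inl (Sum.inl i)) = e (Sum.inl i) := rfl

@[simp] theorem tripleEquiv_inl_inr {q n m s t : ℕ} (e' : Fin n ⊕ Fin m ≃ Fin s)
    (e : Fin q ⊕ Fin s ≃ Fin t) (i : Fin n) :
    tripleEquiv e' e (Sum.inl (Sum.inr i)) = e (Sum.inr (e' (Sum.inl i))) := rfl

@[simp] theorem tripleEquiv_inr {q n m s t : ℕ} (e' : Fin n ⊕ Fin m ≃ Fin s)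
    (e : Fin q ⊕ Fin s ≃ Fin t) (i : Fin m) :
    tripleEquiv e' e (Sum.inr i) = e (Sum.inr (e' (Sum.inr i))) := rfl

@[simp] theorem tripleEquiv_symm_inl {q n m s t : ℕ} (e' : Fin n ⊕ Fin m ≃ Fin s)
    (e : Fin q ⊕ Fin s ≃ Fin t) (i : Fin q) :
    (tripleEquiv e' e).symm (e (Sum.inl i)) = Sum.inl (Sum.inl i) := by
  rw [Equiv.symm_apply_eq, tripleEquiv_inl_inl]

@[simp] theorem tripleEquiv_symm_inr_inl {q n m s t : ℕ} (e' : Fin n ⊕ Fin m ≃ Fin s)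
    (e : Fin q ⊕ Fin s ≃ Fin t) (i : Fin n) :
    (tripleEquiv e' e).symm (e (Sum.inr (e' (Sum.inl i)))) = Sum.inl (Sum.inr i) := by
  rw [Equiv.symm_apply_eq, tripleEquiv_inl_inr]

@[simp] theorem tripleEquiv_symm_inr_inr {q n m s t : ℕ} (e' : Fin n ⊕ Fin m ≃ Fin s)
    (e : Fin q ⊕ Fin s ≃ Fin t) (i : Fin m) :
    (tripleEquiv e' e).symm (e (Sum.inr (e' (Sum.inr i)))) = Sum.inr i := by
  rw [Equiv.symm_apply_eq, tripleEquiv_inr]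

namespace Cochain

theorem insertion_smul_left {q m n : ℕ} (f : Cochain k H (m + 1) M N) (i : Fin (m + 1))
    (e : Fin q ⊕ Fin m ≃ Fin n) (b : TPow k H (Fin q)) (y : PTensor k H q M) (z : Fin m → M) :
    insertion f i e (b • y) z = place k H (blockL e) b • insertion f i e y z := by
  have h := insertion_equivariant f i e b (1 : Fin m → H) y z
  rw [← PiTensorProduct.one_def, map_one, mul_one] at h
  simpa using h

/-- `f(g(y, z), w)` for a pseudotensor `y`. -/
def nest {q n m t : ℕ} (E : (Fin q ⊕ Fin n) ⊕ Fin m ≃ Fin t) (f : Cochain k H (m + 1) M N)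
    (g : Cochain k H (n + 1) M M) (y : PTensor k H q M) (z : Fin n → M) (w : Fin m → M) :
    PTensor k H t N :=
  insertion f 0 ((Equiv.sumCongr finSumFinEquiv.symm (Equiv.refl _)).trans E)
    (insertion g 0 finSumFinEquiv y z) w

/-- The inner decomposition is the standard one up to a permutation of the inner block, which can be
pushed into the outer decomposition. Hence only the resulting decomposition into three blocks
matters. -/
theorem insertion_insertion {q n m s t : ℕ} (e : Fin s ⊕ Fin m ≃ Fin t)
    (e' : Fin q ⊕ Fin n ≃ Fin s) (f : Cochain k H (m + 1) M N)
    (g : Cochain k H (n + 1) M M) (y : PTensor k H q M) (z : Fin n → M) (w : Fin m → M) :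
    insertion f 0 e (insertion g 0 e' y z) w =
      nest ((Equiv.sumCongr e' (Equiv.refl _)).trans e) f g y z w := by
  obtain ⟨rfl, σ, rfl⟩ := exists_trans_blocks e'
  rw [← perm_insertion]
  have h := insertion_sumCongr f e σ 1 (insertion g 0 (blocks rfl) y z) w
  rw [Equiv.Perm.sign_one, Units.val_one, one_smul] at h
  rw [← h]
  have hb : (blocks (rfl : q + n = q + n)) = finSumFinEquiv := by ext x; simp [blocks]
  rw [nest, hb]
  congr 3
  ext x
  rcases x with x | x <;> simp

/-- The `k`-linear map `a ↦ W(a, z)`. -/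
def consLin {s : ℕ} {V : Type*} [AddCommGroup V] [Module k V]
    (W : MultilinearMap k (fun _ : Fin (s + 1) => M) V) (z : Fin s → M) : M →ₗ[k] V where
  toFun a := W (Fin.cons a z)
  map_add' a b := W.cons_add z a b
  map_smul' c a := W.cons_smul z c a

theorem consLin_apply {s : ℕ} {V : Type*} [AddCommGroup V] [Module k V]
    (W : MultilinearMap k (fun _ : Fin (s + 1) => M) V) (z : Fin s → M) (a : M) :
    consLin W z a = W (Fin.cons a z) := rfl

theorem cons_smul_eq {s : ℕ} (c : H) (a : M) (z : Fin s → M) :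
    (Fin.cons (c • a) z : Fin (s + 1) → M) = fun i =>
      (Function.update (1 : Fin (s + 1) → H) 0 c) i • (Fin.cons a z : Fin (s + 1) → M) i := by
  funext i
  refine Fin.cases ?_ (fun i => ?_) i <;> simp

theorem consLin_kernel_smul {q m s : ℕ} (e : Fin q ⊕ Fin m ≃ Fin (s + 1))
    (f : Cochain k H (m + 1) M N) (g : Cochain k H q M M) (z : Fin s → M) (c : H) (a : M) :
    consLin (kernel e f g) z (c • a) = slot k H (0 : Fin (s + 1)) c • consLin (kernel e f g) z a := by
  rw [consLin_apply, consLin_apply, cons_smul_eq, kernel_equivariant]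
  rfl

theorem consLin_insertion_smul {n m s : ℕ} (e : Fin n ⊕ Fin m ≃ Fin s)
    (f : Cochain k H (m + 2) M N) (y : PTensor k H n M) (z : Fin m → M) (c : H) (a : M) :
    consLin (insertion f 0 (extR e) y) z (c • a) =
      slot k H (0 : Fin (s + 1)) c • consLin (insertion f 0 (extR e) y) z a := by
  rw [consLin_apply, consLin_apply, cons_smul_eq]
  have h := insertion_equivariant f 0 (extR e) 1 (Function.update (1 : Fin (m + 1) → H) 0 c) y
    (Fin.cons a z)
  rw [one_smul, map_one, one_mul, ← slot_apply, place_slot] at h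
  exact h

/-- This and the next two comparisons make nested insertion associative. They concern the
coefficient of the innermost pseudotensor, the coefficient produced by `g`, and the tensor factors
in the value of `f`. In each the fibre functions are compared on the three blocks. -/
theorem comp_blockL_finSumFinEquiv {q n m s t : ℕ} (e' : Fin n ⊕ Fin m ≃ Fin s)
    (e : Fin q ⊕ Fin s ≃ Fin t) :
    (place k H (blockL ((Equiv.sumCongr finSumFinEquiv.symm (Equiv.refl _)).trans
      (tripleEquiv e' e)))).comp (place k H (blockL finSumFinEquiv)) = place k H (blockL e) := by
  refine ((isFib_blockL _).comp (isFib_blockL _)).ext (isFib_blockL _) fun j => ?_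
  obtain ⟨((c | c) | c), rfl⟩ := (tripleEquiv e' e).surjective j
  · simp
  · simp
  · simp

theorem comp_blockL_spread {q n m s t : ℕ} (e' : Fin n ⊕ Fin m ≃ Fin s)
    (e : Fin q ⊕ Fin s ≃ Fin t) :
    (place k H (blockL ((Equiv.sumCongr finSumFinEquiv.symm (Equiv.refl _)).trans
      (tripleEquiv e' e)))).comp (spread k H (0 : Fin (n + 1)) finSumFinEquiv) =
    (spread k H 0 e).comp (place k H (blockL (extL e'))) := by
  refine ((isFib_blockL _).comp (isFib_spread _ _)).ext
    ((isFib_spread _ _).comp (isFib_blockL _)) fun j => ?_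
  obtain ⟨((c | c) | c), rfl⟩ := (tripleEquiv e' e).surjective j
  · simp
  · simp
  · simp

theorem spread_comp_spread_extL {q n m s t : ℕ} (e' : Fin n ⊕ Fin m ≃ Fin s)
    (e : Fin q ⊕ Fin s ≃ Fin t) :
    (spread k H 0 e).comp (spread k H 0 (extL e')) =
    spread k H 0 ((Equiv.sumCongr finSumFinEquiv.symm (Equiv.refl _)).trans
      (tripleEquiv e' e)) := by
  refine ((isFib_spread _ _).comp (isFib_spread _ _)).ext (isFib_spread _ _) fun j => ?_
  obtain ⟨((c | c) | c), rfl⟩ := (tripleEquiv e' e).surjective j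
  · simp
  · simp
  · simp

/-- With `extL` the argument replaced by `y` is the first argument of `g`, so the insertion is
nested. On pure tensors the claim is the three preceding comparisons. -/
theorem insLin_kernel_extL {q n m s t : ℕ} (e' : Fin n ⊕ Fin m ≃ Fin s)
    (e : Fin q ⊕ Fin s ≃ Fin t) (f : Cochain k H (m + 1) M N) (g : Cochain k H (n + 1) M M)
    (y : PTensor k H q M) (z : Fin s → M) :
    insLin (consLin (kernel (extL e') f g) z) (consLin_kernel_smul _ f g z) e y =
      nest (tripleEquiv e' e) f g y (fun i => z (e' (Sum.inl i))) fun j => z (e' (Sum.inr j)) := by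
  induction y using PTensor.induction with
  | h0 => simp [nest]
  | hadd y y' hy hy' =>
    rw [map_add, hy, hy']
    simp only [nest, map_add, add_apply]
  | hmk G a =>
    rw [insLin_mk, nest, insertion_mk, insertion_smul_left]
    have h1 := DFunLike.congr_fun (comp_blockL_finSumFinEquiv (k := k) (H := H) e' e) G
    rw [AlgHom.comp_apply] at h1
    rw [h1, consLin_apply, kernel_apply]
    congr 1
    have h2 : (fun i => (Fin.cons a z : Fin (s + 1) → M) (extL e' (Sum.inl i))) =
        Fin.insertNth (α := fun _ => M) 0 a (fun i => z (e' (Sum.inl i))) := by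
      funext i
      refine Fin.cases ?_ (fun i => ?_) i <;> simp
    have h3 : (fun i => (Fin.cons a z : Fin (s + 1) → M) (extL e' (Sum.inr i))) =
        fun i => z (e' (Sum.inr i)) := by
      funext i; simp
    rw [h2, h3]
    generalize g.1 (Fin.insertNth (α := fun _ => M) 0 a (fun i => z (e' (Sum.inl i)))) = v
    induction v using PTensor.induction with
    | h0 => simp
    | hadd v v' hv hv' => simp only [map_add, add_apply, hv, hv']
    | hmk G' b =>
      rw [PTensor.mapAlg_mk, insertion_mk, insertion_mk, PTensor.mapAlg_smul]
      have h4 := DFunLike.congr_fun (comp_blockL_spread (k := k) (H := H) e' e) G'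
      rw [AlgHom.comp_apply, AlgHom.comp_apply] at h4
      rw [h4]
      congr 1
      exact PTensor.mapAlg_mapAlg _ _ _ _ _ _ (spread_comp_spread_extL e' e) _

/-- The fibre functions here and in the next two lemmas are written through `tripleEquiv e' e`.
Consequently the parallel insertion depends on `e'` and `e` only through the decomposition into
three blocks. -/
theorem isFib_par_left {q n m s t : ℕ} (e' : Fin n ⊕ Fin m ≃ Fin s) (e : Fin q ⊕ Fin s ≃ Fin t) :
    IsFib (place k H (blockL e)) fun j =>
      Sum.elim (Sum.elim some fun _ => none) (fun _ => none) ((tripleEquiv e' e).symm j) := by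
  have h := isFib_blockL (k := k) (H := H) e
  convert h using 2 with j
  obtain ⟨((c | c) | c), rfl⟩ := (tripleEquiv e' e).surjective j <;> simp

theorem isFib_par_right {q n m s t : ℕ} (e' : Fin n ⊕ Fin m ≃ Fin s) (e : Fin q ⊕ Fin s ≃ Fin t) :
    IsFib ((spread k H 0 e).comp (place k H (blockL (extR e')))) fun j =>
      Sum.elim (Sum.elim (fun _ => none) some) (fun _ => none) ((tripleEquiv e' e).symm j) := by
  have h := (isFib_spread (k := k) (H := H) 0 e).comp (isFib_blockL (extR e'))
  convert h using 2 with j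
  obtain ⟨((c | c) | c), rfl⟩ := (tripleEquiv e' e).surjective j <;> simp

/-- The block of size `q` has index `1` and the block of size `n` index `0`: in `f(y', y, z)` the
pseudotensor `y'` comes first. -/
theorem isFib_par_spread {q n m s t : ℕ} (e' : Fin n ⊕ Fin m ≃ Fin s)
    (e : Fin q ⊕ Fin s ≃ Fin t) :
    IsFib ((spread k H 0 e).comp (spread k H (0 : Fin (m + 2)) (extR e'))) fun j =>
      some (Sum.elim (Sum.elim (fun _ => 1) fun _ => 0) (fun i : Fin m => i.succ.succ)
        ((tripleEquiv e' e).symm j)) := by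
  have h := (isFib_spread (k := k) (H := H) 0 e).comp (isFib_spread (0 : Fin (m + 2)) (extR e'))
  convert h using 2 with j
  obtain ⟨((c | c) | c), rfl⟩ := (tripleEquiv e' e).surjective j <;> simp

/-- `f(y', y, z)` for pseudotensors `y` and `y'`. -/
def par {q n m s t : ℕ} (e' : Fin n ⊕ Fin m ≃ Fin s) (e : Fin q ⊕ Fin s ≃ Fin t)
    (f : Cochain k H (m + 2) M N) (y : PTensor k H q M) (y' : PTensor k H n M) (z : Fin m → M) :
    PTensor k H t N :=
  insLin (consLin (insertion f 0 (extR e') y') z) (consLin_insertion_smul e' f y' z) e y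

theorem par_add_left {q n m s t : ℕ} (e' : Fin n ⊕ Fin m ≃ Fin s) (e : Fin q ⊕ Fin s ≃ Fin t)
    (f : Cochain k H (m + 2) M N) (y₁ y₂ : PTensor k H q M) (y' : PTensor k H n M) (z : Fin m → M) :
    par e' e f (y₁ + y₂) y' z = par e' e f y₁ y' z + par e' e f y₂ y' z := map_add _ _ _

theorem par_zero_left {q n m s t : ℕ} (e' : Fin n ⊕ Fin m ≃ Fin s) (e : Fin q ⊕ Fin s ≃ Fin t)
    (f : Cochain k H (m + 2) M N) (y' : PTensor k H n M) (z : Fin m → M) :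
    par e' e f 0 y' z = 0 := map_zero _

theorem par_add_right {q n m s t : ℕ} (e' : Fin n ⊕ Fin m ≃ Fin s) (e : Fin q ⊕ Fin s ≃ Fin t)
    (f : Cochain k H (m + 2) M N) (y : PTensor k H q M) (y₁ y₂ : PTensor k H n M) (z : Fin m → M) :
    par e' e f y (y₁ + y₂) z = par e' e f y y₁ z + par e' e f y y₂ z := by
  induction y using PTensor.induction with
  | h0 => simp [par_zero_left]
  | hadd y y' hy hy' =>
    rw [par_add_left, par_add_left, par_add_left, hy, hy']
    abel
  | hmk G a =>
    simp only [par, insLin_mk, consLin_apply, map_add, add_apply, smul_add]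

theorem par_zero_right {q n m s t : ℕ} (e' : Fin n ⊕ Fin m ≃ Fin s) (e : Fin q ⊕ Fin s ≃ Fin t)
    (f : Cochain k H (m + 2) M N) (y : PTensor k H q M) (z : Fin m → M) :
    par e' e f y 0 z = 0 := by
  have := par_add_right e' e f y 0 0 z
  rwa [add_zero, left_eq_add] at this

theorem par_mk_mk {q n m s t : ℕ} (e' : Fin n ⊕ Fin m ≃ Fin s) (e : Fin q ⊕ Fin s ≃ Fin t)
    (f : Cochain k H (m + 2) M N) (G : TPow k H (Fin q)) (a : M) (G' : TPow k H (Fin n)) (b : M)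
    (z : Fin m → M)
    (hs : ∀ x, ((spread k H 0 e).comp (spread k H (0 : Fin (m + 2)) (extR e')))
      (iterComul k H (m + 2) x) = iterComul k H t x) :
    par e' e f (PTensor.mk k H G a) (PTensor.mk k H G' b) z =
      (place k H (blockL e) G * (spread k H 0 e).comp (place k H (blockL (extR e'))) G') •
        PTensor.mapAlg ((spread k H 0 e).comp (spread k H (0 : Fin (m + 2)) (extR e'))) hs
          (f.1 (Fin.cons b (Fin.cons a z))) := by
  rw [par, insLin_mk, consLin_apply, insertion_mk, PTensor.mapAlg_smul, mul_smul,
    PTensor.mapAlg_mapAlg _ _ _ _ _ hs rfl, Fin.insertNth_zero']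
  rfl

theorem par_congr {q n m s t s' : ℕ} (e' : Fin n ⊕ Fin m ≃ Fin s) (e : Fin q ⊕ Fin s ≃ Fin t)
    (d' : Fin n ⊕ Fin m ≃ Fin s') (d : Fin q ⊕ Fin s' ≃ Fin t)
    (h : tripleEquiv e' e = tripleEquiv d' d)
    (f : Cochain k H (m + 2) M N) (y : PTensor k H q M) (y' : PTensor k H n M) (z : Fin m → M) :
    par e' e f y y' z = par d' d f y y' z := by
  induction y using PTensor.induction with
  | h0 => simp [par_zero_left]
  | hadd y₁ y₂ h₁ h₂ => rw [par_add_left, par_add_left, h₁, h₂]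
  | hmk G a =>
    induction y' using PTensor.induction with
    | h0 => simp [par_zero_right]
    | hadd y₁ y₂ h₁ h₂ => rw [par_add_right, par_add_right, h₁, h₂]
    | hmk G' b =>
      have c1 : place k H (blockL e) = place k H (blockL d) :=
        (isFib_par_left e' e).ext (isFib_par_left d' d) fun j => by rw [h]
      have c2 := (isFib_par_right (k := k) (H := H) e' e).ext (isFib_par_right d' d)
        fun j => by rw [h]
      have c3 := (isFib_par_spread (k := k) (H := H) e' e).ext (isFib_par_spread d' d)
        fun j => by rw [h]
      have hs : ∀ x, ((spread k H 0 e).comp (spread k H (0 : Fin (m + 2)) (extR e')))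
          (iterComul k H (m + 2) x) = iterComul k H t x := fun x => by
        rw [AlgHom.comp_apply, spread_iterComul, spread_iterComul]
      rw [par_mk_mk _ _ _ _ _ _ _ _ hs]
      simp only [c1, c2, c3]
      rw [par_mk_mk]

/-- The minus sign is the skew-symmetry of `f` in its first two arguments. The coefficients of `y`
and `y'` occupy disjoint blocks, so they commute although `H` need not be commutative. -/
theorem par_swap {q n m s t s' : ℕ} (e' : Fin n ⊕ Fin m ≃ Fin s) (e : Fin q ⊕ Fin s ≃ Fin t)
    (d' : Fin q ⊕ Fin m ≃ Fin s') (d : Fin n ⊕ Fin s' ≃ Fin t)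
    (h : (Equiv.sumCongr (Equiv.sumComm _ _) (Equiv.refl _)).trans (tripleEquiv e' e) =
      tripleEquiv d' d)
    (f : Cochain k H (m + 2) M N) (y : PTensor k H q M) (y' : PTensor k H n M) (z : Fin m → M) :
    par e' e f y y' z = -par d' d f y' y z := by
  induction y using PTensor.induction with
  | h0 => simp [par_zero_left, par_zero_right]
  | hadd y₁ y₂ h₁ h₂ => rw [par_add_left, par_add_right, h₁, h₂, neg_add]
  | hmk G a =>
    induction y' using PTensor.induction with
    | h0 => simp [par_zero_left, par_zero_right]
    | hadd y₁ y₂ h₁ h₂ => rw [par_add_left, par_add_right, h₁, h₂, neg_add]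
    | hmk G' b =>
      have c1 := (isFib_par_left (k := k) (H := H) e' e).ext (isFib_par_right d' d) fun j => by
        rw [← h]
        obtain ⟨((c | c) | c), rfl⟩ := (tripleEquiv e' e).surjective j <;> simp
      have c2 := (isFib_par_right (k := k) (H := H) e' e).ext (isFib_par_left d' d) fun j => by
        rw [← h]
        obtain ⟨((c | c) | c), rfl⟩ := (tripleEquiv e' e).surjective j <;> simp
      -- Transposing the first two tensor factors before spreading amounts to exchanging the two
      -- blocks they are spread over.
      have c3 := ((isFib_par_spread (k := k) (H := H) e' e).comp
          (isFib_perm (Equiv.swap 0 1))).ext (isFib_par_spread d' d) fun j => by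
        rw [← h]
        obtain ⟨((c | c) | c), rfl⟩ := (tripleEquiv e' e).surjective j
        · simp
        · simp
        · simp [swap_zero_one_succ_succ]
      have hs : ∀ x, ((spread k H 0 e).comp (spread k H (0 : Fin (m + 2)) (extR e')))
          (iterComul k H (m + 2) x) = iterComul k H t x := fun x => by
        rw [AlgHom.comp_apply, spread_iterComul, spread_iterComul]
      have hs' : ∀ x, ((spread k H 0 d).comp (spread k H (0 : Fin (m + 2)) (extR d')))
          (iterComul k H (m + 2) x) = iterComul k H t x := fun x => by
        rw [AlgHom.comp_apply, spread_iterComul, spread_iterComul]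
      rw [par_mk_mk _ _ _ _ _ _ _ _ hs, par_mk_mk _ _ _ _ _ _ _ _ hs', ← c1, ← c2,
        f.2.2 (Equiv.swap 0 1) (Fin.cons b (Fin.cons a z))]
      have h1 : (fun i => (Fin.cons b (Fin.cons a z) : Fin (m + 2) → M) (Equiv.swap 0 1 i)) =
          Fin.cons a (Fin.cons b z) := by
        funext i
        refine Fin.cases ?_ (fun i => Fin.cases ?_ (fun i => ?_) i) i
        · simp
        · simp
        · rw [swap_zero_one_succ_succ]
          simp
      rw [h1, map_zsmul, Equiv.Perm.sign_swap (by simp), PTensor.perm,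
        PTensor.mapAlg_mapAlg _ _ _ _ _ hs' c3]
      have h2 : place k H (blockL e) G * (spread k H 0 e).comp (place k H (blockL (extR e'))) G' =
          (spread k H 0 e).comp (place k H (blockL (extR e'))) G' * place k H (blockL e) G := by
        rw [c1, c2]
        rw [← c2]
        exact ((commute_of_support (Set.range (blockL e)) (Set.range (blockL d))
          (by
            rw [Set.disjoint_left]
            rintro _ ⟨i, rfl⟩ ⟨j, hj⟩
            have h3 : tripleEquiv e' e (Sum.inl (Sum.inr j)) = blockL d j := by
              have := DFunLike.congr_fun h (Sum.inl (Sum.inl j))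
              simpa [blockL] using this
            have h4 : tripleEquiv e' e (Sum.inl (Sum.inl i)) = blockL e i := rfl
            rw [← h3, ← h4] at hj
            simpa using (tripleEquiv e' e).injective hj)
          (by rw [← c1]; exact place_mem_span _ _) (by rw [c2]; exact place_mem_span _ _)).eq)
      rw [h2]
      simp

end Cochain

end Assoc

/-! ### Signs of rotations, counting permutations, cancelling factorials -/

section Signs

theorem val_finRotate_pow {N : ℕ} (q : ℕ) (i : Fin (N + 1)) :
    (((finRotate (N + 1)) ^ q) i : ℕ) = (i + q) % (N + 1) := by
  induction q with
  | zero => simp [Nat.mod_eq_of_lt i.2]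
  | succ q ih =>
    rw [pow_succ', Equiv.Perm.mul_apply, finRotate_apply, Fin.val_add, ih, Fin.val_one',
      ← Nat.add_mod, add_assoc]

/-- This exchange of blocks of lengths `a` and `q + 1` is the `(q + 1)`-st power of the rotation, of
sign `(-1)^{(a + q)(q + 1)}`, and `q(q + 1)` is even. -/
theorem sign_of_shift {a q N : ℕ} (hN : a + q = N) (σ : Equiv.Perm (Fin (N + 1)))
    (hlt : ∀ i : Fin (N + 1), (i : ℕ) < a → (σ i : ℕ) = i + (q + 1))
    (hge : ∀ i : Fin (N + 1), a ≤ (i : ℕ) → (σ i : ℕ) = i - a) :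
    Equiv.Perm.sign σ = (-1) ^ (a * (q + 1)) := by
  have h : σ = (finRotate (N + 1)) ^ (q + 1) := by
    refine Equiv.ext fun i => Fin.ext ?_
    rw [val_finRotate_pow]
    have := i.2
    rcases lt_or_ge (i : ℕ) a with hi | hi
    · rw [hlt i hi, Nat.mod_eq_of_lt (by omega)]
    · rw [hge i hi, Nat.mod_eq_sub_mod (by omega), Nat.mod_eq_of_lt (by omega)]
      omega
  rw [h, map_pow, sign_finRotate, Nat.add_sub_cancel, ← pow_mul, ← hN, add_mul, pow_add,
    (Nat.even_mul_succ_self q).neg_one_pow, mul_one]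

/-- For every `i` there are `s!` permutations sending `0` to `i`. -/
theorem sum_perm_apply_zero {s : ℕ} {W : Type*} [AddCommMonoid W] (A : Fin (s + 1) → W) :
    ∑ ρ : Equiv.Perm (Fin (s + 1)), A (ρ 0) = s.factorial • ∑ i, A i := by
  rw [← Equiv.sum_comp Equiv.Perm.decomposeFin.symm, Fintype.sum_prod_type]
  simp only [Equiv.Perm.decomposeFin_symm_apply_zero, Finset.sum_const, Finset.card_univ,
    Fintype.card_perm, Fintype.card_fin]
  rw [Finset.smul_sum]

theorem sum_perm_symm_apply_zero {s : ℕ} {W : Type*} [AddCommMonoid W] (A : Fin (s + 1) → W) :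
    ∑ ρ : Equiv.Perm (Fin (s + 1)), A (ρ.symm 0) = s.factorial • ∑ i, A i := by
  rw [← sum_perm_apply_zero, ← Equiv.sum_comp (Equiv.inv (Equiv.Perm (Fin (s + 1))))]
  rfl

/-- Characteristic zero enters here: this removes the factorials introduced by summing over all
permutations instead of shuffles. -/
theorem nsmul_left_cancel' (k : Type*) [Field k] [CharZero k] {V : Type*} [AddCommGroup V]
    [Module k V] {c : ℕ} (hc : c ≠ 0) {a b : V} (h : c • a = c • b) : a = b := by
  rw [← Nat.cast_smul_eq_nsmul k, ← Nat.cast_smul_eq_nsmul k c b] at h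
  exact smul_right_injective V (Nat.cast_ne_zero.2 hc) h

end Signs

/-! ### Permutations of three blocks -/

section Triple

/-- A permutation used at the inner stage is rewritten as one of all `t` arguments, so that a double
sum can be reindexed. The next lemma does the same when the inner stage involves the first two
blocks instead of the last two. -/
theorem triple_trans_mul {q n m s t : ℕ} (h' : n + m = s) (h : q + s = t)
    (ρ : Equiv.Perm (Fin s)) (σ : Equiv.Perm (Fin t)) :
    tripleEquiv ((blocks h').trans ρ) ((blocks h).trans σ) =
      tripleEquiv (blocks h') ((blocks h).trans (σ * blockPerm h 1 ρ)) := by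
  ext x
  rcases x with (x | x) | x <;> simp [blockPerm_inl, blockPerm_inr]

theorem sumCongr_trans_mul {q n m s u t : ℕ} (h' : n + m = s) (h : q + s = t) (h1 : q + n = u)
    (h2 : u + m = t) (ρ : Equiv.Perm (Fin u)) (σ : Equiv.Perm (Fin t)) :
    (Equiv.sumCongr ((blocks h1).trans ρ) (Equiv.refl _)).trans ((blocks h2).trans σ) =
      tripleEquiv (blocks h') ((blocks h).trans (σ * blockPerm h2 ρ 1)) := by
  have e1 : ∀ i, blocks h (Sum.inl i) = blocks h2 (Sum.inl (blocks h1 (Sum.inl i))) := fun i =>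
    Fin.ext (by simp [val_blocks_inl])
  have e2 : ∀ i, blocks h (Sum.inr (blocks h' (Sum.inl i))) =
      blocks h2 (Sum.inl (blocks h1 (Sum.inr i))) := fun i =>
    Fin.ext (by simp [val_blocks_inl, val_blocks_inr])
  have e3 : ∀ i, blocks h (Sum.inr (blocks h' (Sum.inr i))) = blocks h2 (Sum.inr i) := fun i =>
    Fin.ext (by simp [val_blocks_inr]; omega)
  ext x
  rcases x with (x | x) | x
  · simp [e1, blockPerm_inl]
  · simp [e2, blockPerm_inl]
  · simp [e3, blockPerm_inr]

/-- The permutation exchanging the first two of three blocks. -/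
theorem exists_block_swap {q n m s s' t : ℕ} (h' : n + m = s) (h : q + 1 + s = t)
    (d' : q + 1 + m = s') (d : n + s' = t) :
    ∃ β : Equiv.Perm (Fin t), Equiv.Perm.sign β = (-1) ^ (n * (q + 1)) ∧
      ∀ τ : Equiv.Perm (Fin t), (Equiv.sumCongr (Equiv.sumComm _ _) (Equiv.refl _)).trans
        (tripleEquiv (blocks h') ((blocks h).trans τ)) =
      tripleEquiv (blocks d') ((blocks d).trans (τ * β)) := by
  have hb : n + (q + 1) + m = t := by omega
  have hc : n + q + 1 = n + (q + 1) := by omega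
  -- `γ` exchanges the two leading blocks; the last `m` positions stay fixed. Its size is written `n
  -- + q + 1` to fit `sign_of_shift` with `a = n`.
  let γ : Equiv.Perm (Fin (n + q + 1)) :=
    (blocks (by omega : n + (q + 1) = n + q + 1)).symm.trans
      ((Equiv.sumComm _ _).trans (blocks (by omega : q + 1 + n = n + q + 1)))
  have γl : ∀ i, γ (blocks (by omega : n + (q + 1) = n + q + 1) (Sum.inl i)) =
    blocks (by omega : q + 1 + n = n + q + 1) (Sum.inr i) := fun i => by simp [γ]
  have γr : ∀ i, γ (blocks (by omega : n + (q + 1) = n + q + 1) (Sum.inr i)) =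
    blocks (by omega : q + 1 + n = n + q + 1) (Sum.inl i) := fun i => by simp [γ]
  have sγ : Equiv.Perm.sign γ = (-1) ^ (n * (q + 1)) := by
    refine sign_of_shift rfl γ (fun i hi => ?_) (fun i hi => ?_)
    · obtain ⟨(c | c), rfl⟩ := (blocks (by omega : n + (q + 1) = n + q + 1)).surjective i
      · rw [γl, val_blocks_inl, val_blocks_inr, add_comm]
      · rw [val_blocks_inr] at hi; omega
    · obtain ⟨(c | c), rfl⟩ := (blocks (by omega : n + (q + 1) = n + q + 1)).surjective i
      · rw [val_blocks_inl] at hi; omega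
      · rw [γr, val_blocks_inl, val_blocks_inr]; omega
  have hb' : n + q + 1 + m = t := by omega
  refine ⟨blockPerm hb' γ 1, by rw [sign_blockPerm, sγ]; simp, fun τ => ?_⟩
  have e1 : ∀ i : Fin n, blockPerm hb' γ 1 (blocks d (Sum.inl i)) =
      blocks h (Sum.inr (blocks h' (Sum.inl i))) := fun i => by
    have : blocks d (Sum.inl i) = blocks hb' (Sum.inl
        (blocks (by omega : n + (q + 1) = n + q + 1) (Sum.inl i))) :=
      Fin.ext (by simp [val_blocks_inl])
    rw [this, blockPerm_inl, γl]
    exact Fin.ext (by simp [val_blocks_inl, val_blocks_inr])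
  have e2 : ∀ i : Fin (q + 1), blockPerm hb' γ 1 (blocks d (Sum.inr (blocks d' (Sum.inl i)))) =
      blocks h (Sum.inl i) := fun i => by
    have : blocks d (Sum.inr (blocks d' (Sum.inl i))) = blocks hb' (Sum.inl
        (blocks (by omega : n + (q + 1) = n + q + 1) (Sum.inr i))) :=
      Fin.ext (by simp [val_blocks_inl, val_blocks_inr])
    rw [this, blockPerm_inl, γr]
    exact Fin.ext (by simp [val_blocks_inl])
  have e3 : ∀ i : Fin m, blockPerm hb' γ 1 (blocks d (Sum.inr (blocks d' (Sum.inr i)))) =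
      blocks h (Sum.inr (blocks h' (Sum.inr i))) := fun i => by
    have : blocks d (Sum.inr (blocks d' (Sum.inr i))) = blocks hb' (Sum.inr i) :=
      Fin.ext (by simp [val_blocks_inr]; omega)
    rw [this, blockPerm_inr]
    exact Fin.ext (by simp [val_blocks_inr]; omega)
  ext x
  rcases x with (x | x) | x
  · simp [e1]
  · simp [e2]
  · simp [e3]

end Triple

/-! ### The graded pre-Lie identity -/

section PreLie

variable {k H : Type*} [Field k] [Ring H] [HopfAlgebra k H] [IsCocomm k H]
variable {M N : Type*}
  [AddCommGroup M] [Module k M] [Module H M] [IsScalarTower k H M]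
  [AddCommGroup N] [Module k N] [Module H N] [IsScalarTower k H N]

/-- The integer coefficients are there to compare kernels that agree only up to the signs of their
permutations. -/
theorem smul_insLin_congr {q m n : ℕ} (u u' : M →ₗ[k] PTensor k H (m + 1) N) (hu hu')
    (e : Fin q ⊕ Fin m ≃ Fin n) (c d : ℤ) (h : ∀ a, c • u a = d • u' a) (y : PTensor k H q M) :
    c • insLin u hu e y = d • insLin u' hu' e y := by
  induction y using PTensor.induction with
  | h0 => simp
  | hadd y y' hy hy' => simp only [map_add, smul_add, hy, hy']
  | hmk G a =>
    rw [insLin_mk, insLin_mk, smul_comm, ← map_zsmul, h, map_zsmul, smul_comm]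

namespace Cochain

theorem sign_smul_kernel_mul {q m n : ℕ} (h : q + m = n) (f : Cochain k H (m + 1) M N)
    (g : Cochain k H q M M) (σ : Equiv.Perm (Fin n)) (κ₁ : Equiv.Perm (Fin q))
    (κ₂ : Equiv.Perm (Fin m)) (x : Fin n → M) :
    (Equiv.Perm.sign (σ * blockPerm h κ₁ κ₂) : ℤ) •
      kernel ((blocks h).trans (σ * blockPerm h κ₁ κ₂)) f g x =
    (Equiv.Perm.sign σ : ℤ) • kernel ((blocks h).trans σ) f g x := by
  have h1 : (blocks h).trans (σ * blockPerm h κ₁ κ₂) =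
      (Equiv.sumCongr κ₁ κ₂).trans ((blocks h).trans σ) := by
    ext x
    rcases x with x | x <;> simp [blockPerm_inl, blockPerm_inr]
  rw [h1, kernel_sumCongr, smul_smul, Equiv.Perm.sign_mul, sign_blockPerm]
  congr 1
  push_cast
  have a1 : ((Equiv.Perm.sign κ₁ : ℤ) * (Equiv.Perm.sign κ₁ : ℤ)) = 1 := by
    rw [← Units.val_mul, Int.units_mul_self]; rfl
  have a2 : ((Equiv.Perm.sign κ₂ : ℤ) * (Equiv.Perm.sign κ₂ : ℤ)) = 1 := by
    rw [← Units.val_mul, Int.units_mul_self]; rfl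
  linear_combination (Equiv.Perm.sign σ : ℤ) * (Equiv.Perm.sign κ₂ : ℤ) ^ 2 * a1 +
    (Equiv.Perm.sign σ : ℤ) * a2

/-- `f(g(h(x), x'), x'')` for the decomposition of the arguments given by `E`. -/
def nestAt {q n m t : ℕ} (E : (Fin q ⊕ Fin n) ⊕ Fin m ≃ Fin t) (f : Cochain k H (m + 1) M N)
    (g : Cochain k H (n + 1) M M) (h : Cochain k H q M M) (x : Fin t → M) : PTensor k H t N :=
  nest E f g (h.1 fun i => x (E (Sum.inl (Sum.inl i)))) (fun i => x (E (Sum.inl (Sum.inr i))))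
    fun i => x (E (Sum.inr i))

/-- `f(g(x'), h(x), x'')` for the decomposition of the arguments given by `e` and `e'`. -/
def parAt {q n m s t : ℕ} (e' : Fin n ⊕ Fin m ≃ Fin s) (e : Fin q ⊕ Fin s ≃ Fin t)
    (f : Cochain k H (m + 2) M N) (g : Cochain k H n M M) (h : Cochain k H q M M)
    (x : Fin t → M) : PTensor k H t N :=
  par e' e f (h.1 fun i => x (tripleEquiv e' e (Sum.inl (Sum.inl i))))
    (g.1 fun i => x (tripleEquiv e' e (Sum.inl (Sum.inr i))))
    fun i => x (tripleEquiv e' e (Sum.inr i))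

/-- The skew-symmetrization of `f(g(h(x), x'), x'')`. -/
def nestSum {q n m s t : ℕ} (h' : n + m = s) (h₀ : q + s = t) (f : Cochain k H (m + 1) M N)
    (g : Cochain k H (n + 1) M M) (h : Cochain k H q M M) (x : Fin t → M) : PTensor k H t N :=
  ∑ τ, (Equiv.Perm.sign τ : ℤ) • nestAt (tripleEquiv (blocks h') ((blocks h₀).trans τ)) f g h x

/-- The skew-symmetrization of `f(g(x'), h(x), x'')`. -/
def parSum {q n m s t : ℕ} (h' : n + m = s) (h₀ : q + s = t) (f : Cochain k H (m + 2) M N)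
    (g : Cochain k H n M M) (h : Cochain k H q M M) (x : Fin t → M) : PTensor k H t N :=
  ∑ τ, (Equiv.Perm.sign τ : ℤ) • parAt (blocks h') ((blocks h₀).trans τ) f g h x

theorem sum_sign_mul {t : ℕ} {V : Type*} [AddCommGroup V] (β : Equiv.Perm (Fin t))
    (A : Equiv.Perm (Fin t) → V) :
    ∑ σ, (Equiv.Perm.sign σ : ℤ) • A (σ * β) =
      (Equiv.Perm.sign β : ℤ) • ∑ τ, (Equiv.Perm.sign τ : ℤ) • A τ := by
  rw [← Equiv.sum_comp (Equiv.mulRight β) fun τ => (Equiv.Perm.sign τ : ℤ) • A τ, Finset.smul_sum]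
  refine Finset.sum_congr rfl fun σ _ => ?_
  simp only [Equiv.coe_mulRight]
  rw [smul_smul, Equiv.Perm.sign_mul, Units.val_mul, mul_comm, mul_assoc, ← Units.val_mul,
    Int.units_mul_self, Units.val_one, mul_one]

theorem sign_smul_sign_smul {n : ℕ} {V : Type*} [AddCommGroup V] (β : Equiv.Perm (Fin n)) (v : V) :
    (Equiv.Perm.sign β : ℤ) • (Equiv.Perm.sign β : ℤ) • v = v := by
  rw [smul_smul, ← Units.val_mul, Int.units_mul_self, Units.val_one, one_smul]

/-- Both circle products become sums over permutations. For each inner permutation the outer sum can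
be reindexed, with matching signs, to `nestSum`; the resulting factor `u!` is cancelled. -/
theorem smul_circ_circ_right [CharZero k] {q n m s u t : ℕ} (h' : n + m = s) (h₀ : q + s = t)
    (h1 : q + n = u) (h2 : u + m = t) (f : Cochain k H (m + 1) M N)
    (g : Cochain k H (n + 1) M M) (h : Cochain k H q M M) (x : Fin t → M) :
    (q.factorial * n.factorial * m.factorial) • (circ h2 f (circ h1 g h)).1 x =
      nestSum h' h₀ f g h x := by
  refine nsmul_left_cancel' k u.factorial_ne_zero ?_
  have e1 : ∀ σ : Equiv.Perm (Fin t), (q.factorial * n.factorial) •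
      kernel ((blocks h2).trans σ) f (circ h1 g h) x =
      ∑ ρ, (Equiv.Perm.sign ρ : ℤ) •
        nestAt (tripleEquiv (blocks h') ((blocks h₀).trans (σ * blockPerm h2 ρ 1))) f g h x := by
    intro σ
    have : ∀ (W : MultilinearMap k (fun _ : Fin m => M) (PTensor k H t N)) (c : ℕ) z,
      (c • W) z = c • W z := fun _ _ _ => rfl
    rw [kernel_apply, ← this, ← map_nsmul, smul_circ_apply, map_sum, sum_apply]
    refine Finset.sum_congr rfl fun ρ _ => ?_
    have : ∀ (W : MultilinearMap k (fun _ : Fin m => M) (PTensor k H t N)) (c : ℤ) z,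
      (c • W) z = c • W z := fun _ _ _ => rfl
    rw [map_zsmul, this, kernel_apply, insertion_insertion, ← sumCongr_trans_mul h' h₀ h1]
    rfl
  have e2 := congrArg (fun w => (q.factorial * n.factorial) • w)
    (smul_circ_apply h2 f (circ h1 g h) x)
  simp only [Finset.smul_sum] at e2
  have e3 : ∀ σ : Equiv.Perm (Fin t), (q.factorial * n.factorial) • (Equiv.Perm.sign σ : ℤ) •
      kernel ((blocks h2).trans σ) f (circ h1 g h) x =
      ∑ ρ : Equiv.Perm (Fin u), (Equiv.Perm.sign ρ : ℤ) • (Equiv.Perm.sign σ : ℤ) •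
        nestAt (tripleEquiv (blocks h') ((blocks h₀).trans (σ * blockPerm h2 ρ 1))) f g h x := by
    intro σ
    rw [smul_comm, e1, Finset.smul_sum]
    exact Finset.sum_congr rfl fun ρ _ => smul_comm _ _ _
  simp only [e3] at e2
  rw [Finset.sum_comm] at e2
  have e4 : ∀ ρ : Equiv.Perm (Fin u), ∑ σ : Equiv.Perm (Fin t), (Equiv.Perm.sign ρ : ℤ) •
      (Equiv.Perm.sign σ : ℤ) •
        nestAt (tripleEquiv (blocks h') ((blocks h₀).trans (σ * blockPerm h2 ρ 1))) f g h x =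
      nestSum h' h₀ f g h x := by
    intro ρ
    rw [← Finset.smul_sum, sum_sign_mul (blockPerm h2 ρ 1) fun τ =>
        nestAt (tripleEquiv (blocks h') ((blocks h₀).trans τ)) f g h x,
      sign_blockPerm, Equiv.Perm.sign_one, mul_one, sign_smul_sign_smul]
    rfl
  simp only [e4, Finset.sum_const, Finset.card_univ, Fintype.card_perm, Fintype.card_fin] at e2
  rw [← e2, smul_smul, smul_smul]
  congr 1
  ring

theorem smul_insertion_circ {q p m s t : ℕ} (h1 : p + m = s + 1) (f : Cochain k H (m + 1) M N)
    (g : Cochain k H p M M) (e : Fin q ⊕ Fin s ≃ Fin t) (y : PTensor k H q M) (z : Fin s → M) :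
    (p.factorial * m.factorial) • insertion (circ h1 f g) 0 e y z =
      ∑ ρ, (Equiv.Perm.sign ρ : ℤ) •
        insLin (consLin (kernel ((blocks h1).trans ρ) f g) z) (consLin_kernel_smul _ f g z) e y := by
  induction y using PTensor.induction with
  | h0 => simp
  | hadd y y' hy hy' =>
    simp only [map_add, add_apply, smul_add, hy, hy', Finset.sum_add_distrib]
  | hmk G a =>
    rw [insertion_mk, smul_comm, ← map_nsmul, smul_circ_apply, map_sum, Finset.smul_sum]
    refine Finset.sum_congr rfl fun ρ _ => ?_
    rw [map_zsmul, smul_comm, insLin_mk, consLin_apply, Fin.insertNth_zero']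

/-- In `f ⊚ g` the argument numbered `0` is the one to be filled by `h`; here `ρ` makes it an
argument of `g`, which gives a nested term. -/
theorem sign_smul_sum_insLin_inl {q n m s t : ℕ} (h' : n + m = s) (h₀ : q + s = t)
    (h1 : n + 1 + m = s + 1) (f : Cochain k H (m + 1) M N)
    (g : Cochain k H (n + 1) M M) (h : Cochain k H q M M) (x : Fin t → M)
    (ρ : Equiv.Perm (Fin (s + 1))) (i : Fin (n + 1)) (hρ : ρ (blocks h1 (Sum.inl i)) = 0) :
    ∑ σ : Equiv.Perm (Fin t), (Equiv.Perm.sign σ : ℤ) • (Equiv.Perm.sign ρ : ℤ) •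
      insLin (consLin (kernel ((blocks h1).trans ρ) f g)
        (fun j => x (((blocks h₀).trans σ) (Sum.inr j)))) (consLin_kernel_smul _ f g _)
        ((blocks h₀).trans σ) (h.1 fun j => x (((blocks h₀).trans σ) (Sum.inl j))) =
      nestSum h' h₀ f g h x := by
  -- Exchanging the arguments `0` and `i` of `g` leaves the signed kernel unchanged and brings the
  -- marked argument to the front.
  obtain ⟨ρ', hs, hρ'⟩ := exists_extL h1 h' (ρ * blockPerm h1 (Equiv.swap 0 i) 1) (by
    rw [Equiv.Perm.mul_apply, blockPerm_inl, Equiv.swap_apply_left, hρ])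
  have key : ∀ σ : Equiv.Perm (Fin t), (Equiv.Perm.sign ρ : ℤ) •
      insLin (consLin (kernel ((blocks h1).trans ρ) f g)
        (fun j => x (((blocks h₀).trans σ) (Sum.inr j)))) (consLin_kernel_smul _ f g _)
        ((blocks h₀).trans σ) (h.1 fun j => x (((blocks h₀).trans σ) (Sum.inl j))) =
      (Equiv.Perm.sign ρ' : ℤ) • nestAt (tripleEquiv (blocks h')
        ((blocks h₀).trans (σ * blockPerm h₀ 1 ρ'))) f g h x := by
    intro σ
    rw [← triple_trans_mul]
    rw [smul_insLin_congr _ (consLin (kernel (extL ((blocks h').trans ρ')) f g)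
      (fun j => x (((blocks h₀).trans σ) (Sum.inr j)))) _ (consLin_kernel_smul _ f g _) _ _
      (Equiv.Perm.sign ρ' : ℤ), insLin_kernel_extL]
    · rfl
    · intro a
      rw [consLin_apply, consLin_apply, ← hρ', ← hs, sign_smul_kernel_mul]
  simp only [key]
  simp only [smul_comm _ (Equiv.Perm.sign ρ' : ℤ)]
  rw [← Finset.smul_sum, sum_sign_mul (blockPerm h₀ 1 ρ') fun τ =>
        nestAt (tripleEquiv (blocks h') ((blocks h₀).trans τ)) f g h x,
      sign_blockPerm, Equiv.Perm.sign_one, one_mul, sign_smul_sign_smul]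
  rfl

theorem insLin_kernel_extR {q n m s t : ℕ} (e' : Fin n ⊕ Fin m ≃ Fin s)
    (e : Fin q ⊕ Fin s ≃ Fin t) (f : Cochain k H (m + 2) M N) (g : Cochain k H n M M)
    (y : PTensor k H q M) (z : Fin s → M) :
    insLin (consLin (kernel (extR e') f g) z) (consLin_kernel_smul _ f g z) e y =
      par e' e f y (g.1 fun i => z (e' (Sum.inl i))) fun j => z (e' (Sum.inr j)) := by
  have h := smul_insLin_congr (consLin (kernel (extR e') f g) z)
    (consLin (insertion f 0 (extR e') (g.1 fun i => z (e' (Sum.inl i))))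
      fun j => z (e' (Sum.inr j))) (consLin_kernel_smul _ f g z)
    (consLin_insertion_smul e' f _ _) e 1 1 (fun a => by
      rw [consLin_apply, consLin_apply, kernel_apply]
      congr 2
      funext j
      refine Fin.cases ?_ (fun j => ?_) j <;> simp) y
  rwa [one_smul, one_smul] at h

theorem parAt_congr {q n m s s' t : ℕ} (e' : Fin n ⊕ Fin m ≃ Fin s) (e : Fin q ⊕ Fin s ≃ Fin t)
    (d' : Fin n ⊕ Fin m ≃ Fin s') (d : Fin q ⊕ Fin s' ≃ Fin t)
    (hE : tripleEquiv e' e = tripleEquiv d' d)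
    (f : Cochain k H (m + 2) M N) (g : Cochain k H n M M) (h : Cochain k H q M M)
    (x : Fin t → M) : parAt e' e f g h x = parAt d' d f g h x := by
  rw [parAt, par_congr e' e d' d hE, hE]
  rfl

theorem parAt_swap {q n m s s' t : ℕ} (e' : Fin n ⊕ Fin m ≃ Fin s) (e : Fin q ⊕ Fin s ≃ Fin t)
    (d' : Fin q ⊕ Fin m ≃ Fin s') (d : Fin n ⊕ Fin s' ≃ Fin t)
    (hE : (Equiv.sumCongr (Equiv.sumComm _ _) (Equiv.refl _)).trans (tripleEquiv e' e) =
      tripleEquiv d' d)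
    (f : Cochain k H (m + 2) M N) (g : Cochain k H n M M) (h : Cochain k H q M M)
    (x : Fin t → M) : parAt e' e f g h x = -parAt d' d f h g x := by
  rw [parAt, par_swap e' e d' d hE, parAt, ← hE]
  rfl

/-- Here the argument to be filled by `h` is an argument of `f` outside `g`, which gives a parallel
term. The sign is that of `exists_extR`: the marked argument moves past the `n` arguments of `g`. -/
theorem sign_smul_sum_insLin_inr {q n m s t : ℕ} (h' : n + m = s) (h₀ : q + s = t)
    (h1 : n + (m + 1) = s + 1) (f : Cochain k H (m + 2) M N)
    (g : Cochain k H n M M) (h : Cochain k H q M M) (x : Fin t → M)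
    (ρ : Equiv.Perm (Fin (s + 1))) (i : Fin (m + 1)) (hρ : ρ (blocks h1 (Sum.inr i)) = 0) :
    ∑ σ : Equiv.Perm (Fin t), (Equiv.Perm.sign σ : ℤ) • (Equiv.Perm.sign ρ : ℤ) •
      insLin (consLin (kernel ((blocks h1).trans ρ) f g)
        (fun j => x (((blocks h₀).trans σ) (Sum.inr j)))) (consLin_kernel_smul _ f g _)
        ((blocks h₀).trans σ) (h.1 fun j => x (((blocks h₀).trans σ) (Sum.inl j))) =
      (-1 : ℤ) ^ n • parSum h' h₀ f g h x := by
  obtain ⟨ρ', hs, hρ'⟩ := exists_extR h1 h' (ρ * blockPerm h1 1 (Equiv.swap 0 i)) (by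
    rw [Equiv.Perm.mul_apply, blockPerm_inr, Equiv.swap_apply_left, hρ])
  have key : ∀ σ : Equiv.Perm (Fin t), (Equiv.Perm.sign ρ : ℤ) •
      insLin (consLin (kernel ((blocks h1).trans ρ) f g)
        (fun j => x (((blocks h₀).trans σ) (Sum.inr j)))) (consLin_kernel_smul _ f g _)
        ((blocks h₀).trans σ) (h.1 fun j => x (((blocks h₀).trans σ) (Sum.inl j))) =
      ((-1) ^ n * (Equiv.Perm.sign ρ' : ℤ)) • parAt (blocks h')
        ((blocks h₀).trans (σ * blockPerm h₀ 1 ρ')) f g h x := by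
    intro σ
    rw [← parAt_congr _ _ _ _ (triple_trans_mul h' h₀ ρ' σ)]
    rw [smul_insLin_congr _ (consLin (kernel (extR ((blocks h').trans ρ')) f g)
      (fun j => x (((blocks h₀).trans σ) (Sum.inr j)))) _ (consLin_kernel_smul _ f g _) _ _
      ((-1) ^ n * (Equiv.Perm.sign ρ' : ℤ)), insLin_kernel_extR]
    · rfl
    · intro a
      have hs' : ((-1) ^ n * (Equiv.Perm.sign ρ' : ℤ)) =
          (Equiv.Perm.sign (ρ * blockPerm h1 1 (Equiv.swap 0 i)) : ℤ) := by rw [hs]; simp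
      rw [consLin_apply, consLin_apply, ← hρ', hs', sign_smul_kernel_mul]
  simp only [key]
  simp only [smul_comm _ ((-1) ^ n * (Equiv.Perm.sign ρ' : ℤ))]
  rw [← Finset.smul_sum, sum_sign_mul (blockPerm h₀ 1 ρ') fun τ =>
        parAt (blocks h') ((blocks h₀).trans τ) f g h x,
      sign_blockPerm, Equiv.Perm.sign_one, one_mul, mul_smul, sign_smul_sign_smul]
  rfl

/-- The permutations `ρ` are sorted by the slot that receives the marked argument, `s!` for each
slot: `n + 1` slots belong to `g` and `m` to `f`. The parallel contribution `S` is left abstract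
because `parSum` only makes sense when `f` has at least two arguments, while `m = 0` is also needed.
-/
theorem smul_circ_circ_left [CharZero k] {q n m s t : ℕ} (h' : n + m = s) (h₀ : q + s = t)
    (h1 : n + 1 + m = s + 1) (f : Cochain k H (m + 1) M N)
    (g : Cochain k H (n + 1) M M) (h : Cochain k H q M M) (x : Fin t → M) (S : PTensor k H t N)
    (hS : ∀ (ρ : Equiv.Perm (Fin (s + 1))) (i : Fin m), ρ (blocks h1 (Sum.inr i)) = 0 →
      ∑ σ : Equiv.Perm (Fin t), (Equiv.Perm.sign σ : ℤ) • (Equiv.Perm.sign ρ : ℤ) •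
      insLin (consLin (kernel ((blocks h1).trans ρ) f g)
        (fun j => x (((blocks h₀).trans σ) (Sum.inr j)))) (consLin_kernel_smul _ f g _)
        ((blocks h₀).trans σ) (h.1 fun j => x (((blocks h₀).trans σ) (Sum.inl j))) = S) :
    (q.factorial * (n + 1).factorial * m.factorial) • (circ h₀ (circ h1 f g) h).1 x =
      (n + 1) • nestSum h' h₀ f g h x + m • S := by
  refine nsmul_left_cancel' k s.factorial_ne_zero ?_
  have e2 := congrArg (fun w => ((n + 1).factorial * m.factorial) • w)
    (smul_circ_apply h₀ (circ h1 f g) h x)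
  simp only [Finset.smul_sum] at e2
  simp only [smul_comm ((n + 1).factorial * m.factorial) (Units.val (α := ℤ) _), kernel_apply,
    smul_insertion_circ h1 f g, Finset.smul_sum] at e2
  rw [Finset.sum_comm] at e2
  have e4 : ∀ ρ : Equiv.Perm (Fin (s + 1)),
      ∑ σ : Equiv.Perm (Fin t), (Equiv.Perm.sign σ : ℤ) • (Equiv.Perm.sign ρ : ℤ) •
      insLin (consLin (kernel ((blocks h1).trans ρ) f g)
        (fun j => x (((blocks h₀).trans σ) (Sum.inr j)))) (consLin_kernel_smul _ f g _)
        ((blocks h₀).trans σ) (h.1 fun j => x (((blocks h₀).trans σ) (Sum.inl j))) =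
      Sum.elim (fun _ : Fin (n + 1) => nestSum h' h₀ f g h x) (fun _ : Fin m => S)
        ((blocks h1).symm (ρ.symm 0)) := by
    intro ρ
    obtain ⟨c, hc⟩ := (blocks h1).surjective (ρ.symm 0)
    rw [← hc, Equiv.symm_apply_apply]
    rcases c with c | c
    · exact sign_smul_sum_insLin_inl h' h₀ h1 f g h x ρ c (by rw [hc, Equiv.apply_symm_apply])
    · exact hS ρ c (by rw [hc, Equiv.apply_symm_apply])
  rw [Finset.sum_congr rfl fun ρ _ => e4 ρ] at e2
  rw [sum_perm_symm_apply_zero fun i => Sum.elim (fun _ : Fin (n + 1) => nestSum h' h₀ f g h x)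
      (fun _ : Fin m => S) ((blocks h1).symm i),
    Equiv.sum_comp (blocks h1).symm fun c => Sum.elim
      (fun _ : Fin (n + 1) => nestSum h' h₀ f g h x) (fun _ : Fin m => S) c,
    Fintype.sum_sum_type] at e2
  simp only [Sum.elim_inl, Sum.elim_inr, Finset.sum_const, Finset.card_univ,
    Fintype.card_fin] at e2
  rw [← e2, smul_smul, smul_smul]
  congr 1
  ring

/-- One minus sign comes from the skew-symmetry of `f`, the power of `-1` from exchanging blocks of
`n` and `q + 1` arguments. -/
theorem parSum_swap {q n m s s' t : ℕ} (h' : n + m = s) (h₀ : q + 1 + s = t)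
    (d' : q + 1 + m = s') (d₀ : n + s' = t)
    (f : Cochain k H (m + 2) M N) (g : Cochain k H n M M) (h : Cochain k H (q + 1) M M)
    (x : Fin t → M) :
    parSum h' h₀ f g h x = -((-1 : ℤ) ^ (n * (q + 1)) • parSum d' d₀ f h g x) := by
  obtain ⟨β, hβ, hE⟩ := exists_block_swap h' h₀ d' d₀
  simp only [parSum, parAt_swap _ _ _ _ (hE _) f g h x, smul_neg, Finset.sum_neg_distrib]
  rw [sum_sign_mul β fun τ => parAt (blocks d') ((blocks d₀).trans τ) f h g x, hβ]
  simp

/-- The nested terms cancel since `(n + 1) n! = (n + 1)!`; what remains are the `m + 1` slots of `f`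
not occupied by `g`. -/
theorem smul_associator [CharZero k] {l n m s u t : ℕ} (h' : n + 1 + m = s) (h₀ : l + 1 + s = t)
    (h1 : n + 1 + (m + 1) = s + 1) (h2 : l + 1 + n = u) (h3 : u + (m + 1) = t)
    (f : Cochain k H (m + 2) M N) (g : Cochain k H (n + 1) M M) (h : Cochain k H (l + 1) M M)
    (x : Fin t → M) :
    ((l + 1).factorial * (n + 1).factorial * (m + 1).factorial) •
      (circ h₀ (circ h1 f g) h - circ h3 f (circ h2 g h)).1 x =
      (m + 1) • (-1 : ℤ) ^ (n + 1) • parSum h' h₀ f g h x := by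
  have e1 := smul_circ_circ_left (by omega) h₀ h1 f g h x _
    (fun ρ i hi => sign_smul_sum_insLin_inr h' h₀ h1 f g h x ρ i hi)
  have e2 := congrArg (fun w => (n + 1) • w)
    (smul_circ_circ_right (by omega : n + (m + 1) = s) h₀ h2 h3 f g h x)
  simp only [smul_smul] at e2
  have e3 : (n + 1) * ((l + 1).factorial * n.factorial * (m + 1).factorial) =
      (l + 1).factorial * (n + 1).factorial * (m + 1).factorial := by
    rw [Nat.factorial_succ n]; ring
  rw [e3] at e2
  rw [Submodule.coe_sub, sub_apply, smul_sub, e1, e2, add_sub_cancel_left]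

/-- A cochain `f` with a single argument has no second slot, so there are no parallel terms. -/
theorem associator_eq_zero [CharZero k] {l n s u t : ℕ} (h₀ : l + 1 + s = t)
    (h1 : n + 1 + 0 = s + 1) (h2 : l + 1 + n = u) (h3 : u + 0 = t)
    (f : Cochain k H (0 + 1) M N) (g : Cochain k H (n + 1) M M) (h : Cochain k H (l + 1) M M) :
    circ h₀ (circ h1 f g) h = circ h3 f (circ h2 g h) := by
  refine Subtype.ext (MultilinearMap.ext fun x => ?_)
  have e1 := smul_circ_circ_left (by omega) h₀ h1 f g h x 0 (fun ρ i hi => i.elim0)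
  have e2 := congrArg (fun w => (n + 1) • w)
    (smul_circ_circ_right (by omega : n + 0 = s) h₀ h2 h3 f g h x)
  simp only [smul_smul] at e2
  have e3 : (n + 1) * ((l + 1).factorial * n.factorial * (0).factorial) =
      (l + 1).factorial * (n + 1).factorial * (0).factorial := by
    rw [Nat.factorial_succ n]; ring
  rw [e3] at e2
  refine nsmul_left_cancel' k (c := (l + 1).factorial * (n + 1).factorial * (0).factorial)
    (by positivity) ?_
  rw [e1, e2, smul_zero, add_zero]

/-- The circle product is a graded right pre-Lie product. -/
theorem associator_comm [CharZero k] {l n m s s' u u' t : ℕ} (h₀ : l + 1 + s = t)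
    (h1 : n + 1 + m = s + 1) (h2 : l + 1 + n = u) (h3 : u + m = t)
    (d₀ : n + 1 + s' = t) (d1 : l + 1 + m = s' + 1) (d2 : n + 1 + l = u') (d3 : u' + m = t)
    (f : Cochain k H (m + 1) M N) (g : Cochain k H (n + 1) M M) (h : Cochain k H (l + 1) M M) :
    circ h₀ (circ h1 f g) h - circ h3 f (circ h2 g h) =
      (-1 : ℤ) ^ (n * l) • (circ d₀ (circ d1 f h) g - circ d3 f (circ d2 h g)) := by
  rcases m with _ | m
  · rw [associator_eq_zero h₀ h1 h2 h3, associator_eq_zero d₀ d1 d2 d3]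
    simp
  · refine Subtype.ext (MultilinearMap.ext fun x => ?_)
    refine nsmul_left_cancel' k
      (c := (l + 1).factorial * (n + 1).factorial * (m + 1).factorial) (by positivity) ?_
    rw [smul_associator (by omega : n + 1 + m = s), parSum_swap _ _ (by omega : l + 1 + m = s') d₀]
    have e := smul_associator (by omega) d₀ d1 d2 d3 f h g x
    have e' : ((l + 1).factorial * (n + 1).factorial * (m + 1).factorial) •
        ((-1 : ℤ) ^ (n * l) • (circ d₀ (circ d1 f h) g - circ d3 f (circ d2 h g))).1 x =
        (-1 : ℤ) ^ (n * l) • ((n + 1).factorial * (l + 1).factorial * (m + 1).factorial) •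
        (circ d₀ (circ d1 f h) g - circ d3 f (circ d2 h g)).1 x := by
      rw [smul_comm, mul_comm (l + 1).factorial]
      rfl
    rw [e', e, smul_comm _ (m + 1), smul_neg, smul_smul, ← neg_smul, smul_smul]
    -- The signs agree: `(n + 1) + 1 + (n + 1)(l + 1)` and `nl + (l + 1)` have the same parity.
    congr 2
    ring_nf
    simp

end Cochain

end PreLie

/-! ### The Nijenhuis–Richardson graded Lie algebra -/

section GradedLie

variable {k H : Type*} [Field k] [Ring H] [HopfAlgebra k H] [IsCocomm k H]
variable {M N : Type*}
  [AddCommGroup M] [Module k M] [Module H M] [IsScalarTower k H M]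
  [AddCommGroup N] [Module k N] [Module H N] [IsScalarTower k H N]

theorem ofDegree_apply_self (n : ℕ) (f : Cochain k H (n + 1) M N) :
    ofDegree k H M N n f n = f :=
  DirectSum.of_eq_same (β := fun n => Cochain k H (n + 1) M N) n f

theorem ofDegree_apply_of_ne {n m : ℕ} (h : m ≠ n) (f : Cochain k H (n + 1) M N) :
    ofDegree k H M N n f m = 0 :=
  DirectSum.of_eq_of_ne (β := fun n => Cochain k H (n + 1) M N) n m f h

theorem ofDegree_mem (n : ℕ) (f : Cochain k H (n + 1) M N) :
    ofDegree k H M N n f ∈ degreePart k H M N n := by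
  intro m hm
  exact ofDegree_apply_of_ne (fun h => hm (by rw [h])) f

theorem ofDegree_mem' {n : ℕ} {d : ℤ} (h : (n : ℤ) = d) (f : Cochain k H (n + 1) M N) :
    ofDegree k H M N n f ∈ degreePart k H M N d := h ▸ ofDegree_mem n f

theorem eq_zero_or_eq_ofDegree {d : ℤ} {x : CochainSpace k H M N}
    (hx : x ∈ degreePart k H M N d) :
    x = 0 ∨ ∃ (n : ℕ) (f : Cochain k H (n + 1) M N), (n : ℤ) = d ∧ x = ofDegree k H M N n f := by
  by_cases h : ∃ n : ℕ, (n : ℤ) = d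
  · obtain ⟨n, rfl⟩ := h
    refine Or.inr ⟨n, x n, rfl, DFinsupp.ext fun m => ?_⟩
    by_cases hm : m = n
    · subst hm
      exact (ofDegree_apply_self m (x m)).symm
    · exact (hx m (by exact_mod_cast hm)).trans (ofDegree_apply_of_ne hm _).symm
  · refine Or.inl (DFinsupp.ext fun m => hx m fun hm => h ⟨m, hm⟩)

theorem coe_directSum_apply (z : DirectSum ℤ fun d => degreePart k H M N d) (n : ℕ) :
    (DirectSum.coeAddMonoidHom (degreePart k H M N) z) n = (z n : CochainSpace k H M N) n := by
  induction z using DirectSum.induction_on with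
  | zero => rfl
  | of d x =>
    rw [DirectSum.coeAddMonoidHom_of]
    by_cases h : (n : ℤ) = d
    · subst h
      rw [DirectSum.of_eq_same]
    · rw [DirectSum.of_eq_of_ne _ _ _ h, x.2 n h]
      rfl
  | add x y hx hy =>
    rw [map_add, DirectSum.add_apply, DirectSum.add_apply, hx, hy]
    rfl

variable (k H M N) in
theorem isInternal_degreePart : DirectSum.IsInternal (degreePart k H M N) := by
  constructor
  · intro z z' h
    refine DFinsupp.ext fun d => Subtype.ext (DFinsupp.ext fun n => ?_)
    by_cases hn : (n : ℤ) = d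
    · subst hn
      exact (coe_directSum_apply z n).symm.trans
        ((congrArg (fun w : CochainSpace k H M N => w n) h).trans (coe_directSum_apply z' n))
    · exact ((z d).2 n hn).trans ((z' d).2 n hn).symm
  · intro x
    induction x using DirectSum.induction_on with
    | zero => exact ⟨0, map_zero _⟩
    | of n f =>
      refine ⟨DirectSum.of (fun d => degreePart k H M N d) n ⟨ofDegree k H M N n f,
        ofDegree_mem n f⟩, ?_⟩
      rw [DirectSum.coeAddMonoidHom_of]
      rfl
    | add x y hx hy =>
      obtain ⟨x', hx⟩ := hx
      obtain ⟨y', hy⟩ := hy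
      exact ⟨x' + y', by rw [map_add, hx, hy]⟩

theorem negOnePow_smul {V : Type*} [AddCommGroup V] [Module k V] (a b : ℕ) (v : V) :
    ((((a : ℤ) * (b : ℤ)).negOnePow : ℤˣ) : ℤ) • v = (-1 : k) ^ (a * b) • v := by
  rw [← Int.cast_smul_eq_zsmul k, ← Nat.cast_mul, Int.negOnePow_def, zpow_natCast]
  push_cast
  rfl

theorem nrBracket_ofDegree {m n p : ℕ} (hp : m + n = p) (h1 : n + 1 + m = p + 1)
    (h2 : m + 1 + n = p + 1) (f : Cochain k H (m + 1) M M) (g : Cochain k H (n + 1) M M) :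
    nrBracket k H M (ofDegree k H M M m f) (ofDegree k H M M n g) =
      ofDegree k H M M p (Cochain.circ h1 f g - (-1 : k) ^ (m * n) • Cochain.circ h2 g f) := by
  subst hp
  exact nrBracket_of m n f g

namespace Cochain

theorem circ_sub_left {q m n : ℕ} (h : q + m = n) (f f' : Cochain k H (m + 1) M N)
    (g : Cochain k H q M M) : circ h (f - f') g = circ h f g - circ h f' g :=
  (circBilin h).map_sub₂ f f' g

theorem circ_sub_right {q m n : ℕ} (h : q + m = n) (f : Cochain k H (m + 1) M N)
    (g g' : Cochain k H q M M) : circ h f (g - g') = circ h f g - circ h f g' :=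
  (circBilin h f).map_sub g g'

theorem circ_smul_left {q m n : ℕ} (h : q + m = n) (c : k) (f : Cochain k H (m + 1) M N)
    (g : Cochain k H q M M) : circ h (c • f) g = c • circ h f g :=
  (circBilin h).map_smul₂ c f g

theorem circ_smul_right {q m n : ℕ} (h : q + m = n) (c : k) (f : Cochain k H (m + 1) M N)
    (g : Cochain k H q M M) : circ h f (c • g) = c • circ h f g :=
  (circBilin h f).map_smul c g

theorem sub_eq_smul_sub [CharZero k] {l n m s s' u u' t : ℕ} (h₀ : l + 1 + s = t)
    (h1 : n + 1 + m = s + 1) (h2 : l + 1 + n = u) (h3 : u + m = t)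
    (d₀ : n + 1 + s' = t) (d1 : l + 1 + m = s' + 1) (d2 : n + 1 + l = u') (d3 : u' + m = t)
    (f : Cochain k H (m + 1) M N) (g : Cochain k H (n + 1) M M) (h : Cochain k H (l + 1) M M) :
    circ h₀ (circ h1 f g) h - circ h3 f (circ h2 g h) =
      (-1 : k) ^ (n * l) • (circ d₀ (circ d1 f h) g - circ d3 f (circ d2 h g)) := by
  rw [associator_comm h₀ h1 h2 h3 d₀ d1 d2 d3, ← Int.cast_smul_eq_zsmul k]
  push_cast
  rfl

end Cochain

/-- Here `fg_h` stands for `(f ⊚ g) ⊚ h` and `f_gh` for `f ⊚ (g ⊚ h)`, and `r`, `s`, `t` are the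
signs of the pairs `(f, g)`, `(f, h)`, `(g, h)`. The hypotheses are the pre-Lie identity with `f`,
`g`, `h` in turn as the outer cochain; the Jacobi identity is a signed sum of the three. -/
theorem jacobi_of_preLie {V : Type*} [AddCommGroup V] [Module k V] {r s t : k}
    (hr : r = 1 ∨ r = -1) (hs : s = 1 ∨ s = -1) (ht : t = 1 ∨ t = -1)
    {fg_h f_gh fh_g f_hg gf_h g_fh gh_f g_hf hf_g h_fg hg_f h_gf : V}
    (h1 : fg_h - f_gh = t • (fh_g - f_hg)) (h2 : gf_h - g_fh = s • (gh_f - g_hf))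
    (h3 : hf_g - h_fg = r • (hg_f - h_gf)) :
    f_gh - t • f_hg - (r * s) • (gh_f - t • hg_f) =
      fg_h - r • gf_h - (s * t) • (h_fg - r • h_gf) +
        r • (g_fh - s • g_hf - (r * t) • (fh_g - s • hf_g)) := by
  rcases hr with rfl | rfl <;> rcases hs with rfl | rfl <;> rcases ht with rfl | rfl
  · linear_combination (norm := module) -h1 + h2 - h3
  · linear_combination (norm := module) -h1 + h2 + h3
  · linear_combination (norm := module) -h1 + h2 + h3
  · linear_combination (norm := module) -h1 + h2 - h3
  · linear_combination (norm := module) -h1 - h2 - h3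
  · linear_combination (norm := module) -h1 - h2 + h3
  · linear_combination (norm := module) -h1 - h2 + h3
  · linear_combination (norm := module) -h1 - h2 - h3

theorem nrBracket_jacobi_ofDegree [CharZero k] (a b c : ℕ) (f : Cochain k H (a + 1) M M)
    (g : Cochain k H (b + 1) M M) (h : Cochain k H (c + 1) M M) :
    nrBracket k H M (ofDegree k H M M a f)
      (nrBracket k H M (ofDegree k H M M b g) (ofDegree k H M M c h)) =
    nrBracket k H M (nrBracket k H M (ofDegree k H M M a f) (ofDegree k H M M b g))
      (ofDegree k H M M c h) +
    (-1 : k) ^ (a * b) • nrBracket k H M (ofDegree k H M M b g)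
      (nrBracket k H M (ofDegree k H M M a f) (ofDegree k H M M c h)) := by
  -- The three double brackets are all placed in the summand of index `a + b + c`, although their
  -- degrees arise in different forms.
  have j1 := nrBracket_ofDegree (by omega : a + (b + c) = a + b + c) (by omega) (by omega) f
    (Cochain.circ (by omega : c + 1 + b = b + c + 1) g h -
      (-1 : k) ^ (b * c) • Cochain.circ (by omega : b + 1 + c = b + c + 1) h g)
  have j2 := nrBracket_ofDegree (rfl : a + b + c = a + b + c) (by omega) (by omega)
    (Cochain.circ (by omega : b + 1 + a = a + b + 1) f g -
      (-1 : k) ^ (a * b) • Cochain.circ (by omega : a + 1 + b = a + b + 1) g f) h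
  have j3 := nrBracket_ofDegree (by omega : b + (a + c) = a + b + c) (by omega) (by omega) g
    (Cochain.circ (by omega : c + 1 + a = a + c + 1) f h -
      (-1 : k) ^ (a * c) • Cochain.circ (by omega : a + 1 + c = a + c + 1) h f)
  rw [nrBracket_of b c g h, nrBracket_of a b f g, nrBracket_of a c f h, j1, j2, j3]
  rw [← LinearMap.map_smul (ofDegree k H M M (a + b + c)),
    ← LinearMap.map_add (ofDegree k H M M (a + b + c))]
  congr 1
  simp only [Cochain.circ_sub_left, Cochain.circ_sub_right, Cochain.circ_smul_left,
    Cochain.circ_smul_right]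
  have r1 := Cochain.sub_eq_smul_sub (by omega : c + 1 + (a + b) = a + b + c + 1)
    (by omega : b + 1 + a = a + b + 1) (by omega : c + 1 + b = b + c + 1) (by omega)
    (by omega) (by omega : c + 1 + a = a + c + 1) (by omega : b + 1 + c = b + c + 1)
    (by omega) f g h
  have r2 := Cochain.sub_eq_smul_sub (by omega : c + 1 + (a + b) = a + b + c + 1)
    (by omega : a + 1 + b = a + b + 1) (by omega : c + 1 + a = a + c + 1) (by omega)
    (by omega) (by omega : c + 1 + b = b + c + 1) (by omega : a + 1 + c = a + c + 1)
    (by omega) g f h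
  have r3 := Cochain.sub_eq_smul_sub (by omega : b + 1 + (a + c) = a + b + c + 1)
    (by omega : a + 1 + c = a + c + 1) (by omega : b + 1 + a = a + b + 1) (by omega)
    (by omega) (by omega : b + 1 + c = b + c + 1) (by omega : a + 1 + b = a + b + 1)
    (by omega) h f g
  rw [show a * (b + c) = a * b + a * c by ring, show (a + b) * c = a * c + b * c by ring,
    show b * (a + c) = a * b + b * c by ring, pow_add, pow_add, pow_add]
  exact jacobi_of_preLie (neg_one_pow_eq_or k _) (neg_one_pow_eq_or k _) (neg_one_pow_eq_or k _)
    r1 r2 r3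

variable (k H M) in
/-- The Nijenhuis–Richardson bracket is a graded Lie bracket. -/
theorem isGradedLieAlgebra_nrBracket [CharZero k] :
    IsGradedLieAlgebra (k := k) (L := CochainSpace k H M M) (degreePart k H M M)
      (nrBracket k H M) where
  internal := isInternal_degreePart k H M M
  bracket_mem := by
    intro i j x hx y hy
    rcases eq_zero_or_eq_ofDegree hx with rfl | ⟨a, f, rfl, rfl⟩
    · simp
    rcases eq_zero_or_eq_ofDegree hy with rfl | ⟨b, g, rfl, rfl⟩
    · simp
    rw [nrBracket_of]
    exact ofDegree_mem' (by push_cast; rfl) _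
  antisymm := by
    intro i j x hx y hy
    rcases eq_zero_or_eq_ofDegree hx with rfl | ⟨a, f, rfl, rfl⟩
    · simp
    rcases eq_zero_or_eq_ofDegree hy with rfl | ⟨b, g, rfl, rfl⟩
    · simp
    rw [negOnePow_smul (k := k), nrBracket_ofDegree (rfl : a + b = a + b) (by omega) (by omega),
      nrBracket_ofDegree (add_comm b a) (by omega) (by omega), ← map_smul, ← map_neg]
    congr 1
    rw [mul_comm b a]
    rcases neg_one_pow_eq_or k (a * b) with e1 | e1 <;> rw [e1] <;> module
  jacobi := by
    intro i j l x hx y hy z hz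
    rcases eq_zero_or_eq_ofDegree hx with rfl | ⟨a, f, rfl, rfl⟩
    · simp
    rcases eq_zero_or_eq_ofDegree hy with rfl | ⟨b, g, rfl, rfl⟩
    · simp
    rcases eq_zero_or_eq_ofDegree hz with rfl | ⟨c, h, rfl, rfl⟩
    · simp
    rw [negOnePow_smul (k := k)]
    exact nrBracket_jacobi_ofDegree a b c f g h

end GradedLie

/-! ### Degree-zero cochains from `H`-linear maps, and naturality -/

section Hom

variable {k H : Type*} [Field k] [Ring H] [HopfAlgebra k H]
variable {M N M' N' : Type*}
  [AddCommGroup M] [Module k M] [Module H M] [IsScalarTower k H M]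
  [AddCommGroup N] [Module k N] [Module H N] [IsScalarTower k H N]
  [AddCommGroup M'] [Module k M'] [Module H M'] [IsScalarTower k H M']
  [AddCommGroup N'] [Module k N'] [Module H N'] [IsScalarTower k H N']

theorem isFib_id (n : ℕ) : IsFib (AlgHom.id k (TPow k H (Fin n))) some := by
  intro i
  refine ⟨[i], by simp, fun j => by simp [eq_comm], ?_⟩
  simp

theorem PTensor.mapAlg_of_eq_id {n : ℕ} (φ : TPow k H (Fin n) →ₐ[k] TPow k H (Fin n)) (hφ)
    (h : φ = AlgHom.id k _) (z : PTensor k H n N) : PTensor.mapAlg φ hφ z = z := by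
  subst h
  induction z using PTensor.induction with
  | h0 => simp
  | hmk G a => rfl
  | hadd y z hy hz => rw [map_add, hy, hz]

variable [IsCocomm k H]

theorem spread_blocks_one {n : ℕ} (h : 1 + n = n + 1) :
    spread k H (0 : Fin (n + 1)) (blocks h) = AlgHom.id k _ := by
  refine (isFib_spread _ _).ext (isFib_id _) fun j => ?_
  obtain ⟨(c | c), rfl⟩ := (blocks h).surjective j
  · have : blocks h (Sum.inl c) = 0 := Fin.ext (by simp [val_blocks_inl])
    rw [Equiv.symm_apply_apply, this]
    rfl
  · have : blocks h (Sum.inr c) = c.succ := Fin.ext (by simp [val_blocks_inr]; omega)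
    rw [Equiv.symm_apply_apply, this]
    simp

theorem place_blockL_blocks_zero {q : ℕ} (h : q + 0 = q) :
    place k H (blockL (blocks h)) = AlgHom.id k _ := by
  refine (isFib_blockL _).ext (isFib_id _) fun j => ?_
  obtain ⟨(c | c), rfl⟩ := (blocks h).surjective j
  · have : blocks h (Sum.inl c) = c := Fin.ext (by simp [val_blocks_inl])
    rw [Equiv.symm_apply_apply, this]
    rfl
  · exact c.elim0

namespace Cochain

theorem insertion_ofHom {q : ℕ} (h : q + 0 = q) (D : M →ₗ[H] N) (y : PTensor k H q M)
    (z : Fin 0 → M) : insertion (ofHom (k := k) D) 0 (blocks h) y z = PTensor.map D y := by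
  induction y using PTensor.induction with
  | h0 => simp
  | hadd y y' hy hy' => simp only [map_add, add_apply, hy, hy']
  | hmk G a =>
    rw [insertion_mk, ofHom_apply, PTensor.mapAlg_mk, map_one, PTensor.smul_mk, mul_one,
      place_blockL_blocks_zero, PTensor.map_mk]
    rfl

theorem insertion_mk_one {n : ℕ} (h : 1 + n = n + 1) (f : Cochain k H (n + 1) M N) (a : M)
    (z : Fin n → M) :
    insertion f 0 (blocks h) (PTensor.mk k H 1 a) z = f.1 (Fin.cons a z) := by
  rw [insertion_mk, map_one, one_smul, PTensor.mapAlg_of_eq_id _ _ (spread_blocks_one h),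
    Fin.insertNth_zero']

variable [CharZero k]

/-- All `q!` terms of the full sum coincide: the skew-symmetry of `f` undoes each permutation. -/
theorem ofHom_circ {q : ℕ} (h : q + 0 = q) (D : M →ₗ[H] N) (f : Cochain k H q M M) :
    circ h (ofHom (k := k) D) f = Cochain.map q LinearMap.id D f := by
  refine Subtype.ext (MultilinearMap.ext fun x => ?_)
  refine nsmul_left_cancel' k (c := q.factorial * Nat.factorial 0) (by positivity) ?_
  rw [smul_circ_apply, map_apply]
  have e : ∀ σ : Equiv.Perm (Fin q), (Equiv.Perm.sign σ : ℤ) •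
      kernel ((blocks h).trans σ) (ofHom (k := k) D) f x =
      PTensor.map D (f.1 x) := by
    intro σ
    rw [kernel_apply, ← perm_insertion, insertion_ofHom, PTensor.perm, ← PTensor.map_mapAlg,
      f.2.2 σ x, map_zsmul]
    congr 4
  simp only [e, Finset.sum_const, Finset.card_univ, Fintype.card_perm, Fintype.card_fin,
    Nat.factorial_zero, mul_one]
  rfl

/-- Skew-symmetry of `f` returns the modified argument to its original place, so the term of `σ`
depends only on `σ 0`. -/
theorem circ_ofHom_apply {n : ℕ} (h : 1 + n = n + 1) (f : Cochain k H (n + 1) M N)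
    (D : M →ₗ[H] M) (x : Fin (n + 1) → M) :
    (circ h f (ofHom (k := k) D)).1 x = ∑ i, f.1 (Function.update x i (D (x i))) := by
  refine nsmul_left_cancel' k (c := Nat.factorial 1 * n.factorial) (by positivity) ?_
  rw [smul_circ_apply]
  have e : ∀ σ : Equiv.Perm (Fin (n + 1)), (Equiv.Perm.sign σ : ℤ) •
      kernel ((blocks h).trans σ) f (ofHom (k := k) D) x =
      f.1 (Function.update x (σ 0) (D (x (σ 0)))) := by
    intro σ
    have h0 : blocks h (Sum.inl 0) = 0 := Fin.ext (by simp [val_blocks_inl])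
    have hs : ∀ c, blocks h (Sum.inr c) = c.succ := fun c =>
      Fin.ext (by simp [val_blocks_inr]; omega)
    rw [kernel_apply, ← perm_insertion, ofHom_apply, insertion_mk_one,
      f.2.2 σ (Function.update x (σ 0) (D (x (σ 0))))]
    congr 3
    funext i
    refine Fin.cases ?_ (fun i => ?_) i
    · simp [h0]
    · simp [hs]
  simp only [e]
  rw [sum_perm_apply_zero fun i => f.1 (Function.update x i (D (x i))), Nat.factorial_one,
    one_mul]

end Cochain

theorem PTensor.map_add_map {n : ℕ} (α β : M →ₗ[H] N) (z : PTensor k H n M) :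
    PTensor.map (α + β) z = PTensor.map α z + PTensor.map β z := by
  induction z using PTensor.induction with
  | h0 => simp
  | hmk G a => simp [PTensor.mk_add_right]
  | hadd y z hy hz => simp only [map_add, hy, hz]; abel

theorem PTensor.map_zero_map {n : ℕ} (z : PTensor k H n M) :
    PTensor.map (0 : M →ₗ[H] N) z = 0 := by
  have := PTensor.map_add_map (0 : M →ₗ[H] N) 0 z
  rwa [add_zero, left_eq_add] at this

namespace Cochain

theorem map_insertion_map {q m n : ℕ} (α : M' →ₗ[H] M) (ν : N →ₗ[H] N')
    (f : Cochain k H (m + 1) M N) (i : Fin (m + 1)) (e : Fin q ⊕ Fin m ≃ Fin n)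
    (y : PTensor k H q M') (z : Fin m → M') :
    PTensor.map ν (insertion f i e (PTensor.map α y) fun j => α (z j)) =
      insertion (Cochain.map (m + 1) α ν f) i e y z := by
  induction y using PTensor.induction with
  | h0 => simp
  | hadd y y' hy hy' => simp only [map_add, add_apply, hy, hy']
  | hmk G a =>
    rw [PTensor.map_mk, insertion_mk, insertion_mk, PTensor.map_smul', PTensor.map_mapAlg,
      map_apply]
    congr 4
    funext j
    rcases Fin.eq_self_or_eq_succAbove i j with rfl | ⟨j, rfl⟩ <;> simp

/-- The hypothesis says that `α` intertwines `g'` and `g`. Then the pseudotensor inserted into `f`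
comes from `M'`, and naturality of insertion applies to every term. -/
theorem map_circ {q m n : ℕ} (h : q + m = n) (α : M' →ₗ[H] M) (ν : N →ₗ[H] N')
    (f : Cochain k H (m + 1) M N) (g : Cochain k H q M M) (g' : Cochain k H q M' M')
    (hg : Cochain.map q α LinearMap.id g = Cochain.map q LinearMap.id α g') :
    Cochain.map n α ν (circ h f g) = circ h (Cochain.map (m + 1) α ν f) g' := by
  refine Subtype.ext (MultilinearMap.ext fun x => ?_)
  rw [map_apply, circ_apply, circ_apply, map_sum]
  refine Finset.sum_congr rfl fun σ _ => ?_
  rw [map_zsmul, PTensor.perm, PTensor.map_mapAlg]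
  congr 2
  have hg' : ∀ x : Fin q → M', g.1 (fun i => α (x i)) = PTensor.map α (g'.1 x) := by
    intro x
    have := DFunLike.congr_fun (congrArg Subtype.val hg) x
    rw [map_apply, map_apply, PTensor.map_id] at this
    exact this
  rw [hg' fun i => x (σ (blocks h (Sum.inl i)))]
  exact map_insertion_map α ν f 0 (blocks h) _ _

theorem map_map {M'' N'' : Type*}
    [AddCommGroup M''] [Module k M''] [Module H M''] [IsScalarTower k H M'']
    [AddCommGroup N''] [Module k N''] [Module H N''] [IsScalarTower k H N'']
    (n : ℕ) (α : M' →ₗ[H] M) (ν : N →ₗ[H] N') (β : M'' →ₗ[H] M') (ξ : N' →ₗ[H] N'')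
    (f : Cochain k H n M N) :
    Cochain.map n β ξ (Cochain.map n α ν f) = Cochain.map n (α ∘ₗ β) (ξ ∘ₗ ν) f := by
  refine Subtype.ext (MultilinearMap.ext fun x => ?_)
  rw [map_apply, map_apply, map_apply, PTensor.map_comp]
  rfl

end Cochain

end Hom

/-! ### Weights of cochains on `g ⊞ h` -/

section Weight

variable {k H g h : Type*} [Field k] [Ring H] [HopfAlgebra k H] [IsCocomm k H]
  [AddCommGroup g] [Module k g] [Module H g] [IsScalarTower k H g]
  [AddCommGroup h] [Module k h] [Module H h] [IsScalarTower k H h]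

/-- The sum over all arguments of a cochain with that argument replaced by its `h`-component, minus
the `h`-component of the cochain. -/
def weight {n : ℕ} (f : Cochain k H (n + 1) (g × h) (g × h)) :
    Cochain k H (n + 1) (g × h) (g × h) :=
  Cochain.circ (by omega : 1 + n = n + 1) f (Cochain.ofHom (toH H g h)) -
    Cochain.map (n + 1) LinearMap.id (toH H g h) f

theorem toG_add_toH (x : g × h) : toG H g h x + toH H g h x = x := by simp [toG, toH]

theorem toH_toH (x : g × h) : toH H g h (toH H g h x) = toH H g h x := rfl

theorem toH_toG (x : g × h) : toH H g h (toG H g h x) = 0 := rfl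

theorem toG_toH (x : g × h) : toG H g h (toH H g h x) = 0 := rfl

theorem PTensor.map_toH_toH {n : ℕ} (z : PTensor k H n (g × h)) :
    PTensor.map (toH H g h) (PTensor.map (toH H g h) z) = PTensor.map (toH H g h) z := by
  rw [← PTensor.map_comp]; rfl

theorem PTensor.map_toG_add_map_toH {n : ℕ} (z : PTensor k H n (g × h)) :
    PTensor.map (toG H g h) z + PTensor.map (toH H g h) z = z := by
  rw [← PTensor.map_add_map]
  have : toG H g h + toH H g h = LinearMap.id := LinearMap.ext toG_add_toH
  rw [this, PTensor.map_id]

variable [CharZero k]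

theorem weight_apply {n : ℕ} (f : Cochain k H (n + 1) (g × h) (g × h)) (x : Fin (n + 1) → g × h) :
    (weight f).1 x = ∑ i, f.1 (Function.update x i (toH H g h (x i))) -
      PTensor.map (toH H g h) (f.1 x) := by
  rw [← Cochain.circ_ofHom_apply (by omega)]
  rfl

/-- If the arguments in `s` lie in `h` and the others in `g`, passing to the `h`-component of one
argument changes nothing or gives zero. The sum in the weight is therefore `|s|` times the value. -/
theorem map_toH_of_weight {n : ℕ} {c : k} {f : Cochain k H (n + 1) (g × h) (g × h)}
    (hf : weight f = c • f) (s : Finset (Fin (n + 1))) (x : Fin (n + 1) → g × h) :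
    PTensor.map (toH H g h) (f.1 (s.piecewise (fun i => toH H g h (x i))
      fun i => toG H g h (x i))) = ((s.card : k) - c) •
        f.1 (s.piecewise (fun i => toH H g h (x i)) fun i => toG H g h (x i)) := by
  set w := s.piecewise (fun i => toH H g h (x i)) fun i => toG H g h (x i) with hw
  have h1 := weight_apply f w
  have h2 : ∀ i, f.1 (Function.update w i (toH H g h (w i))) = if i ∈ s then f.1 w else 0 := by
    intro i
    split_ifs with hi
    · have : toH H g h (w i) = w i := by
        rw [hw, Finset.piecewise_eq_of_mem _ _ _ hi, toH_toH]
      rw [this, Function.update_eq_self]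
    · have : toH H g h (w i) = 0 := by
        rw [hw, Finset.piecewise_eq_of_notMem _ _ _ hi, toH_toG]
      rw [this, MultilinearMap.map_update_zero]
  simp only [h2, Finset.sum_ite_mem, Finset.univ_inter, Finset.sum_const] at h1
  rw [hf, ← Nat.cast_smul_eq_nsmul k] at h1
  have h3 : c • f.1 w = (s.card : k) • f.1 w - PTensor.map (toH H g h) (f.1 w) := h1
  rw [sub_smul, h3]
  abel

/-- The value is an eigenvector of an idempotent for the eigenvalue `|s| - c`, so it vanishes unless
this is `0` or `1`. -/
theorem eq_zero_of_weight_aux {n : ℕ} {c : k} {f : Cochain k H (n + 1) (g × h) (g × h)}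
    (hf : weight f = c • f) (s : Finset (Fin (n + 1))) (x : Fin (n + 1) → g × h)
    (h0 : ((s.card : k) - c) ≠ 0) (h1 : (s.card : k) - c ≠ 1) :
    f.1 (s.piecewise (fun i => toH H g h (x i)) fun i => toG H g h (x i)) = 0 := by
  have e := map_toH_of_weight hf s x
  have e' := congrArg (PTensor.map (toH H g h)) e
  rw [PTensor.map_toH_toH, map_smul, e, smul_smul] at e'
  have e2 : (((s.card : k) - c) * (((s.card : k) - c) - 1)) •
    f.1 (s.piecewise (fun i => toH H g h (x i)) fun i => toG H g h (x i)) = 0 := by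
    rw [mul_sub, mul_one, sub_smul, ← e', sub_self]
  exact (smul_eq_zero.1 e2).resolve_left (mul_ne_zero h0 (sub_ne_zero.2 h1))

theorem apply_eq_sum_piecewise {n : ℕ} (f : Cochain k H (n + 1) (g × h) (g × h))
    (x : Fin (n + 1) → g × h) : f.1 x = ∑ s : Finset (Fin (n + 1)),
      f.1 (s.piecewise (fun i => toH H g h (x i)) fun i => toG H g h (x i)) := by
  rw [← MultilinearMap.map_add_univ]
  congr 1
  funext i
  rw [Pi.add_apply, add_comm, toG_add_toH]

/-- For the weight `-2` the eigenvalue `|s| + 2` is never `0` or `1` in characteristic zero. -/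
theorem eq_zero_of_weight {n : ℕ} {f : Cochain k H (n + 1) (g × h) (g × h)}
    (hf : weight f = (-2 : k) • f) : f = 0 := by
  refine Subtype.ext (MultilinearMap.ext fun x => ?_)
  rw [apply_eq_sum_piecewise]
  refine Finset.sum_eq_zero fun s _ => eq_zero_of_weight_aux hf s x ?_ ?_
  · have : (s.card : k) - -2 = ((s.card + 2 : ℕ) : k) := by push_cast; ring
    rw [this]
    exact Nat.cast_ne_zero.2 (by omega)
  · rw [← sub_ne_zero]
    have : (s.card : k) - -2 - 1 = ((s.card + 1 : ℕ) : k) := by push_cast; ring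
    rw [this]
    exact Nat.cast_ne_zero.2 (by omega)

/-- For the weight `-1` the eigenvalue is `|s| + 1`, so only `s = ∅` survives: all arguments lie in
`g`, and the eigenvalue `1` puts the value in `h`. -/
theorem map_toG_toH_of_weight {n : ℕ} {f : Cochain k H (n + 1) (g × h) (g × h)}
    (hf : weight f = (-1 : k) • f) : Cochain.map (n + 1) (toG H g h) (toH H g h) f = f := by
  refine Subtype.ext (MultilinearMap.ext fun x => ?_)
  rw [apply_eq_sum_piecewise f x, Finset.sum_eq_single ∅]
  · have := map_toH_of_weight hf ∅ x
    simpa [Cochain.map_apply] using this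
  · intro s _ hs
    refine eq_zero_of_weight_aux hf s x ?_ ?_
    · have : (s.card : k) - -1 = ((s.card + 1 : ℕ) : k) := by push_cast; ring
      rw [this]
      exact Nat.cast_ne_zero.2 (by omega)
    · rw [sub_neg_eq_add, Ne, add_eq_right, Nat.cast_eq_zero, Finset.card_eq_zero]
      exact hs
  · simp

theorem map_toG_toH_weight {n : ℕ} (f : Cochain k H (n + 1) (g × h) (g × h)) :
    Cochain.map (n + 1) (toG H g h) (toH H g h) (weight f) =
      -Cochain.map (n + 1) (toG H g h) (toH H g h) f := by
  refine Subtype.ext (MultilinearMap.ext fun x => ?_)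
  change PTensor.map (toH H g h) ((weight f).1 fun i => toG H g h (x i)) =
    -PTensor.map (toH H g h) (f.1 fun i => toG H g h (x i))
  rw [weight_apply]
  simp only [toH_toG, MultilinearMap.map_update_zero, Finset.sum_const_zero, zero_sub, map_neg,
    PTensor.map_toH_toH]

theorem weight_map_toG_toH {n : ℕ} (f : Cochain k H (n + 1) (g × h) (g × h)) :
    weight (Cochain.map (n + 1) (toG H g h) (toH H g h) f) =
      -Cochain.map (n + 1) (toG H g h) (toH H g h) f := by
  refine Subtype.ext (MultilinearMap.ext fun x => ?_)
  rw [weight_apply]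
  have h1 : ∀ i, (Cochain.map (n + 1) (toG H g h) (toH H g h) f).1
      (Function.update x i (toH H g h (x i))) = 0 := by
    intro i
    rw [Cochain.map_apply]
    have : f.1 (fun j => toG H g h (Function.update x i (toH H g h (x i)) j)) = 0 :=
      f.1.map_coord_zero i (by rw [Function.update_self, toG_toH])
    rw [this, map_zero]
  simp only [h1, Finset.sum_const_zero, zero_sub, Cochain.map_apply, PTensor.map_toH_toH]
  rfl

end Weight

/-! ### Degree-zero elements act as derivations -/

section GradedAbstract

variable {k L : Type*} [Field k] [AddCommGroup L] [Module k L] {𝒜 : ℤ → Submodule k L}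
  {br : L →ₗ[k] L →ₗ[k] L}

theorem IsGradedLieAlgebra.induction (hL : IsGradedLieAlgebra 𝒜 br) {p : L → Prop} (h0 : p 0)
    (hadd : ∀ x y, p x → p y → p (x + y)) (h : ∀ i, ∀ x ∈ 𝒜 i, p x) (x : L) : p x := by
  obtain ⟨z, rfl⟩ := hL.internal.2 x
  induction z using DirectSum.induction_on with
  | zero => rwa [map_zero]
  | of i y => rw [DirectSum.coeAddMonoidHom_of]; exact h i y y.2
  | add y z hy hz => rw [map_add]; exact hadd _ _ hy hz

/-- For `e` of degree `0` antisymmetry cancels all signs in the graded Jacobi identity. For `e =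
euler` this says that weights add under the bracket. -/
theorem IsGradedLieAlgebra.derivation (hL : IsGradedLieAlgebra 𝒜 br) {e : L} (he : e ∈ 𝒜 0)
    (x y : L) : br (br x y) e = br (br x e) y + br x (br y e) := by
  have key : ∀ i, ∀ x ∈ 𝒜 i, ∀ j, ∀ y ∈ 𝒜 j, br (br x y) e = br (br x e) y + br x (br y e) := by
    intro i x hx j y hy
    have h1 := hL.jacobi i j 0 x hx y hy e he
    have h2 := hL.antisymm i (j + 0) x hx (br y e) (hL.bracket_mem _ _ _ hy _ he)
    have h3 := hL.antisymm j (i + 0) y hy (br x e) (hL.bracket_mem _ _ _ hx _ he)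
    rw [add_zero] at h2 h3
    have h4 : (((i * j).negOnePow : ℤˣ) : ℤ) • ((((j * i).negOnePow : ℤˣ) : ℤ) • br (br x e) y) =
        br (br x e) y := by
      rw [mul_comm j i, smul_smul, ← Units.val_mul, Int.units_mul_self, Units.val_one, one_smul]
    rw [h3, smul_neg, h4] at h1
    rw [h1]
    abel
  refine hL.induction (p := fun x => br (br x y) e = br (br x e) y + br x (br y e)) ?_ ?_ ?_ x
  · simp
  · intro x x' hx hx'
    simp only [map_add, LinearMap.add_apply] at hx hx' ⊢
    rw [hx, hx']; abel
  · intro i x hx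
    refine hL.induction (p := fun y => br (br x y) e = br (br x e) y + br x (br y e)) ?_ ?_
      (fun j y hy => key i x hx j y hy) y
    · simp
    · intro y y' hy hy'
      simp only [map_add, LinearMap.add_apply] at hy hy' ⊢
      rw [hy, hy']; abel

end GradedAbstract

/-! ### The weight as a bracket, and the projection onto `K` -/

section Euler

variable {k H g h : Type*} [Field k] [Ring H] [HopfAlgebra k H] [IsCocomm k H]
  [AddCommGroup g] [Module k g] [Module H g] [IsScalarTower k H g]
  [AddCommGroup h] [Module k h] [Module H h] [IsScalarTower k H h]

variable (k H g h) in
/-- The projection onto `h` as an element of degree `0` of the Nijenhuis–Richardson algebra. -/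
def euler : CochainSpace k H (g × h) (g × h) :=
  ofDegree k H (g × h) (g × h) 0 (Cochain.ofHom (toH H g h))

theorem embed_apply (x : CochainSpace k H g h) (n : ℕ) :
    (embed k H g h x) n =
      Cochain.map (n + 1) (LinearMap.fst H g h) (LinearMap.inr H g h) (x n) :=
  DirectSum.lmap_apply _ _ _

theorem restrict_apply (x : CochainSpace k H (g × h) (g × h)) (n : ℕ) :
    (restrict k H g h x) n =
      Cochain.map (n + 1) (LinearMap.inl H g h) (LinearMap.snd H g h) (x n) :=
  DirectSum.lmap_apply _ _ _

theorem projK_apply (x : CochainSpace k H (g × h) (g × h)) (n : ℕ) :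
    (projK k H g h x) n = Cochain.map (n + 1) (toG H g h) (toH H g h) (x n) := by
  rw [projK, LinearMap.comp_apply, embed_apply, restrict_apply, Cochain.map_map]
  rfl

theorem Cochain.map_id (n : ℕ) {M N : Type*} [AddCommGroup M] [Module k M] [Module H M]
    [IsScalarTower k H M] [AddCommGroup N] [Module k N] [Module H N] [IsScalarTower k H N]
    (f : Cochain k H n M N) :
    Cochain.map n LinearMap.id LinearMap.id f = f := by
  refine Subtype.ext (MultilinearMap.ext fun x => ?_)
  rw [map_apply, PTensor.map_id]
  rfl

theorem restrict_embed (x : CochainSpace k H g h) : restrict k H g h (embed k H g h x) = x := by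
  refine DFinsupp.ext fun n => ?_
  refine (restrict_apply _ n).trans ?_
  rw [embed_apply, Cochain.map_map]
  exact Cochain.map_id _ _

theorem embed_injective : Function.Injective (embed k H g h) :=
  Function.LeftInverse.injective restrict_embed

theorem projK_embed (x : CochainSpace k H g h) :
    projK k H g h (embed k H g h x) = embed k H g h x := by
  rw [projK, LinearMap.comp_apply, restrict_embed]

theorem projK_eq_zero_iff (x : CochainSpace k H (g × h) (g × h)) :
    projK k H g h x = 0 ↔ restrict k H g h x = 0 := by
  rw [projK, LinearMap.comp_apply, map_eq_zero_iff _ embed_injective]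

theorem range_projK : LinearMap.range (projK k H g h) = LinearMap.range (embed k H g h) := by
  refine le_antisymm (LinearMap.range_comp_le_range _ _) ?_
  rintro _ ⟨x, rfl⟩
  exact ⟨_, projK_embed x⟩

theorem isGradedSubspace_of_apply {M N : Type*} [AddCommGroup M] [Module k M] [Module H M]
    [IsScalarTower k H M] [AddCommGroup N] [Module k N] [Module H N] [IsScalarTower k H N]
    (K : Submodule k (CochainSpace k H M N))
    (hK : ∀ x ∈ K, ∀ n, ofDegree k H M N n (x n) ∈ K) :
    IsGradedSubspace (k := k) (L := CochainSpace k H M N) (degreePart k H M N) K := by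
  refine le_antisymm (fun x hx => ?_) (iSup_le fun i => inf_le_left)
  classical
  have e : x = ∑ n ∈ DFinsupp.support x, ofDegree k H M N n (x n) :=
    (DirectSum.sum_support_of x).symm
  rw [e]
  exact Submodule.sum_mem _ fun n _ =>
    (le_iSup (fun i : ℤ => K ⊓ degreePart k H M N i) (n : ℤ)) ⟨hK x hx n, ofDegree_mem n _⟩

theorem embed_ofDegree (n : ℕ) (f : Cochain k H (n + 1) g h) :
    embed k H g h (ofDegree k H g h n f) = ofDegree k H (g × h) (g × h) n
      (Cochain.map (n + 1) (LinearMap.fst H g h) (LinearMap.inr H g h) f) :=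
  DirectSum.lmap_lof _ _ _

theorem projK_ofDegree (n : ℕ) (f : Cochain k H (n + 1) (g × h) (g × h)) :
    projK k H g h (ofDegree k H (g × h) (g × h) n f) = ofDegree k H (g × h) (g × h) n
      (Cochain.map (n + 1) (toG H g h) (toH H g h) f) := by
  refine DFinsupp.ext fun m => (projK_apply _ m).trans ?_
  by_cases hm : m = n
  · subst hm
    rw [ofDegree_apply_self]
    exact (ofDegree_apply_self m _).symm
  · rw [ofDegree_apply_of_ne hm, map_zero]
    exact (ofDegree_apply_of_ne hm _).symm

theorem isGradedSubspace_range_embed :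
    IsGradedSubspace (k := k) (L := CochainSpace k H (g × h) (g × h))
      (degreePart k H (g × h) (g × h)) (LinearMap.range (embed k H g h)) := by
  refine isGradedSubspace_of_apply _ ?_
  rintro _ ⟨y, rfl⟩ n
  exact ⟨ofDegree k H g h n (y n), by rw [embed_ofDegree, embed_apply]⟩

theorem isGradedSubspace_ker_projK :
    IsGradedSubspace (k := k) (L := CochainSpace k H (g × h) (g × h))
      (degreePart k H (g × h) (g × h)) (LinearMap.ker (projK k H g h)) := by
  refine isGradedSubspace_of_apply _ fun x hx n => ?_
  rw [LinearMap.mem_ker] at hx ⊢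
  rw [projK_ofDegree, ← projK_apply, hx]
  exact LinearMap.map_zero (ofDegree k H (g × h) (g × h) n)

theorem euler_mem : euler k H g h ∈ degreePart k H (g × h) (g × h) 0 := ofDegree_mem 0 _

theorem embed_mem {d : ℤ} {x : CochainSpace k H g h} (hx : x ∈ degreePart k H g h d) :
    embed k H g h x ∈ degreePart k H (g × h) (g × h) d := fun n hn => by
  rw [embed_apply, hx n hn, map_zero]

theorem restrict_mem {d : ℤ} {x : CochainSpace k H (g × h) (g × h)}
    (hx : x ∈ degreePart k H (g × h) (g × h) d) :
    restrict k H g h x ∈ degreePart k H g h d := fun n hn => by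
  rw [restrict_apply, hx n hn, map_zero]

variable [CharZero k]

theorem nrBracket_euler_ofDegree (n : ℕ) (f : Cochain k H (n + 1) (g × h) (g × h)) :
    nrBracket k H (g × h) (ofDegree k H (g × h) (g × h) n f) (euler k H g h) =
      ofDegree k H (g × h) (g × h) n (weight f) := by
  rw [euler, nrBracket_ofDegree (by omega : n + 0 = n) (by omega) (by omega), mul_zero, pow_zero,
    one_smul, Cochain.ofHom_circ]
  rfl

theorem weight_zero {n : ℕ} : weight (0 : Cochain k H (n + 1) (g × h) (g × h)) = 0 := by
  rw [← LinearMap.map_eq_zero_iff (ofDegree k H (g × h) (g × h) n)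
    (DirectSum.of_injective n), ← nrBracket_euler_ofDegree, LinearMap.map_zero
    (ofDegree k H (g × h) (g × h) n), LinearMap.map_zero₂]

theorem nrBracket_euler_apply (x : CochainSpace k H (g × h) (g × h)) (n : ℕ) :
    (nrBracket k H (g × h) x (euler k H g h)) n = weight (x n) := by
  induction x using DirectSum.induction_on generalizing n with
  | zero =>
    rw [LinearMap.map_zero₂]
    exact (weight_zero).symm
  | of m f =>
    change (nrBracket k H (g × h) (ofDegree k H (g × h) (g × h) m f) (euler k H g h)) n = weight
      (ofDegree k H (g × h) (g × h) m f n)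
    rw [nrBracket_euler_ofDegree]
    by_cases hm : n = m
    · subst hm
      rw [ofDegree_apply_self, ofDegree_apply_self]
    · rw [ofDegree_apply_of_ne hm, ofDegree_apply_of_ne hm, weight_zero]
  | add x y hx hy =>
    rw [LinearMap.map_add₂, DirectSum.add_apply, DirectSum.add_apply, hx, hy]
    refine Subtype.ext (MultilinearMap.ext fun z => ?_)
    change (weight (x n)).1 z + (weight (y n)).1 z = _
    rw [weight_apply, weight_apply, weight_apply]
    change _ = ∑ i, ((x n).1 _ + (y n).1 _) - PTensor.map _ ((x n).1 z + (y n).1 z)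
    rw [Finset.sum_add_distrib, map_add]
    abel

theorem eq_zero_of_nrBracket_euler {x : CochainSpace k H (g × h) (g × h)}
    (hx : nrBracket k H (g × h) x (euler k H g h) = (-2 : k) • x) : x = 0 := by
  refine DFinsupp.ext fun n => eq_zero_of_weight ?_
  rw [← nrBracket_euler_apply, hx]
  rfl

theorem projK_of_nrBracket_euler {x : CochainSpace k H (g × h) (g × h)}
    (hx : nrBracket k H (g × h) x (euler k H g h) = (-1 : k) • x) : projK k H g h x = x := by
  refine DFinsupp.ext fun n => (projK_apply x n).trans (map_toG_toH_of_weight ?_)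
  rw [← nrBracket_euler_apply, hx]
  rfl

theorem projK_nrBracket_euler (x : CochainSpace k H (g × h) (g × h)) :
    projK k H g h (nrBracket k H (g × h) x (euler k H g h)) = -projK k H g h x := by
  refine DFinsupp.ext fun n => (projK_apply _ n).trans ?_
  rw [nrBracket_euler_apply, map_toG_toH_weight, ← projK_apply]
  rfl

theorem nrBracket_embed_euler (x : CochainSpace k H g h) :
    nrBracket k H (g × h) (embed k H g h x) (euler k H g h) = (-1 : k) • embed k H g h x := by
  refine DFinsupp.ext fun n => (nrBracket_euler_apply _ n).trans ?_
  rw [← projK_embed, projK_apply, weight_map_toG_toH, ← projK_apply]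
  exact (neg_one_smul k _).symm

/-- Applying `P` to `[x, E]` gives `-P x` for every `x`, and `c • P x` for this one. -/
theorem projK_eq_zero_of_nrBracket_euler {c : k} (hc : c ≠ -1)
    {x : CochainSpace k H (g × h) (g × h)}
    (hx : nrBracket k H (g × h) x (euler k H g h) = c • x) : projK k H g h x = 0 := by
  have h1 := projK_nrBracket_euler x
  have h2 : (c + 1) • projK k H g h x = 0 := by
    rw [add_smul, one_smul, ← map_smul, ← hx, h1, neg_add_cancel]
  exact (smul_eq_zero.1 h2).resolve_left fun h => hc (eq_neg_of_add_eq_zero_left h)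

theorem nrBracket_nrBracket_euler {a b : k} {x y : CochainSpace k H (g × h) (g × h)}
    (hx : nrBracket k H (g × h) x (euler k H g h) = a • x)
    (hy : nrBracket k H (g × h) y (euler k H g h) = b • y) :
    nrBracket k H (g × h) (nrBracket k H (g × h) x y) (euler k H g h) =
      (a + b) • nrBracket k H (g × h) x y := by
  rw [(isGradedLieAlgebra_nrBracket k H (g × h)).derivation euler_mem, hx, hy,
    LinearMap.map_smul₂, map_smul, add_smul]

/-- The bracket has weight `-2`, and only zero has that weight. -/
theorem nrBracket_embed_embed (x y : CochainSpace k H g h) :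
    nrBracket k H (g × h) (embed k H g h x) (embed k H g h y) = 0 := by
  refine eq_zero_of_nrBracket_euler ?_
  rw [nrBracket_nrBracket_euler (nrBracket_embed_euler x) (nrBracket_embed_euler y)]
  norm_num

/-- If a cochain `g` has no `h`-component on arguments in `g`, insertion of `g` commutes with
restriction to `g`. -/
theorem Cochain.map_inl_snd_circ_eq_zero {q m n : ℕ} (e : q + m = n)
    {f : Cochain k H (m + 1) (g × h) (g × h)} {f' : Cochain k H q (g × h) (g × h)}
    (hf : Cochain.map (m + 1) (LinearMap.inl H g h) (LinearMap.snd H g h) f = 0)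
    (hf' : Cochain.map q (LinearMap.inl H g h) (LinearMap.snd H g h) f' = 0) :
    Cochain.map n (LinearMap.inl H g h) (LinearMap.snd H g h) (circ e f f') = 0 := by
  -- On arguments in `g` the values of `f'` have no `h`-component. Hence `f'` restricts to a cochain
  -- on `g`, which serves as the inner cochain in `Cochain.map_circ`.
  rw [Cochain.map_circ e _ _ f f'
    (Cochain.map q (LinearMap.inl H g h) (LinearMap.fst H g h) f'), hf]
  · exact (circBilin e).map_zero₂ _
  · rw [Cochain.map_map]
    have h0 := congrArg (Cochain.map q LinearMap.id (LinearMap.inr H g h)) hf'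
    rw [Cochain.map_map, map_zero] at h0
    refine Subtype.ext (MultilinearMap.ext fun x => ?_)
    have h1 := DFunLike.congr_fun (congrArg Subtype.val h0) x
    rw [map_apply] at h1 ⊢
    rw [map_apply, PTensor.map_id]
    have h2 := PTensor.map_toG_add_map_toH (k := k) (H := H) (g := g) (h := h)
      (f'.1 fun i => LinearMap.inl H g h (x i))
    rw [← h2]
    exact (add_eq_left.2 h1)

theorem restrict_ofDegree (n : ℕ) (f : Cochain k H (n + 1) (g × h) (g × h)) :
    restrict k H g h (ofDegree k H (g × h) (g × h) n f) = ofDegree k H g h n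
      (Cochain.map (n + 1) (LinearMap.inl H g h) (LinearMap.snd H g h) f) :=
  DirectSum.lmap_lof _ _ _

theorem restrict_nrBracket_eq_zero {x y : CochainSpace k H (g × h) (g × h)}
    (hx : restrict k H g h x = 0) (hy : restrict k H g h y = 0) :
    restrict k H g h (nrBracket k H (g × h) x y) = 0 := by
  classical
  have e : ∀ z : CochainSpace k H (g × h) (g × h),
      z = ∑ n ∈ DFinsupp.support z, ofDegree k H (g × h) (g × h) n (z n) :=
    fun z => (DirectSum.sum_support_of z).symm
  rw [e x, e y, map_sum, map_sum]
  refine Finset.sum_eq_zero fun n _ => ?_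
  rw [map_sum, LinearMap.sum_apply, map_sum]
  refine Finset.sum_eq_zero fun m _ => ?_
  have hxm : Cochain.map (m + 1) (LinearMap.inl H g h) (LinearMap.snd H g h) (x m) = 0 := by
    rw [← restrict_apply, hx]; rfl
  have hyn : Cochain.map (n + 1) (LinearMap.inl H g h) (LinearMap.snd H g h) (y n) = 0 := by
    rw [← restrict_apply, hy]; rfl
  rw [nrBracket_of, restrict_ofDegree, map_sub, map_smul,
    Cochain.map_inl_snd_circ_eq_zero _ hxm hyn, Cochain.map_inl_snd_circ_eq_zero _ hyn hxm,
    smul_zero, sub_zero]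
  exact LinearMap.map_zero (ofDegree k H g h (m + n))

end Euler

/-! ### The five components of the pseudobracket and their weights -/

section Decomposition

variable {k H g h : Type*} [Field k] [Ring H] [HopfAlgebra k H] [IsCocomm k H]
  [AddCommGroup g] [Module k g] [Module H g] [IsScalarTower k H g]
  [AddCommGroup h] [Module k h] [Module H h] [IsScalarTower k H h]

theorem Cochain.map_toG_add_map_toH {M : Type*} [AddCommGroup M] [Module k M] [Module H M]
    [IsScalarTower k H M] {n : ℕ} (α : M →ₗ[H] g × h) (f : Cochain k H n (g × h) (g × h)) :
    Cochain.map n α (toG H g h) f + Cochain.map n α (toH H g h) f =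
      Cochain.map n α LinearMap.id f := by
  refine Subtype.ext (MultilinearMap.ext fun x => ?_)
  change (Cochain.map n α (toG H g h) f).1 x + (Cochain.map n α (toH H g h) f).1 x = _
  rw [map_apply, map_apply, map_apply, PTensor.map_toG_add_map_toH, PTensor.map_id]

/-- This is the only use of `h` being a subalgebra: it removes the component `h ⊗ h → g`, which
would have weight `2`. -/
theorem IsQuasiTwilled.map_toH_toG {Ω : Cochain k H 2 (g × h) (g × h)} (hΩ : IsQuasiTwilled Ω) :
    Cochain.map 2 (toH H g h) (toG H g h) Ω = 0 := by
  refine Subtype.ext (MultilinearMap.ext fun x => ?_)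
  rw [Cochain.map_apply]
  obtain ⟨w, hw⟩ := hΩ.2 (x 0).2 (x 1).2
  have e : (fun i => toH H g h (x i)) = ![(0, (x 0).2), (0, (x 1).2)] := by
    funext i
    fin_cases i <;> rfl
  rw [e, hw, ← PTensor.map_comp]
  exact PTensor.map_zero_map w

theorem IsQuasiTwilled.eq_add {Ω : Cochain k H 2 (g × h) (g × h)} (hΩ : IsQuasiTwilled Ω) :
    Ω = piLift Ω + rhoLift Ω + muLift Ω + etaLift Ω + thetaLift Ω := by
  have h1 := Cochain.map_toG_add_map_toH (toG H g h) Ω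
  have h2 := Cochain.map_toG_add_map_toH (toH H g h) Ω
  have h3 := Cochain.map_toG_add_map_toH LinearMap.id (mixedPart Ω)
  rw [hΩ.map_toH_toG, zero_add] at h2
  rw [Cochain.map_id] at h3
  have h4 : Ω = mixedPart Ω + Cochain.map 2 (toG H g h) LinearMap.id Ω +
      Cochain.map 2 (toH H g h) LinearMap.id Ω := by
    rw [mixedPart]; abel
  rw [← h1, ← h2, ← h3] at h4
  rw [piLift, rhoLift, muLift, etaLift, thetaLift]
  refine h4.trans ?_
  abel

variable [CharZero k]

theorem weight_add {n : ℕ} (f f' : Cochain k H (n + 1) (g × h) (g × h)) :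
    weight (f + f') = weight f + weight f' := by
  refine Subtype.ext (MultilinearMap.ext fun x => ?_)
  change _ = (weight f).1 x + (weight f').1 x
  rw [weight_apply, weight_apply, weight_apply]
  change ∑ i, (f.1 _ + f'.1 _) - PTensor.map _ (f.1 x + f'.1 x) = _
  rw [Finset.sum_add_distrib, map_add]
  abel

theorem weight_thetaLift (Ω : Cochain k H 2 (g × h) (g × h)) :
    weight (n := 1) (thetaLift Ω) = (-1 : k) • thetaLift Ω :=
  (weight_map_toG_toH (n := 1) Ω).trans (neg_one_smul k _).symm

theorem weight_piLift (Ω : Cochain k H 2 (g × h) (g × h)) : weight (n := 1) (piLift Ω) = 0 := by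
  refine Subtype.ext (MultilinearMap.ext fun x => ?_)
  rw [weight_apply, Finset.sum_eq_zero, zero_sub]
  · rw [piLift, Cochain.map_apply, ← PTensor.map_comp]
    have : toH H g h ∘ₗ toG H g h = 0 := LinearMap.ext toH_toG
    rw [this, PTensor.map_zero_map, neg_zero]
    rfl
  · intro i _
    rw [piLift, Cochain.map_apply, Ω.1.map_coord_zero i, map_zero]
    rw [Function.update_self, toG_toH]

theorem weight_muLift (Ω : Cochain k H 2 (g × h) (g × h)) :
    weight (n := 1) (muLift Ω) = muLift Ω := by
  refine Subtype.ext (MultilinearMap.ext fun x => ?_)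
  rw [weight_apply]
  have e : ∀ i, (muLift Ω).1 (Function.update x i (toH H g h (x i))) = (muLift Ω).1 x := by
    intro i
    rw [muLift, Cochain.map_apply, Cochain.map_apply]
    congr 2
    funext j
    by_cases hj : j = i
    · subst hj; rw [Function.update_self, toH_toH]
    · rw [Function.update_of_ne hj]
  have e' : PTensor.map (toH H g h) ((muLift Ω).1 x) = (muLift Ω).1 x := by
    rw [muLift, Cochain.map_apply, PTensor.map_toH_toH]
  simp only [e, e', Finset.sum_const, Finset.card_univ, Fintype.card_fin]
  abel

/-- Each term of the mixed part has exactly one argument in `h`, so it is counted once. -/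
theorem sum_mixedPart_update (Ω : Cochain k H 2 (g × h) (g × h)) (x : Fin 2 → g × h) :
    ∑ i, (mixedPart Ω).1 (Function.update x i (toH H g h (x i))) = (mixedPart Ω).1 x := by
  have key : ∀ y, (mixedPart Ω).1 y = Ω.1 y - Ω.1 (fun i => toG H g h (y i)) -
      Ω.1 (fun i => toH H g h (y i)) := by
    intro y
    change Ω.1 y - (Cochain.map 2 (toG H g h) LinearMap.id Ω).1 y -
      (Cochain.map 2 (toH H g h) LinearMap.id Ω).1 y = _
    rw [Cochain.map_apply, Cochain.map_apply, PTensor.map_id, PTensor.map_id]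
  have e1 : ∀ i, Ω.1 (fun j => toG H g h (Function.update x i (toH H g h (x i)) j)) = 0 := by
    intro i
    refine Ω.1.map_coord_zero i ?_
    rw [Function.update_self, toG_toH]
  have e2 : ∀ i, (fun j => toH H g h (Function.update x i (toH H g h (x i)) j)) =
      fun j => toH H g h (x j) := by
    intro i
    funext j
    by_cases hj : j = i
    · subst hj; rw [Function.update_self, toH_toH]
    · rw [Function.update_of_ne hj]
  simp only [key, e1, e2, Fin.sum_univ_two]
  have a1 := Ω.1.map_update_add (Function.update x 0 (toH H g h (x 0))) 1
    (toG H g h (x 1)) (toH H g h (x 1))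
  have a2 := Ω.1.map_update_add x 0 (toG H g h (x 0)) (toH H g h (x 0))
  have a3 := Ω.1.map_update_add (Function.update x 1 (toH H g h (x 1))) 0
    (toG H g h (x 0)) (toH H g h (x 0))
  have a4 := Ω.1.map_update_add (Function.update x 0 (toG H g h (x 0))) 1
    (toG H g h (x 1)) (toH H g h (x 1))
  rw [toG_add_toH] at a1 a2 a3 a4
  have c1 : ∀ a b c : g × h, Function.update ![a, b] 1 c = ![a, c] := by
    intro a b c; funext i; fin_cases i <;> rfl
  have c2 : ∀ a b c : g × h, Function.update ![a, b] 0 c = ![c, b] := by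
    intro a b c; funext i; fin_cases i <;> rfl
  have c3 : ∀ a : g × h, Function.update x 0 a = ![a, x 1] := by
    intro a; funext i; fin_cases i <;> rfl
  have c4 : ∀ a : g × h, Function.update x 1 a = ![x 0, a] := by
    intro a; funext i; fin_cases i <;> rfl
  have c5 : ∀ α : g × h →ₗ[H] g × h, (fun i => α (x i)) = ![α (x 0), α (x 1)] := by
    intro α; funext i; fin_cases i <;> rfl
  have c6 : Ω.1 x = Ω.1 ![x 0, x 1] := by
    congr 1; funext i; fin_cases i <;> rfl
  simp only [c3, c4, c1, c2] at a1 a2 a3 a4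
  rw [c3, c4, c5, c5, c6, a2, a1, a3, a4]
  abel

theorem sum_map_mixedPart_update (Ω : Cochain k H 2 (g × h) (g × h)) (ν : g × h →ₗ[H] g × h)
    (x : Fin 2 → g × h) :
    ∑ i, (Cochain.map 2 LinearMap.id ν (mixedPart Ω)).1 (Function.update x i (toH H g h (x i))) =
      (Cochain.map 2 LinearMap.id ν (mixedPart Ω)).1 x := by
  rw [Cochain.map_apply]
  simp only [LinearMap.id_apply]
  rw [← sum_mixedPart_update, map_sum]
  rfl

theorem weight_rhoLift (Ω : Cochain k H 2 (g × h) (g × h)) : weight (n := 1) (rhoLift Ω) = 0 := by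
  refine Subtype.ext (MultilinearMap.ext fun x => ?_)
  rw [weight_apply, rhoLift, sum_map_mixedPart_update, Cochain.map_apply, PTensor.map_toH_toH,
    sub_self]
  rfl

theorem weight_etaLift (Ω : Cochain k H 2 (g × h) (g × h)) :
    weight (n := 1) (etaLift Ω) = etaLift Ω := by
  refine Subtype.ext (MultilinearMap.ext fun x => ?_)
  rw [weight_apply, etaLift, sum_map_mixedPart_update, Cochain.map_apply, ← PTensor.map_comp]
  have : toH H g h ∘ₗ toG H g h = 0 := LinearMap.ext toH_toG
  rw [this, PTensor.map_zero_map, sub_zero]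

end Decomposition

/-! ### The Jacobi identity as `[Ω, Ω] = 0` -/

section SquareZero

variable {k H L : Type*} [Field k] [Ring H] [HopfAlgebra k H] [IsCocomm k H]
  [AddCommGroup L] [Module k L] [Module H L] [IsScalarTower k H L]

theorem spread_one_place_swap {n : ℕ} (e : Fin 2 ⊕ Fin 1 ≃ Fin n) :
    (spread k H (1 : Fin 2) e).comp (place k H (Equiv.swap 0 1 : Equiv.Perm (Fin 2)).toEmbedding) =
      spread k H 0 e := by
  refine AlgHom.toLinearMap_injective (PiTensorProduct.ext (MultilinearMap.ext fun a => ?_))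
  change spread k H (1 : Fin 2) e (place k H _ (PiTensorProduct.tprod k a)) =
    spread k H 0 e (PiTensorProduct.tprod k a)
  have e1 : a = fun i => (fun j => a (Equiv.swap 0 1 j)) (Equiv.swap (0 : Fin 2) 1 i) := by
    funext i; fin_cases i <;> rfl
  conv_lhs => rw [e1]
  rw [place_tprod_perm (Equiv.swap (0 : Fin 2) 1) fun j => a (Equiv.swap 0 1 j), spread_tprod,
    spread_tprod]
  congr 3
  funext i
  fin_cases i
  rfl

/-- The Jacobi identity inserts into the second argument, the circle product only into the first;
skew-symmetry relates the two. -/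
theorem Cochain.insertion_one_eq_neg {n : ℕ} (f : Cochain k H 2 L L) (e : Fin 2 ⊕ Fin 1 ≃ Fin n)
    (y : PTensor k H 2 L) (x : L) : insertion f 1 e y ![x] = -insertion f 0 e y ![x] := by
  induction y using PTensor.induction with
  | h0 => simp
  | hadd y z hy hz => simp only [map_add, add_apply, hy, hz]; abel
  | hmk G a =>
    have e1 : (Fin.insertNth (1 : Fin 2) a ![x] : Fin 2 → L) = ![x, a] := by
      funext i; fin_cases i <;> rfl
    have e0 : (Fin.insertNth (0 : Fin 2) a ![x] : Fin 2 → L) = ![a, x] := by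
      funext i; fin_cases i <;> rfl
    rw [insertion_mk, insertion_mk, e1, e0, f.2.2 (Equiv.swap 0 1) ![x, a]]
    have e2 : (fun i => (![x, a] : Fin 2 → L) (Equiv.swap 0 1 i)) = ![a, x] := by
      funext i; fin_cases i <;> rfl
    rw [e2, Equiv.Perm.sign_swap (by decide), Units.val_neg, Units.val_one, neg_one_smul, map_neg,
      smul_neg, PTensor.perm, PTensor.mapAlg_mapAlg _ _ _ _ _ _ (spread_one_place_swap e)]

theorem shuffles_two_one :
    shuffles (rfl : 2 + 1 = 3) = {1, Equiv.swap 1 2, finRotate 3} := by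
  decide

/-- The three `(2, 1)`-shuffles `1`, `(23)` and the rotation give the three terms of the Jacobi
identity. -/
theorem circ_self_eq_zero {Ω : Cochain k H 2 L L} (hΩ : IsLiePseudobracket Ω) :
    Cochain.circ (rfl : 2 + 1 = 3) Ω Ω = 0 := by
  refine Subtype.ext (MultilinearMap.ext fun x => ?_)
  have hJ := hΩ (x 0) (x 1) (x 2)
  simp only [Cochain.insertion_one_eq_neg] at hJ
  -- The inserted pseudotensor occupies the last two positions; rotation carries the first two
  -- positions there.
  have er : (Equiv.sumComm (Fin 2) (Fin 1)).trans (blocks (rfl : 1 + 2 = 3)) =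
      (blocks (rfl : 2 + 1 = 3)).trans (finRotate 3) := by
    decide
  rw [er, ← Cochain.perm_insertion, ← Cochain.perm_insertion, map_neg, ← PTensor.perm_mul] at hJ
  have em : (Equiv.swap 0 1 * finRotate 3 : Equiv.Perm (Fin 3)) = Equiv.swap 1 2 := by decide
  rw [em] at hJ
  rw [Cochain.circ_apply, shuffles_two_one, Finset.sum_insert (by decide),
    Finset.sum_insert (by decide), Finset.sum_singleton, Equiv.Perm.sign_one,
    Equiv.Perm.sign_swap (by decide), show Equiv.Perm.sign (finRotate 3) = 1 by decide]
  have e1 : PTensor.perm 1 (Cochain.insertion Ω 0 (blocks (rfl : 2 + 1 = 3)) (Ω.1 ![x 0, x 1])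
      ![x 2]) = Cochain.insertion Ω 0 (blocks (rfl : 2 + 1 = 3)) (Ω.1 ![x 0, x 1]) ![x 2] := by
    rw [Cochain.perm_insertion]; rfl
  have c1 : ∀ a : Fin 2 → L, a = ![a 0, a 1] := by
    intro a; funext i; fin_cases i <;> rfl
  have c2 : ∀ a : Fin 1 → L, a = ![a 0] := by
    intro a; funext i; fin_cases i; rfl
  rw [c1 fun i => x ((1 : Equiv.Perm (Fin 3)) (blocks (rfl : 2 + 1 = 3) (Sum.inl i))),
    c1 fun i => x ((Equiv.swap 1 2 : Equiv.Perm (Fin 3)) (blocks (rfl : 2 + 1 = 3) (Sum.inl i))),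
    c1 fun i => x (finRotate 3 (blocks (rfl : 2 + 1 = 3) (Sum.inl i))),
    c2 fun i => x ((1 : Equiv.Perm (Fin 3)) (blocks (rfl : 2 + 1 = 3) (Sum.inr i))),
    c2 fun i => x ((Equiv.swap 1 2 : Equiv.Perm (Fin 3)) (blocks (rfl : 2 + 1 = 3) (Sum.inr i))),
    c2 fun i => x (finRotate 3 (blocks (rfl : 2 + 1 = 3) (Sum.inr i)))]
  rw [Units.val_neg, Units.val_one, one_smul, one_smul, neg_one_smul]
  change PTensor.perm 1 (Cochain.insertion Ω 0 (blocks (rfl : 2 + 1 = 3)) (Ω.1 ![x 0, x 1])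
      ![x 2]) + (-PTensor.perm (Equiv.swap 1 2) (Cochain.insertion Ω 0 (blocks (rfl : 2 + 1 = 3))
        (Ω.1 ![x 0, x 2]) ![x 1]) + PTensor.perm (finRotate 3) (Cochain.insertion Ω 0
          (blocks (rfl : 2 + 1 = 3)) (Ω.1 ![x 1, x 2]) ![x 0])) = 0
  rw [e1, ← neg_eq_zero, neg_add, neg_add, neg_neg, hJ]
  abel

theorem nrBracket_self_eq_zero {Ω : Cochain k H 2 L L} (hΩ : IsLiePseudobracket Ω) :
    nrBracket k H L (ofDegree k H L L 1 Ω) (ofDegree k H L L 1 Ω) = 0 := by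
  rw [nrBracket_ofDegree (rfl : 1 + 1 = 2) rfl rfl, circ_self_eq_zero hΩ, smul_zero, sub_zero]
  exact LinearMap.map_zero (ofDegree k H L L 2)

end SquareZero

/-! ### Higher Jacobi identities from the weight splitting of `[Ω, Ω] = 0` -/

section Split

variable {k L : Type*} [Field k] [AddCommGroup L] [Module k L] {𝒜 : ℤ → Submodule k L}
  {br : L →ₗ[k] L →ₗ[k] L}

/-- Eigenvectors of an endomorphism for the eigenvalues `-1, 0, 1, 2` are independent. -/
theorem eq_zero_of_eigen_sum [CharZero k] {D : L →ₗ[k] L} {a b c d : L} (ha : D a = (-1 : k) • a)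
    (hb : D b = 0) (hc : D c = c) (hd : D d = (2 : k) • d) (h : a + b + c + d = 0) :
    a = 0 ∧ b = 0 ∧ c = 0 ∧ d = 0 := by
  have h1 := congrArg D h
  simp only [map_add, ha, hb, hc, hd, map_zero] at h1
  have h2 := congrArg D h1
  simp only [map_add, map_smul, ha, hc, hd, map_zero] at h2
  have h3 := congrArg D h2
  simp only [map_add, map_smul, ha, hc, hd, map_zero] at h3
  -- The `j`-th application of `D` gives `(-1)^j a + c + 2^j d = 0`. The difference for `j = 3` and
  -- `j = 1` leaves `(8 - 2) d`.
  have hd0 : (6 : k) • d = 0 := by linear_combination (norm := module) h3 - h1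
  have hd0 : d = 0 := (smul_eq_zero.1 hd0).resolve_left (by norm_num)
  subst hd0
  have ha0 : (2 : k) • a = 0 := by linear_combination (norm := module) h2 - h1
  have ha0 : a = 0 := (smul_eq_zero.1 ha0).resolve_left (by norm_num)
  subst ha0
  have hc0 : c = 0 := by linear_combination (norm := module) h1
  subst hc0
  refine ⟨rfl, ?_, rfl, rfl⟩
  linear_combination (norm := module) h

/-- Elements `θ ∈ K`, `A` and `B` of a graded Lie algebra for which `θ`, `[A, x]` and
`[[B, x], y]` are the operations of a curved `L∞`-structure on the abelian subalgebra `K`. -/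
structure IsDerivedTriple (𝒜 : ℤ → Submodule k L) (br : L →ₗ[k] L →ₗ[k] L) (K : Submodule k L)
    (θ A B : L) : Prop where
  abelian : ∀ x ∈ K, ∀ y ∈ K, br x y = 0
  A_mem : A ∈ 𝒜 1
  B_mem : B ∈ 𝒜 1
  A_apply_mem : ∀ x ∈ K, br A x ∈ K
  B_apply_mem : ∀ x ∈ K, ∀ y ∈ K, br (br B x) y ∈ K
  A_θ : br A θ = 0
  A_A : br A A + (2 : k) • br B θ = 0
  A_B : br A B = 0
  B_B : br B B = 0

namespace IsDerivedTriple

variable {K : Submodule k L} {θ A B : L} {i j l : ℤ} {x y z : L}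

/-- This is the graded Jacobi identity for `B`, `x`, `y` with `[x, y] = 0`. -/
theorem symm (hL : IsGradedLieAlgebra 𝒜 br) (hT : IsDerivedTriple 𝒜 br K θ A B)
    (hxK : x ∈ K) (hyK : y ∈ K) (hx : x ∈ 𝒜 i) (hy : y ∈ 𝒜 j) :
    br (br B x) y = ((i * j).negOnePow : ℤ) • br (br B y) x := by
  have h1 := hL.jacobi 1 i j B hT.B_mem x hx y hy
  have h2 := hL.antisymm i (1 + j) x hx _ (hL.bracket_mem 1 j B hT.B_mem y hy)
  rw [hT.abelian x hxK y hyK, map_zero, h2] at h1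
  rw [one_mul, mul_add, mul_one, Int.negOnePow_add, smul_neg, smul_smul, ← Units.val_mul,
    ← mul_assoc, Int.units_mul_self, one_mul] at h1
  linear_combination (norm := module) -h1

theorem bracket_bracket [CharZero k] (hL : IsGradedLieAlgebra 𝒜 br) {C : L} (hC : C ∈ 𝒜 1)
    (hx : x ∈ 𝒜 i) : (2 : k) • br C (br C x) = br (br C C) x := by
  have h1 := hL.jacobi 1 1 i C hC C hC x hx
  rw [one_mul, Int.negOnePow_one, Units.val_neg, Units.val_one] at h1
  linear_combination (norm := module) h1

theorem jacobi_one [CharZero k] (hL : IsGradedLieAlgebra 𝒜 br)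
    (hT : IsDerivedTriple 𝒜 br K θ A B) (hx : x ∈ 𝒜 i) :
    br (br B θ) x + br A (br A x) = 0 := by
  have h1 := bracket_bracket hL hT.A_mem hx
  have h2 := congrArg (fun w => br w x) hT.A_A
  simp only [map_add, LinearMap.add_apply, map_smul, LinearMap.smul_apply, map_zero,
    LinearMap.zero_apply] at h2
  have h3 : (2 : k) • (br (br B θ) x + br A (br A x)) = 0 := by
    linear_combination (norm := module) h1 + h2
  exact (smul_eq_zero.1 h3).resolve_left (by norm_num)

/-- `A` is moved through `[[B, x], y]` by the graded Jacobi identity; since `[A, B] = 0`, it passes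
`B` with a sign only. The term with `[A, y]` in last place is brought to the required form by
`symm`. -/
theorem jacobi_two (hL : IsGradedLieAlgebra 𝒜 br) (hT : IsDerivedTriple 𝒜 br K θ A B)
    (hxK : x ∈ K) (hyK : y ∈ K) (hx : x ∈ 𝒜 i) (hy : y ∈ 𝒜 j) :
    br (br B (br A x)) y + ((i * j).negOnePow : ℤ) • br (br B (br A y)) x +
      br A (br (br B x) y) = 0 := by
  have h1 := hL.jacobi 1 (1 + i) j A hT.A_mem _ (hL.bracket_mem 1 i B hT.B_mem x hx) y hy
  have h2 := hL.jacobi 1 1 i A hT.A_mem B hT.B_mem x hx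
  have h3 := hT.symm hL hxK (hT.A_apply_mem y hyK) hx (hL.bracket_mem 1 j A hT.A_mem y hy)
  rw [hT.A_B, LinearMap.map_zero₂, zero_add, one_mul, Int.negOnePow_one, Units.val_neg,
    Units.val_one, neg_one_smul] at h2
  rw [h2, h3, map_neg, LinearMap.neg_apply, smul_smul, ← Units.val_mul,
    ← Int.negOnePow_add, show 1 * (1 + i) + i * (1 + j) = (i + i) + i * j + 1 by ring,
    Int.negOnePow_succ, Int.negOnePow_add, ← two_mul i, Int.negOnePow_two_mul, one_mul,
    Units.val_neg] at h1
  linear_combination (norm := module) h1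

/-- From `[B, B] = 0` follows `[B, [B, x]] = 0`, hence `[B, [[B, x], y]] = ±[[B, x], [B, y]]`. The
identity is then the graded Jacobi identity for `[B, x]`, `[B, y]`, `z`, with the outer arguments
exchanged by `symm`. -/
theorem jacobi_three [CharZero k] (hL : IsGradedLieAlgebra 𝒜 br)
    (hT : IsDerivedTriple 𝒜 br K θ A B)
    (hxK : x ∈ K) (hyK : y ∈ K) (hzK : z ∈ K) (hx : x ∈ 𝒜 i) (hy : y ∈ 𝒜 j) (hz : z ∈ 𝒜 l) :
    br (br B (br (br B x) y)) z + ((j * l).negOnePow : ℤ) • br (br B (br (br B x) z)) y +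
      ((i * j + i * l).negOnePow : ℤ) • br (br B (br (br B y) z)) x = 0 := by
  have hBx := hL.bracket_mem 1 i B hT.B_mem x hx
  have hBy := hL.bracket_mem 1 j B hT.B_mem y hy
  have hBB : br B (br B x) = 0 := by
    have h0 := bracket_bracket hL hT.B_mem hx
    rw [hT.B_B, LinearMap.map_zero₂] at h0
    exact (smul_eq_zero.1 h0).resolve_left (by norm_num)
  have h1 := hL.jacobi 1 (1 + i) j B hT.B_mem _ hBx y hy
  rw [hBB, LinearMap.map_zero₂, zero_add] at h1
  have h2 := hL.jacobi (1 + i) (1 + j) l _ hBx _ hBy z hz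
  have h3 := hT.symm hL hxK (hT.B_apply_mem y hyK z hzK) hx (hL.bracket_mem _ _ _ hBy _ hz)
  have h4 := hT.symm hL hyK (hT.B_apply_mem x hxK z hzK) hy (hL.bracket_mem _ _ _ hBx _ hz)
  have e1 : (1 * (1 + i)).negOnePow = -i.negOnePow := by
    rw [one_mul, add_comm, Int.negOnePow_succ]
  have e2 : ((1 + i) * (1 + j)).negOnePow =
      -(i.negOnePow * j.negOnePow * (i * j).negOnePow) := by
    rw [show (1 + i) * (1 + j) = i + j + i * j + 1 by ring, Int.negOnePow_succ, Int.negOnePow_add,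
      Int.negOnePow_add]
  have e3 : (i * (1 + j + l)).negOnePow =
      i.negOnePow * (i * j).negOnePow * (i * l).negOnePow := by
    rw [mul_add, mul_add, mul_one, Int.negOnePow_add, Int.negOnePow_add]
  have e4 : (j * (1 + i + l)).negOnePow =
      j.negOnePow * (i * j).negOnePow * (j * l).negOnePow := by
    rw [mul_add, mul_add, mul_one, Int.negOnePow_add, Int.negOnePow_add, mul_comm j i]
  rw [h3, h4, e2, e3, e4] at h2
  rw [h1, e1, Int.negOnePow_add, map_zsmul, LinearMap.smul_apply]
  -- All signs are products of these five; in each case the goal is `h2` up to an overall sign.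
  rcases Int.units_eq_one_or i.negOnePow with a1 | a1 <;>
  rcases Int.units_eq_one_or j.negOnePow with a2 | a2 <;>
  rcases Int.units_eq_one_or (i * j).negOnePow with a3 | a3 <;>
  rcases Int.units_eq_one_or (i * l).negOnePow with a4 | a4 <;>
  rcases Int.units_eq_one_or (j * l).negOnePow with a5 | a5 <;>
  rw [a1, a2, a3, a4, a5] at h2 <;> rw [a1, a3, a4, a5] <;>
  simp only [mul_one, mul_neg, neg_neg, Units.val_neg, Units.val_one, neg_smul,
    one_smul] at h2 ⊢ <;>
  first
  | linear_combination (norm := module) h2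
  | linear_combination (norm := module) -h2

/-- As `[θ, θ] = 0`, the square of `A + B + θ` is a sum of eigenvectors of `[·, E]` for `-1`, `0`,
`1`, `2`, and each of them vanishes. Stability of `K` holds because `[A, x]` and `[[B, x], y]` again
have eigenvalue `-1`. -/
theorem of_eigen [CharZero k] (hL : IsGradedLieAlgebra 𝒜 br) {E : L} (hE : E ∈ 𝒜 0)
    (hKE : ∀ x, x ∈ K ↔ br x E = (-1 : k) • x) (hab : ∀ x ∈ K, ∀ y ∈ K, br x y = 0)
    (mA : A ∈ 𝒜 1) (mB : B ∈ 𝒜 1) (mθ : θ ∈ 𝒜 1) (hA : br A E = (0 : k) • A)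
    (hB : br B E = (1 : k) • B) (hθ : br θ E = (-1 : k) • θ)
    (h0 : br (A + B + θ) (A + B + θ) = 0) : IsDerivedTriple 𝒜 br K θ A B := by
  have hd : ∀ {a b : k} {x y : L}, br x E = a • x → br y E = b • y →
      br (br x y) E = (a + b) • br x y := by
    intro a b x y hx hy
    rw [hL.derivation hE, hx, hy, LinearMap.map_smul₂, map_smul, add_smul]
  have comm : ∀ x ∈ 𝒜 1, ∀ y ∈ 𝒜 1, br x y = br y x := by
    intro x hx y hy
    have := hL.antisymm 1 1 x hx y hy
    rwa [one_mul, Int.negOnePow_one, Units.val_neg, Units.val_one, neg_one_smul, neg_neg] at this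
  have kθ : θ ∈ K := (hKE θ).2 hθ
  have split := eq_zero_of_eigen_sum (D := br.flip E) (a := (2 : k) • br A θ)
    (b := br A A + (2 : k) • br B θ) (c := (2 : k) • br A B) (d := br B B)
    (by rw [map_smul, LinearMap.flip_apply, hd hA hθ, zero_add, smul_comm])
    (by
      rw [map_add, map_smul, LinearMap.flip_apply, LinearMap.flip_apply, hd hA hA, hd hB hθ,
        add_zero, zero_smul, add_neg_cancel, zero_smul, smul_zero, add_zero])
    (by rw [map_smul, LinearMap.flip_apply, hd hA hB, zero_add, one_smul])
    (by rw [LinearMap.flip_apply, hd hB hB, one_add_one_eq_two])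
    (by
      simp only [map_add, LinearMap.add_apply] at h0
      rw [hab θ kθ θ kθ, comm θ mθ A mA, comm θ mθ B mB, comm B mB A mA] at h0
      rw [← h0]
      module)
  have two : (2 : k) ≠ 0 := by norm_num
  refine ⟨hab, mA, mB, fun x hx => (hKE _).2 ?_, fun x hx y hy => (hKE _).2 ?_,
    (smul_eq_zero.1 split.1).resolve_left two, split.2.1,
    (smul_eq_zero.1 split.2.2.1).resolve_left two, split.2.2.2⟩
  · rw [hd hA ((hKE x).1 hx), zero_add]
  · rw [hd (hd hB ((hKE x).1 hx)) ((hKE y).1 hy)]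
    norm_num

end IsDerivedTriple

end Split

/-! ### The weight splitting of a quasi-twilled pseudobracket -/

section Splitting

variable {k H g h : Type*} [Field k] [Ring H] [HopfAlgebra k H] [IsCocomm k H]
  [AddCommGroup g] [Module k g] [Module H g] [IsScalarTower k H g]
  [AddCommGroup h] [Module k h] [Module H h] [IsScalarTower k H h] [CharZero k]

theorem nrBracket_ofDegree_euler {n : ℕ} {f : Cochain k H (n + 1) (g × h) (g × h)} {c : k}
    (hf : weight f = c • f) :
    nrBracket k H (g × h) (ofDegree k H (g × h) (g × h) n f) (euler k H g h) =
      c • ofDegree k H (g × h) (g × h) n f := by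
  rw [nrBracket_euler_ofDegree, hf]
  exact LinearMap.map_smul (ofDegree k H (g × h) (g × h) n) c f

variable (Ω : Cochain k H 2 (g × h) (g × h))

theorem nrBracket_thetaLift_euler :
    nrBracket k H (g × h) (ofDegree k H (g × h) (g × h) 1 (thetaLift Ω)) (euler k H g h) =
      (-1 : k) • ofDegree k H (g × h) (g × h) 1 (thetaLift Ω) :=
  nrBracket_ofDegree_euler (n := 1) (weight_thetaLift Ω)

theorem nrBracket_piLift_add_rhoLift_euler :
    nrBracket k H (g × h) (ofDegree k H (g × h) (g × h) 1 (piLift Ω + rhoLift Ω))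
      (euler k H g h) =
      (0 : k) • ofDegree k H (g × h) (g × h) 1 (piLift Ω + rhoLift Ω) :=
  nrBracket_ofDegree_euler (n := 1) <| (weight_add (n := 1) _ _).trans <| by
    rw [weight_piLift, weight_rhoLift, add_zero, zero_smul]

theorem nrBracket_muLift_add_etaLift_euler :
    nrBracket k H (g × h) (ofDegree k H (g × h) (g × h) 1 (muLift Ω + etaLift Ω))
      (euler k H g h) =
      (1 : k) • ofDegree k H (g × h) (g × h) 1 (muLift Ω + etaLift Ω) :=
  nrBracket_ofDegree_euler (n := 1) <| (weight_add (n := 1) _ _).trans <| by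
    rw [weight_muLift, weight_etaLift, one_smul]

theorem projK_mem_range (x : CochainSpace k H (g × h) (g × h)) :
    projK k H g h x ∈ LinearMap.range (embed k H g h) := ⟨_, rfl⟩

theorem mem_range_of_nrBracket_euler {x : CochainSpace k H (g × h) (g × h)}
    (hx : nrBracket k H (g × h) x (euler k H g h) = (-1 : k) • x) :
    x ∈ LinearMap.range (embed k H g h) := by
  rw [← projK_of_nrBracket_euler hx]
  exact projK_mem_range x

variable {Ω}

theorem IsQuasiTwilled.ofDegree_eq (hΩ : IsQuasiTwilled Ω) :
    ofDegree k H (g × h) (g × h) 1 Ω =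
      ofDegree k H (g × h) (g × h) 1 (piLift Ω + rhoLift Ω) +
        ofDegree k H (g × h) (g × h) 1 (muLift Ω + etaLift Ω) +
          ofDegree k H (g × h) (g × h) 1 (thetaLift Ω) := by
  rw [← LinearMap.map_add (ofDegree k H (g × h) (g × h) 1),
    ← LinearMap.map_add (ofDegree k H (g × h) (g × h) 1)]
  refine congrArg _ (hΩ.eq_add.trans ?_)
  abel

theorem IsQuasiTwilled.isDerivedTriple (hΩ : IsQuasiTwilled Ω) :
    IsDerivedTriple (k := k) (L := CochainSpace k H (g × h) (g × h))
      (degreePart k H (g × h) (g × h)) (nrBracket k H (g × h))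
      (LinearMap.range (embed k H g h)) (ofDegree k H (g × h) (g × h) 1 (thetaLift Ω))
      (ofDegree k H (g × h) (g × h) 1 (piLift Ω + rhoLift Ω))
      (ofDegree k H (g × h) (g × h) 1 (muLift Ω + etaLift Ω)) := by
  refine IsDerivedTriple.of_eigen (L := CochainSpace k H (g × h) (g × h))
    (isGradedLieAlgebra_nrBracket k H (g × h)) euler_mem
    (fun x => ⟨?_, mem_range_of_nrBracket_euler⟩) ?_ (ofDegree_mem 1 _) (ofDegree_mem 1 _)
    (ofDegree_mem 1 _) (nrBracket_piLift_add_rhoLift_euler Ω)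
    (nrBracket_muLift_add_etaLift_euler Ω) (nrBracket_thetaLift_euler Ω) ?_
  · rintro ⟨x, rfl⟩
    exact nrBracket_embed_euler x
  · rintro _ ⟨x, rfl⟩ _ ⟨y, rfl⟩
    exact nrBracket_embed_embed x y
  · have h0 := nrBracket_self_eq_zero hΩ.1
    rwa [hΩ.ofDegree_eq] at h0

end Splitting

/-! ### Koszul signs of the shuffles that occur -/

theorem koszulSign_one {n : ℕ} (d : Fin n → ℤ) : koszulSign d 1 = 1 := by
  refine Finset.prod_eq_one fun p _ => if_neg ?_
  rintro ⟨h1, h2⟩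
  exact lt_asymm h1 h2

theorem koszulSign_swap (d : Fin 2 → ℤ) :
    koszulSign d (Equiv.swap 0 1) = (d 0 * d 1).negOnePow := by
  rw [koszulSign, Fintype.prod_prod_type]
  simp [Fin.prod_univ_two, mul_comm]

theorem koszulSign_swap_one_two (d : Fin 3 → ℤ) :
    koszulSign d (Equiv.swap 1 2) = (d 1 * d 2).negOnePow := by
  rw [koszulSign, Fintype.prod_prod_type]
  have e : (Equiv.swap 1 2 : Equiv.Perm (Fin 3)) 0 = 0 := by decide
  simp [Fin.prod_univ_three, e, mul_comm]

theorem koszulSign_finRotate (d : Fin 3 → ℤ) :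
    koszulSign d (finRotate 3) = (d 0 * d 1 + d 0 * d 2).negOnePow := by
  rw [koszulSign, Fintype.prod_prod_type, Int.negOnePow_add]
  simp [Fin.prod_univ_three, mul_comm]

/-! ### The curved `L∞`-algebra of a derived triple -/

section LInfinity

variable {k L V : Type*} [Field k] [AddCommGroup L] [Module k L] {𝒜 : ℤ → Submodule k L}
  {br : L →ₗ[k] L →ₗ[k] L} [AddCommGroup V] [Module k V] {𝒱 : ℤ → Submodule k V}

/-- The summand `∑_σ ε(σ) l_{m+1}(l_i(x_{σ(1)}, …), x_{σ(i+1)}, …)` of the higher Jacobi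
identity. -/
def jacobiTerm (l : (n : ℕ) → MultilinearMap k (fun _ : Fin n => V) V) {n : ℕ} (d : Fin n → ℤ)
    (x : Fin n → V) (i m : ℕ) (h : i + m = n) : V :=
  ∑ σ ∈ shuffles h, (koszulSign d σ : ℤ) • l (m + 1) (Fin.cons
    (l i fun a => x (σ (blocks h (Sum.inl a)))) (fun b => x (σ (blocks h (Sum.inr b)))))

theorem jacobiTerm_eq_zero {l : (n : ℕ) → MultilinearMap k (fun _ : Fin n => V) V}
    (hl : ∀ n, 3 ≤ n → l n = 0) {n : ℕ} (d : Fin n → ℤ) (x : Fin n → V) (i m : ℕ) (h : i + m = n)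
    (him : 3 ≤ i ∨ 2 ≤ m) : jacobiTerm l d x i m h = 0 := by
  refine Finset.sum_eq_zero fun σ _ => ?_
  rcases him with hi | hm
  · rw [hl i hi, MultilinearMap.map_coord_zero _ 0, smul_zero]
    rfl
  · rw [hl (m + 1) (by omega), zero_apply, smul_zero]

/-- Everything is checked after applying the injective map `ι`. Because `l n = 0` for `n ≥ 3`, only
the Jacobi identities with at most three arguments have content: `A_θ`, `jacobi_one`, `jacobi_two`
and `jacobi_three`. -/
theorem IsDerivedTriple.isCurvedLInfinityAlgebra [CharZero k] (hL : IsGradedLieAlgebra 𝒜 br)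
    {ι : V →ₗ[k] L} {θ A B : L} (hT : IsDerivedTriple 𝒜 br (LinearMap.range ι) θ A B)
    (hθ : θ ∈ 𝒜 1) (hι : Function.Injective ι) (hd : ∀ v d, ι v ∈ 𝒜 d ↔ v ∈ 𝒱 d)
    (hV : DirectSum.IsInternal 𝒱) (l : (n : ℕ) → MultilinearMap k (fun _ : Fin n => V) V)
    (h0 : ∀ x, ι (l 0 x) = θ) (h1 : ∀ x, ι (l 1 x) = br A (ι (x 0)))
    (h2 : ∀ x, ι (l 2 x) = br (br B (ι (x 0))) (ι (x 1))) (h3 : ∀ n, 3 ≤ n → l n = 0) :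
    IsCurvedLInfinityAlgebra 𝒱 l where
  internal := hV
  degree := by
    intro n d x hx
    rw [← hd]
    match n, d, x, hx with
    | 0, d, x, hx => rw [h0]; simpa using hθ
    | 1, d, x, hx =>
      rw [h1, Fin.sum_univ_one, add_comm]
      exact hL.bracket_mem _ _ _ hT.A_mem _ ((hd _ _).2 (hx 0))
    | 2, d, x, hx =>
      rw [h2, Fin.sum_univ_two, add_comm, ← add_assoc]
      exact hL.bracket_mem _ _ _ (hL.bracket_mem _ _ _ hT.B_mem _ ((hd _ _).2 (hx 0))) _
        ((hd _ _).2 (hx 1))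
    | n + 3, d, x, hx =>
      rw [h3 (n + 3) (by omega), zero_apply, map_zero]
      exact Submodule.zero_mem _
  symm := by
    intro n d x hx σ
    match n, d, x, hx, σ with
    | 0, d, x, hx, σ =>
      rw [Subsingleton.elim σ 1, koszulSign_one, Units.val_one, one_smul]
      rfl
    | 1, d, x, hx, σ =>
      rw [Subsingleton.elim σ 1, koszulSign_one, Units.val_one, one_smul]
      rfl
    | 2, d, x, hx, σ =>
      have hσ : ∀ σ : Equiv.Perm (Fin 2), σ = 1 ∨ σ = Equiv.swap 0 1 := by decide
      rcases hσ σ with rfl | rfl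
      · rw [koszulSign_one, Units.val_one, one_smul]
        rfl
      · apply hι
        rw [koszulSign_swap, map_zsmul, h2, h2]
        exact hT.symm hL ⟨_, rfl⟩ ⟨_, rfl⟩ ((hd _ _).2 (hx 0)) ((hd _ _).2 (hx 1))
    | n + 3, d, x, hx, σ =>
      rw [h3 (n + 3) (by omega), zero_apply, zero_apply, smul_zero]
  jacobi := by
    intro n d x hx
    change ∑ i : Fin (n + 1), jacobiTerm l d x i (n - i) (by omega) = 0
    match n, d, x, hx with
    | 0, d, x, hx =>
      rw [Fin.sum_univ_one]
      change jacobiTerm l d x 0 0 rfl = 0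
      have hs : shuffles (rfl : 0 + 0 = 0) = {1} := by decide
      apply hι
      rw [jacobiTerm, hs, Finset.sum_singleton, koszulSign_one, Units.val_one, one_smul, h1,
        map_zero, Fin.cons_zero, h0, hT.A_θ]
    | 1, d, x, hx =>
      rw [Fin.sum_univ_two]
      change jacobiTerm l d x 0 1 rfl + jacobiTerm l d x 1 0 rfl = 0
      have hs : shuffles (rfl : 0 + 1 = 1) = {1} := by decide
      have hs' : shuffles (rfl : 1 + 0 = 1) = {1} := by decide
      apply hι
      rw [jacobiTerm, hs, Finset.sum_singleton, jacobiTerm, hs', Finset.sum_singleton,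
        koszulSign_one, Units.val_one, one_smul, one_smul, map_add, h1, h2, map_zero,
        Fin.cons_zero, Fin.cons_zero, h0, h1]
      exact hT.jacobi_one hL ((hd _ _).2 (hx 0))
    | 2, d, x, hx =>
      rw [Fin.sum_univ_three]
      change jacobiTerm l d x 0 2 rfl + jacobiTerm l d x 1 1 rfl + jacobiTerm l d x 2 0 rfl = 0
      have hs : shuffles (rfl : 1 + 1 = 2) = {1, Equiv.swap 0 1} := by decide
      have hs' : shuffles (rfl : 2 + 0 = 2) = {1} := by decide
      apply hι
      rw [jacobiTerm_eq_zero h3 _ _ 0 2 _ (Or.inr le_rfl), zero_add, jacobiTerm, hs,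
        Finset.sum_insert (by decide), Finset.sum_singleton, jacobiTerm, hs',
        Finset.sum_singleton, koszulSign_one, koszulSign_swap, Units.val_one, one_smul, one_smul,
        map_add, map_add, map_zsmul, h1, h2, h2, map_zero,
        Fin.cons_zero, Fin.cons_zero, Fin.cons_zero, h1, h1, h2]
      exact hT.jacobi_two hL ⟨_, rfl⟩ ⟨_, rfl⟩ ((hd _ _).2 (hx 0)) ((hd _ _).2 (hx 1))
    | 3, d, x, hx =>
      rw [Fin.sum_univ_four]
      change jacobiTerm l d x 0 3 rfl + jacobiTerm l d x 1 2 rfl + jacobiTerm l d x 2 1 rfl +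
        jacobiTerm l d x 3 0 rfl = 0
      apply hι
      -- Only the terms `l₂(l₂(·, ·), ·)` survive, one for each `(2, 1)`-shuffle.
      rw [jacobiTerm_eq_zero h3 _ _ 0 3 _ (Or.inr (by omega)),
        jacobiTerm_eq_zero h3 _ _ 1 2 _ (Or.inr le_rfl),
        jacobiTerm_eq_zero h3 _ _ 3 0 _ (Or.inl le_rfl), zero_add, zero_add, add_zero,
        jacobiTerm, shuffles_two_one, Finset.sum_insert (by decide),
        Finset.sum_insert (by decide), Finset.sum_singleton, koszulSign_one,
        koszulSign_swap_one_two, koszulSign_finRotate, Units.val_one, one_smul,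
        map_add, map_add, map_zsmul, map_zsmul, h2, h2, h2, map_zero,
        Fin.cons_zero, Fin.cons_zero, Fin.cons_zero, h2, h2, h2, ← add_assoc]
      exact hT.jacobi_three hL ⟨_, rfl⟩ ⟨_, rfl⟩ ⟨_, rfl⟩ ((hd _ _).2 (hx 0)) ((hd _ _).2 (hx 1))
        ((hd _ _).2 (hx 2))
    | n + 4, d, x, hx =>
      -- With at least four arguments, either the inner operation has three or more, or the outer
      -- one has.
      exact Finset.sum_eq_zero fun i _ => jacobiTerm_eq_zero h3 _ _ _ _ _ (by omega)

end LInfinity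

/-! ### The derived brackets and the curved `V`-datum -/

section DerivedBracket

theorem iterBracket_succ {k L : Type*} [Field k] [AddCommGroup L] [Module k L]
    (br : L →ₗ[k] L →ₗ[k] L) (Δ : L) (n : ℕ) (x : Fin (n + 1) → L) :
    iterBracket br Δ (n + 1) x = br (iterBracket br Δ n (Fin.init x)) (x (Fin.last n)) := rfl

variable {k H g h : Type*} [Field k] [Ring H] [HopfAlgebra k H] [IsCocomm k H]
  [AddCommGroup g] [Module k g] [Module H g] [IsScalarTower k H g]
  [AddCommGroup h] [Module k h] [Module H h] [IsScalarTower k H h]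

theorem embed_derivedBracket (Ω : Cochain k H 2 (g × h) (g × h)) (n : ℕ)
    (f : Fin n → CochainSpace k H g h) :
    embed k H g h (derivedBracket Ω n f) =
      projK k H g h (iterBracket (nrBracket k H (g × h)) (ofDegree k H (g × h) (g × h) 1 Ω) n
        fun i => embed k H g h (f i)) := rfl

theorem embed_mem_iff (x : CochainSpace k H g h) (d : ℤ) :
    embed k H g h x ∈ degreePart k H (g × h) (g × h) d ↔ x ∈ degreePart k H g h d :=
  ⟨fun hx => by simpa only [restrict_embed] using restrict_mem hx, embed_mem⟩

variable [CharZero k] {Ω : Cochain k H 2 (g × h) (g × h)}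

namespace IsQuasiTwilled

theorem embed_derivedBracket_zero (hΩ : IsQuasiTwilled Ω) (f : Fin 0 → CochainSpace k H g h) :
    embed k H g h (derivedBracket Ω 0 f) = ofDegree k H (g × h) (g × h) 1 (thetaLift Ω) := by
  change projK k H g h (ofDegree k H (g × h) (g × h) 1 Ω) = _
  rw [hΩ.ofDegree_eq, map_add, map_add,
    projK_eq_zero_of_nrBracket_euler (by norm_num) (nrBracket_piLift_add_rhoLift_euler Ω),
    projK_eq_zero_of_nrBracket_euler (by norm_num) (nrBracket_muLift_add_etaLift_euler Ω),
    projK_of_nrBracket_euler (nrBracket_thetaLift_euler Ω), zero_add, zero_add]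

theorem thetaLift_mem_range : ofDegree k H (g × h) (g × h) 1 (thetaLift Ω) ∈
    LinearMap.range (embed k H g h) :=
  mem_range_of_nrBracket_euler (nrBracket_thetaLift_euler Ω)

theorem nrBracket_thetaLift_embed (f : CochainSpace k H g h) :
    nrBracket k H (g × h) (ofDegree k H (g × h) (g × h) 1 (thetaLift Ω)) (embed k H g h f) = 0 := by
  obtain ⟨x, hx⟩ := thetaLift_mem_range (Ω := Ω)
  rw [← hx, nrBracket_embed_embed]

/-- `[θ, f]` vanishes since `K` is abelian; `[μ + η, f]` has weight `0` and is killed by `P`; `[π +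
ρ, f]` has weight `-1` and is fixed by `P`. -/
theorem embed_derivedBracket_one (hΩ : IsQuasiTwilled Ω) (f : Fin 1 → CochainSpace k H g h) :
    embed k H g h (derivedBracket Ω 1 f) =
      nrBracket k H (g × h) (ofDegree k H (g × h) (g × h) 1 (piLift Ω + rhoLift Ω))
        (embed k H g h (f 0)) := by
  change projK k H g h (nrBracket k H (g × h) (ofDegree k H (g × h) (g × h) 1 Ω)
    (embed k H g h (f 0))) = _
  rw [hΩ.ofDegree_eq, LinearMap.map_add₂, LinearMap.map_add₂, nrBracket_thetaLift_embed, add_zero,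
    map_add, projK_eq_zero_of_nrBracket_euler (c := 0) (x := nrBracket k H (g × h)
      (ofDegree k H (g × h) (g × h) 1 (muLift Ω + etaLift Ω)) (embed k H g h (f 0))) (by norm_num),
    projK_of_nrBracket_euler, add_zero]
  · rw [nrBracket_nrBracket_euler (nrBracket_piLift_add_rhoLift_euler Ω)
      (nrBracket_embed_euler (f 0)), zero_add]
  · rw [nrBracket_nrBracket_euler (nrBracket_muLift_add_etaLift_euler Ω)
      (nrBracket_embed_euler (f 0)), add_neg_cancel]

/-- The bracket of `π + ρ` with `f₁` already lies in the abelian subalgebra `K`, so the second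
bracket kills it. -/
theorem nrBracket_nrBracket_embed (hΩ : IsQuasiTwilled Ω) (f₁ f₂ : CochainSpace k H g h) :
    nrBracket k H (g × h) (nrBracket k H (g × h) (ofDegree k H (g × h) (g × h) 1 Ω)
      (embed k H g h f₁)) (embed k H g h f₂) =
    nrBracket k H (g × h) (nrBracket k H (g × h)
      (ofDegree k H (g × h) (g × h) 1 (muLift Ω + etaLift Ω)) (embed k H g h f₁))
      (embed k H g h f₂) := by
  obtain ⟨y, hy⟩ := hΩ.isDerivedTriple.A_apply_mem (embed k H g h f₁) ⟨f₁, rfl⟩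
  rw [hΩ.ofDegree_eq, LinearMap.map_add₂, LinearMap.map_add₂, nrBracket_thetaLift_embed,
    LinearMap.map_add₂, LinearMap.map_zero₂, add_zero, LinearMap.map_add₂, ← hy,
    nrBracket_embed_embed, zero_add]

theorem embed_derivedBracket_two (hΩ : IsQuasiTwilled Ω) (f : Fin 2 → CochainSpace k H g h) :
    embed k H g h (derivedBracket Ω 2 f) =
      nrBracket k H (g × h) (nrBracket k H (g × h)
        (ofDegree k H (g × h) (g × h) 1 (muLift Ω + etaLift Ω)) (embed k H g h (f 0)))
        (embed k H g h (f 1)) := by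
  change projK k H g h (nrBracket k H (g × h) (nrBracket k H (g × h)
    (ofDegree k H (g × h) (g × h) 1 Ω) (embed k H g h (f 0))) (embed k H g h (f 1))) = _
  rw [hΩ.nrBracket_nrBracket_embed]
  obtain ⟨y, hy⟩ := hΩ.isDerivedTriple.B_apply_mem (embed k H g h (f 0)) ⟨f 0, rfl⟩
    (embed k H g h (f 1)) ⟨f 1, rfl⟩
  rw [← hy, projK_embed]

/-- Two brackets bring `Ω` into `K`, and a third one vanishes because `K` is abelian. -/
theorem iterBracket_embed_eq_zero (hΩ : IsQuasiTwilled Ω) (n : ℕ)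
    (f : Fin (n + 3) → CochainSpace k H g h) :
    iterBracket (nrBracket k H (g × h)) (ofDegree k H (g × h) (g × h) 1 Ω) (n + 3)
      (fun i => embed k H g h (f i)) = 0 := by
  induction n with
  | zero =>
    change nrBracket k H (g × h) (nrBracket k H (g × h) (nrBracket k H (g × h)
      (ofDegree k H (g × h) (g × h) 1 Ω) (embed k H g h (f 0))) (embed k H g h (f 1)))
      (embed k H g h (f 2)) = 0
    rw [hΩ.nrBracket_nrBracket_embed]
    obtain ⟨y, hy⟩ := hΩ.isDerivedTriple.B_apply_mem (embed k H g h (f 0)) ⟨f 0, rfl⟩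
      (embed k H g h (f 1)) ⟨f 1, rfl⟩
    rw [← hy, nrBracket_embed_embed]
  | succ n ih =>
    refine (iterBracket_succ _ _ _ _).trans ?_
    have := ih (Fin.init f)
    change nrBracket k H (g × h) (iterBracket (nrBracket k H (g × h))
      (ofDegree k H (g × h) (g × h) 1 Ω) (n + 3) fun i => embed k H g h (Fin.init f i)) _ = 0
    rw [this, LinearMap.map_zero₂]

theorem derivedBracket_eq_zero (hΩ : IsQuasiTwilled Ω) (n : ℕ) (hn : 3 ≤ n) :
    derivedBracket Ω n = 0 := by
  obtain ⟨n, rfl⟩ := Nat.exists_eq_add_of_le' hn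
  refine MultilinearMap.ext fun f => embed_injective ?_
  rw [embed_derivedBracket, hΩ.iterBracket_embed_eq_zero, map_zero, zero_apply, map_zero]

theorem isCurvedLInfinityAlgebra (hΩ : IsQuasiTwilled Ω) :
    IsCurvedLInfinityAlgebra (k := k) (V := CochainSpace k H g h) (degreePart k H g h)
      (derivedBracket Ω) := by
  have h1 := hΩ.isDerivedTriple
  have h2 := isGradedLieAlgebra_nrBracket k H (g × h)
  refine IsDerivedTriple.isCurvedLInfinityAlgebra (V := CochainSpace k H g h)
    (L := CochainSpace k H (g × h) (g × h)) (ι := embed k H g h) h2 h1 ?_ ?_ ?_ ?_ _ ?_ ?_ ?_ ?_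
  · exact ofDegree_mem 1 _
  · exact embed_injective
  · exact embed_mem_iff
  · exact isInternal_degreePart k H g h
  · exact hΩ.embed_derivedBracket_zero
  · exact hΩ.embed_derivedBracket_one
  · exact hΩ.embed_derivedBracket_two
  · exact hΩ.derivedBracket_eq_zero

theorem isCurvedVDatum (hΩ : IsQuasiTwilled Ω) :
    IsCurvedVDatum (k := k) (L := CochainSpace k H (g × h) (g × h))
      (degreePart k H (g × h) (g × h)) (nrBracket k H (g × h))
      (LinearMap.range (embed k H g h)) (projK k H g h) (ofDegree k H (g × h) (g × h) 1 Ω) := by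
  refine ⟨isGradedLieAlgebra_nrBracket k H (g × h), isGradedSubspace_range_embed, ?_, ?_, ?_, ?_, ?_, ?_, ?_⟩
  · exact hΩ.isDerivedTriple.abelian
  · refine LinearMap.ext fun x => ?_
    rw [LinearMap.comp_apply]
    exact projK_embed (restrict k H g h x)
  · exact range_projK
  · exact isGradedSubspace_ker_projK
  · intro x hx y hy
    rw [LinearMap.mem_ker, projK_eq_zero_iff] at hx hy ⊢
    exact restrict_nrBracket_eq_zero hx hy
  · exact ofDegree_mem 1 Ω
  · exact nrBracket_self_eq_zero hΩ.1

end IsQuasiTwilled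

end DerivedBracket

/-! ### Deformation maps as Maurer–Cartan elements -/

section MaurerCartan

variable {k H g h : Type*} [Field k] [Ring H] [HopfAlgebra k H] [IsCocomm k H]
  [AddCommGroup g] [Module k g] [Module H g] [IsScalarTower k H g]
  [AddCommGroup h] [Module k h] [Module H h] [IsScalarTower k H h]

/-- An `H`-linear map `g → h` as an endomorphism of `g ⊞ h`. -/
def extHom (D : g →ₗ[H] h) : g × h →ₗ[H] g × h :=
  LinearMap.inr H g h ∘ₗ D ∘ₗ LinearMap.fst H g h

theorem embed_ofDegree_ofHom (D : g →ₗ[H] h) :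
    embed k H g h (ofDegree k H g h 0 (Cochain.ofHom D)) =
      ofDegree k H (g × h) (g × h) 0 (Cochain.ofHom (extHom D)) := embed_ofDegree 0 _

theorem Cochain.skew_two {M N : Type*} [AddCommGroup M] [Module k M] [Module H M]
    [IsScalarTower k H M] [AddCommGroup N] [Module k N] [Module H N] [IsScalarTower k H N]
    (f : Cochain k H 2 M N) (a b : M) :
    f.1 ![a, b] = -PTensor.perm (Equiv.swap 0 1) (f.1 ![b, a]) := by
  rw [f.2.2 (Equiv.swap 0 1)]
  have : (fun i => (![a, b] : Fin 2 → M) (Equiv.swap 0 1 i)) = ![b, a] := by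
    funext i; fin_cases i <;> rfl
  rw [this, Equiv.Perm.sign_swap (by decide), Units.val_neg, Units.val_one, neg_one_smul]

theorem PTensor.map_perm {N N' : Type*} [AddCommGroup N] [Module k N] [Module H N]
    [IsScalarTower k H N] [AddCommGroup N'] [Module k N'] [Module H N'] [IsScalarTower k H N']
    {n : ℕ} (ν : N →ₗ[H] N') (σ : Equiv.Perm (Fin n)) (z : PTensor k H n N) :
    PTensor.map ν (PTensor.perm σ z) = PTensor.perm σ (PTensor.map ν z) :=
  PTensor.map_mapAlg ν _ _ z

variable [CharZero k]

/-- The bracket of a cochain with an endomorphism. -/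
def actHom {M : Type*} [AddCommGroup M] [Module k M] [Module H M] [IsScalarTower k H M]
    {n : ℕ} (δ : M →ₗ[H] M) (f : Cochain k H (n + 1) M M) : Cochain k H (n + 1) M M :=
  Cochain.circ (by omega : 1 + n = n + 1) f (Cochain.ofHom δ) -
    Cochain.map (n + 1) LinearMap.id δ f

theorem nrBracket_ofHom {M : Type*} [AddCommGroup M] [Module k M] [Module H M]
    [IsScalarTower k H M] (n : ℕ) (δ : M →ₗ[H] M) (f : Cochain k H (n + 1) M M) :
    nrBracket k H M (ofDegree k H M M n f) (ofDegree k H M M 0 (Cochain.ofHom δ)) =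
      ofDegree k H M M n (actHom δ f) := by
  rw [nrBracket_ofDegree (by omega : n + 0 = n) (by omega) (by omega), mul_zero, pow_zero,
    one_smul, Cochain.ofHom_circ]
  rfl

theorem actHom_apply_two {M : Type*} [AddCommGroup M] [Module k M] [Module H M]
    [IsScalarTower k H M] (δ : M →ₗ[H] M) (f : Cochain k H 2 M M) (a b : M) :
    (actHom (n := 1) δ f).1 ![a, b] =
      f.1 ![δ a, b] + f.1 ![a, δ b] - PTensor.map δ (f.1 ![a, b]) := by
  change (Cochain.circ (by omega : 1 + 1 = 1 + 1) f (Cochain.ofHom δ)).1 ![a, b] -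
    PTensor.map δ (f.1 ![a, b]) = _
  rw [Cochain.circ_ofHom_apply, Fin.sum_univ_two]
  congr 3
  all_goals funext i; fin_cases i <;> rfl

theorem maurerCartan_eq (Ω : Cochain k H 2 (g × h) (g × h)) (D : g →ₗ[H] h) :
    derivedBracket Ω 0 ![] + derivedBracket Ω 1 ![ofDegree k H g h 0 (Cochain.ofHom D)] +
      (2⁻¹ : k) • derivedBracket Ω 2
        ![ofDegree k H g h 0 (Cochain.ofHom D), ofDegree k H g h 0 (Cochain.ofHom D)] =
    ofDegree k H g h 1 (Cochain.map 2 (LinearMap.inl H g h) (LinearMap.snd H g h)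
      (Ω + actHom (n := 1) (extHom D) Ω +
        (2⁻¹ : k) • actHom (n := 1) (extHom D) (actHom (n := 1) (extHom D) Ω))) := by
  have h0 : derivedBracket Ω 0 ![] = ofDegree k H g h 1
      (Cochain.map 2 (LinearMap.inl H g h) (LinearMap.snd H g h) Ω) :=
    restrict_ofDegree 1 Ω
  have h1 : derivedBracket Ω 1 ![ofDegree k H g h 0 (Cochain.ofHom D)] = ofDegree k H g h 1
      (Cochain.map 2 (LinearMap.inl H g h) (LinearMap.snd H g h)
        (actHom (n := 1) (extHom D) Ω)) := by
    change restrict k H g h (nrBracket k H (g × h) (ofDegree k H (g × h) (g × h) 1 Ω)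
      (embed k H g h (ofDegree k H g h 0 (Cochain.ofHom D)))) = _
    rw [embed_ofDegree_ofHom, nrBracket_ofHom, restrict_ofDegree]
  have h2 : derivedBracket Ω 2
      ![ofDegree k H g h 0 (Cochain.ofHom D), ofDegree k H g h 0 (Cochain.ofHom D)] =
      ofDegree k H g h 1 (Cochain.map 2 (LinearMap.inl H g h) (LinearMap.snd H g h)
        (actHom (n := 1) (extHom D) (actHom (n := 1) (extHom D) Ω))) := by
    change restrict k H g h (nrBracket k H (g × h) (nrBracket k H (g × h)
      (ofDegree k H (g × h) (g × h) 1 Ω)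
      (embed k H g h (ofDegree k H g h 0 (Cochain.ofHom D))))
      (embed k H g h (ofDegree k H g h 0 (Cochain.ofHom D)))) = _
    rw [embed_ofDegree_ofHom, nrBracket_ofHom, nrBracket_ofHom, restrict_ofDegree]
  rw [h0, h1, h2, LinearMap.map_add (Cochain.map 2 _ _), LinearMap.map_add (Cochain.map 2 _ _),
    LinearMap.map_smul (Cochain.map 2 _ _), LinearMap.map_add (ofDegree k H g h 1),
    LinearMap.map_add (ofDegree k H g h 1), LinearMap.map_smul (ofDegree k H g h 1)]

theorem extHom_apply (D : g →ₗ[H] h) (a : g × h) : extHom D a = (0, D a.1) := rfl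

/-- The endomorphism `δ = extHom D` has square zero and vanishes on `h`, so few terms of the
brackets survive. Those of the double bracket are `Ω(δa, δb)`, `-δΩ(δa, b)` and `-δΩ(a, δb)`, each
occurring twice, which cancels the factor `½`. -/
theorem maurerCartan_apply (Ω : Cochain k H 2 (g × h) (g × h)) (D : g →ₗ[H] h) (x y : g) :
    (Cochain.map 2 (LinearMap.inl H g h) (LinearMap.snd H g h)
      (Ω + actHom (n := 1) (extHom D) Ω +
        (2⁻¹ : k) • actHom (n := 1) (extHom D) (actHom (n := 1) (extHom D) Ω))).1 ![x, y] =
    muPart Ω (D x) (D y) + rhoPart Ω x (D y) - PTensor.perm (Equiv.swap 0 1) (rhoPart Ω y (D x)) +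
      thetaPart Ω x y -
      PTensor.map D (piPart Ω x y + etaPart Ω x (D y)
        - PTensor.perm (Equiv.swap 0 1) (etaPart Ω y (D x))) := by
  have e : (fun i => LinearMap.inl H g h ((![x, y] : Fin 2 → g) i)) = ![(x, 0), (y, 0)] := by
    funext i; fin_cases i <;> rfl
  have hδδ : extHom D ∘ₗ extHom D = 0 := by
    refine LinearMap.ext fun a => ?_
    change ((0 : g), D 0) = 0
    rw [map_zero]; rfl
  have hδ0 : ∀ z : PTensor k H 2 (g × h),
      PTensor.map (extHom D) (PTensor.map (extHom D) z) = 0 := by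
    intro z
    rw [← PTensor.map_comp, hδδ, PTensor.map_zero_map]
  have hz : ∀ v : h, extHom D ((0 : g), v) = 0 := by
    intro v
    rw [extHom_apply, map_zero]; rfl
  have hl : ∀ b : g × h, Ω.1 ![0, b] = 0 := fun b => Ω.1.map_coord_zero 0 rfl
  have hr : ∀ b : g × h, Ω.1 ![b, 0] = 0 := fun b => Ω.1.map_coord_zero 1 rfl
  rw [Cochain.map_apply, e]
  change PTensor.map (LinearMap.snd H g h) (Ω.1 ![(x, 0), (y, 0)] +
    (actHom (n := 1) (extHom D) Ω).1 ![(x, 0), (y, 0)] + (2⁻¹ : k) •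
      (actHom (n := 1) (extHom D) (actHom (n := 1) (extHom D) Ω)).1 ![(x, 0), (y, 0)]) = _
  simp only [actHom_apply_two, extHom_apply ]
  simp only [map_zero, Prod.mk_zero_zero, hl, hr, map_add, map_sub, hδ0, map_smul]
  -- The components `ρ` and `η` take their `g`-argument first, so the remaining mixed term is
  -- reversed.
  rw [Cochain.skew_two Ω (0, D x) (y, 0)]
  have hs : ∀ z : PTensor k H 2 (g × h), PTensor.map (LinearMap.snd H g h)
      (PTensor.map (extHom D) z) = PTensor.map D (PTensor.map (LinearMap.fst H g h) z) := by
    intro z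
    rw [← PTensor.map_comp, ← PTensor.map_comp]
    rfl
  simp only [hs, map_neg, PTensor.map_perm]
  rw [muPart, rhoPart, rhoPart, etaPart, etaPart, thetaPart, piPart]
  module

theorem isDeformationMapI_iff (Ω : Cochain k H 2 (g × h) (g × h)) (D : g →ₗ[H] h) :
    IsDeformationMapI Ω D ↔
      derivedBracket Ω 0 ![] + derivedBracket Ω 1 ![ofDegree k H g h 0 (Cochain.ofHom D)] +
        (2⁻¹ : k) • derivedBracket Ω 2
          ![ofDegree k H g h 0 (Cochain.ofHom D), ofDegree k H g h 0 (Cochain.ofHom D)] = 0 := by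
  rw [maurerCartan_eq, LinearMap.map_eq_zero_iff (ofDegree k H g h 1) (DirectSum.of_injective 1)]
  constructor
  · intro hD
    refine Subtype.ext (MultilinearMap.ext fun x => ?_)
    have e : x = ![x 0, x 1] := by funext i; fin_cases i <;> rfl
    rw [e, maurerCartan_apply, hD (x 0) (x 1), sub_self]
    rfl
  · intro hD x y
    have h1 := maurerCartan_apply Ω D x y
    rw [hD] at h1
    exact (sub_eq_zero.1 h1.symm).symm

end MaurerCartan

end

end LiePseudo

theorem theorem3 {k H g h : Type*} [Field k] [CharZero k] [Ring H] [HopfAlgebra k H]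
    [IsCocomm k H]
    [AddCommGroup g] [Module k g] [Module H g] [IsScalarTower k H g]
    [AddCommGroup h] [Module k h] [Module H h] [IsScalarTower k H h]
    (Ω : Cochain k H 2 (g × h) (g × h)) (hΩ : IsQuasiTwilled Ω) :
    -- the decomposition of the pseudobracket
    Ω = piLift Ω + rhoLift Ω + muLift Ω + etaLift Ω + thetaLift Ω ∧
    -- the curved `V`-datum
    Function.Injective (embed k H g h) ∧
    IsCurvedVDatum (degreePart k H (g × h) (g × h)) (nrBracket k H (g × h))
      (LinearMap.range (embed k H g h)) (projK k H g h) (ofDegree k H (g × h) (g × h) 1 Ω) ∧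
    -- the induced curved `L∞`-structure and its operations
    IsCurvedLInfinityAlgebra (k := k) (V := CochainSpace k H g h) (degreePart k H g h) (derivedBracket Ω) ∧
    (∀ (n : ℕ) (f : Fin n → CochainSpace k H g h),
      embed k H g h (derivedBracket Ω n f) =
        projK k H g h (iterBracket (nrBracket k H (g × h)) (ofDegree k H (g × h) (g × h) 1 Ω) n
          fun i => embed k H g h (f i))) ∧
    embed k H g h (derivedBracket Ω 0 ![]) = ofDegree k H (g × h) (g × h) 1 (thetaLift Ω) ∧
    (∀ f : CochainSpace k H g h,
      embed k H g h (derivedBracket Ω 1 ![f]) =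
        nrBracket k H (g × h) (ofDegree k H (g × h) (g × h) 1 (piLift Ω + rhoLift Ω))
          (embed k H g h f)) ∧
    (∀ f₁ f₂ : CochainSpace k H g h,
      embed k H g h (derivedBracket Ω 2 ![f₁, f₂]) =
        nrBracket k H (g × h)
          (nrBracket k H (g × h) (ofDegree k H (g × h) (g × h) 1 (muLift Ω + etaLift Ω))
            (embed k H g h f₁))
          (embed k H g h f₂)) ∧
    (∀ n : ℕ, 3 ≤ n → derivedBracket Ω n = 0) ∧
    -- the Maurer–Cartan characterization of deformation maps of type I
    ∀ D : g →ₗ[H] h,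
      let D' : CochainSpace k H g h := ofDegree k H g h 0 (Cochain.ofHom D)
      IsDeformationMapI Ω D ↔
        derivedBracket Ω 0 ![] + derivedBracket Ω 1 ![D'] +
          (2⁻¹ : k) • derivedBracket Ω 2 ![D', D'] = 0 := by
  exact ⟨hΩ.eq_add, embed_injective, hΩ.isCurvedVDatum, hΩ.isCurvedLInfinityAlgebra,
    embed_derivedBracket Ω, hΩ.embed_derivedBracket_zero _, fun f => hΩ.embed_derivedBracket_one _,
    fun f₁ f₂ => hΩ.embed_derivedBracket_two _, hΩ.derivedBracket_eq_zero,
    fun D => isDeformationMapI_iff Ω D⟩
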